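/- Let $k$ be an algebraically closed field of characteristic zero (for instance $k=\mathbb C$), let $\Gamma$ be a finite abelian group, and let $$k \to B \overset{i}{\to} A \overset{p}{\to} k\Gamma \to k$$ be a cocentral exact sequence of Hopf algebras over $k$. That is, $i$ and $p$ are Hopf algebra maps such that: $i$ is injective and $p$ is surjective; $\ker p = A\,i(B)^+ = i(B)^+A$, where $i(B)^+ = i(B)\cap\ker\varepsilon$; $i(B)=\{a\in A : a_{(1)}\otimes p(a_{(2)}) = a\otimes 1\}=\{a\in A : p(a_{(1)})\otimes a_{(2)} = 1\otimes a\}$; and $p(a_{(1)})\otimes a_{(2)}=p(a_{(2)})\otimes a_{(1)}$ for all $a\in A$ (cocentrality). For a Hopf algebra $H$ let $\mathrm{cd}(H)=\sup\{n : H^n(H,M)\neq 0 \text{ for some } H\text{-bimodule } M\}\in\mathbb N\cup\{\infty\}$, where $H^n(H,M)=\mathrm{Ext}^n_{H\otimes H^{op}}(H,M)$ is Hochschild cohomology, be its Hochschild cohomological dimension. Let $\mathrm{cd}_{GS}(H)=\sup\{n : \mathrm{Ext}^n_{\mathcal{YD}_H^H}(k,V)\neq 0\text{ for some } V\in\mathcal{YD}_H^H\}\in\mathbb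 N\cup\{\infty\}$ be its Gerstenhaber-Schack cohomological dimension. Here $\mathcal{YD}_H^H$ is the abelian category of right-right Yetter-Drinfeld modules over $H$, i.e. right $H$-modules and right $H$-comodules $V$ with $(v\cdot a)_{(0)}\otimes (v\cdot a)_{(1)}=v_{(0)}\cdot a_{(2)}\otimes S(a_{(1)})v_{(1)}a_{(3)}$ for all $v\in V$, $a\in H$, with $H$-linear and $H$-colinear maps as morphisms, and $k$ is the trivial Yetter-Drinfeld module. Then $\mathrm{cd}(A)=\mathrm{cd}(B)$. If moreover $A$ is cosemisimple (every right $A$-comodule is completely reducible), then $\mathrm{cd}_{GS}(A)=\mathrm{cd}_{GS}(B)$. -/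

import Mathlib

open CategoryTheory CategoryTheory.Limits
open scoped TensorProduct

universe w v u

noncomputable section

namespace HopfDim

/-! ### Comodules and cosemisimplicity -/

/-- A right comodule structure on the `k`-module `V` over the coalgebra `A`. -/
class RightComodule (k : Type u) (A : Type v) (V : Type w) [CommRing k] [AddCommGroup A]
    [Module k A] [Coalgebra k A] [AddCommGroup V] [Module k V] where
  /-- The coaction `v ↦ v₍₀₎ ⊗ v₍₁₎`. -/
  coact : V →ₗ[k] V ⊗[k] A
  /-- Coassociativity. -/
  coassoc : (TensorProduct.assoc k V A A).toLinearMap ∘ₗ coact.rTensor A ∘ₗ coact =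
    (Coalgebra.comul (R := k) (A := A)).lTensor V ∘ₗ coact
  /-- The counit axiom `v₍₀₎ ε(v₍₁₎) = v`. -/
  counit_coact : (TensorProduct.rid k V).toLinearMap ∘ₗ
    (Coalgebra.counit (R := k) (A := A)).lTensor V ∘ₗ coact = LinearMap.id

/-- `W ⊆ V` is a subcomodule: the coaction maps `W` into `W ⊗ A`. -/
def IsSubcomodule (k : Type u) (A : Type v) {V : Type w} [CommRing k] [AddCommGroup A]
    [Module k A] [Coalgebra k A] [AddCommGroup V] [Module k V] [RightComodule k A V]
    (W : Submodule k V) : Prop :=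
  ∀ x ∈ W, RightComodule.coact (A := A) x ∈ LinearMap.range (W.subtype.rTensor A)

/-- The coalgebra `A` is cosemisimple: every right `A`-comodule is completely reducible, that is,
every subcomodule has a complementary subcomodule. -/
def IsCosemisimple (k A : Type u) [CommRing k] [AddCommGroup A] [Module k A]
    [Coalgebra k A] : Prop :=
  ∀ (V : Type u) [AddCommGroup V] [Module k V] [RightComodule k A V] (W : Submodule k V),
    IsSubcomodule k A W → ∃ W' : Submodule k V, IsSubcomodule k A W' ∧ IsCompl W W'

/-! ### Exact sequences of Hopf algebras -/

section Exact

variable {k : Type*} [Field k] {A B L : Type*} [Ring A] [HopfAlgebra k A]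
  [Ring B] [HopfAlgebra k B] [Ring L] [HopfAlgebra k L]

/-- `i(B)⁺ = i(B) ∩ ker ε`, as a subspace of `A`. -/
def augImage (i : B →ₐc[k] A) : Submodule k A :=
  LinearMap.range (i : B →ₗ[k] A) ⊓ LinearMap.ker (Coalgebra.counit (R := k) (A := A))

/-- `k → B → A → L → k` is an exact sequence of Hopf algebras. -/
structure IsHopfExact (i : B →ₐc[k] A) (p : A →ₐc[k] L) : Prop where
  injective : Function.Injective i
  surjective : Function.Surjective p
  /-- `ker p = A i(B)⁺`. -/
  ker_eq_left : LinearMap.ker (p : A →ₗ[k] L) = ⊤ * augImage i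
  /-- `ker p = i(B)⁺ A`. -/
  ker_eq_right : LinearMap.ker (p : A →ₗ[k] L) = augImage i * ⊤
  /-- `i(B)` is the space of right coinvariants, `a₍₁₎ ⊗ p(a₍₂₎) = a ⊗ 1`. -/
  mem_range_iff_right (a : A) : (∃ b, i b = a) ↔
    (p : A →ₗ[k] L).lTensor A (Coalgebra.comul (R := k) a) = a ⊗ₜ[k] (1 : L)
  /-- `i(B)` is the space of left coinvariants, `p(a₍₁₎) ⊗ a₍₂₎ = 1 ⊗ a`. -/
  mem_range_iff_left (a : A) : (∃ b, i b = a) ↔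
    (p : A →ₗ[k] L).rTensor A (Coalgebra.comul (R := k) a) = (1 : L) ⊗ₜ[k] a

/-- `p` is cocentral: `p(a₍₁₎) ⊗ a₍₂₎ = p(a₍₂₎) ⊗ a₍₁₎` for all `a`. -/
def IsCocentral (p : A →ₐc[k] L) : Prop :=
  ∀ a : A, (p : A →ₗ[k] L).rTensor A (Coalgebra.comul (R := k) a) =
    (p : A →ₗ[k] L).rTensor A (TensorProduct.comm k A A (Coalgebra.comul (R := k) a))

end Exact

/-! ### Right-right Yetter-Drinfeld modules -/

section YD

variable (k : Type u) [Field k] (A : Type u) [Ring A] [HopfAlgebra k A]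

/-- Right multiplication `b ↦ (v ↦ v · b)` of a right `A`-module, as a `k`-linear map. -/
def rightAct (V : Type u) [AddCommGroup V] [Module k V] [Module Aᵐᵒᵖ V]
    [IsScalarTower k Aᵐᵒᵖ V] : A →ₗ[k] Module.End k V :=
  (Algebra.lsmul k k V : Aᵐᵒᵖ →ₐ[k] Module.End k V).toLinearMap ∘ₗ
    (MulOpposite.opLinearEquiv k : A ≃ₗ[k] Aᵐᵒᵖ).toLinearMap

/-- The linear map `a ⊗ c ↦ (x ↦ S(a) x c)`. -/
def antipodeMul : A ⊗[k] A →ₗ[k] Module.End k A :=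
  TensorProduct.lift (LinearMap.mk₂ k
    (fun a c => LinearMap.mulRight k c ∘ₗ LinearMap.mulLeft k (HopfAlgebra.antipode k a))
    (by intros; ext; simp [add_mul]) (by intros; ext; simp)
    (by intros; ext; simp [mul_add]) (by intros; ext; simp))

/-- The linear map `a ⊗ (b ⊗ c) ↦ (v ⊗ x ↦ v · b ⊗ S(a) x c)`. -/
def ydTwist (V : Type u) [AddCommGroup V] [Module k V] [Module Aᵐᵒᵖ V]
    [IsScalarTower k Aᵐᵒᵖ V] : A ⊗[k] (A ⊗[k] A) →ₗ[k] Module.End k (V ⊗[k] A) :=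
  TensorProduct.homTensorHomMap (RingHom.id k) V A V A ∘ₗ
    TensorProduct.map (rightAct k A V) (antipodeMul k A) ∘ₗ
    (TensorProduct.leftComm k A A A).toLinearMap

variable {k A} in
@[simp] lemma ydTwist_tmul {V : Type u} [AddCommGroup V] [Module k V] [Module Aᵐᵒᵖ V]
    [IsScalarTower k Aᵐᵒᵖ V] (a b c x : A) (v : V) :
    ydTwist k A V (a ⊗ₜ (b ⊗ₜ c)) (v ⊗ₜ x) =
      (MulOpposite.op b • v) ⊗ₜ (HopfAlgebra.antipode k a * x * c) := by
  simp [ydTwist, rightAct, antipodeMul]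

/-- The iterated comultiplication `a ↦ a₍₁₎ ⊗ (a₍₂₎ ⊗ a₍₃₎)`. -/
def comul₂ : A →ₗ[k] A ⊗[k] (A ⊗[k] A) :=
  (Coalgebra.comul (R := k) (A := A)).lTensor A ∘ₗ Coalgebra.comul (R := k) (A := A)

/-- A right-right Yetter-Drinfeld module over `A`: a right `A`-module (a module over `Aᵐᵒᵖ`) and
right `A`-comodule `V` with
`(v · a)₍₀₎ ⊗ (v · a)₍₁₎ = v₍₀₎ · a₍₂₎ ⊗ S(a₍₁₎) v₍₁₎ a₍₃₎`. -/
structure YDModule where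
  carrier : Type u
  [addCommGroup : AddCommGroup carrier]
  [module : Module k carrier]
  [moduleOp : Module Aᵐᵒᵖ carrier]
  [isScalarTower : IsScalarTower k Aᵐᵒᵖ carrier]
  [comodule : RightComodule k A carrier]
  yd : ∀ (v : carrier) (a : A),
    RightComodule.coact (k := k) (A := A) (MulOpposite.op a • v) =
      ydTwist k A carrier (comul₂ k A a) (RightComodule.coact (k := k) (A := A) v)

attribute [instance] YDModule.addCommGroup YDModule.module YDModule.moduleOp
  YDModule.isScalarTower YDModule.comodule

variable {k A}

namespace YDModule

/-- The coaction of a Yetter-Drinfeld module. -/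
abbrev coact (V : YDModule k A) : V.carrier →ₗ[k] V.carrier ⊗[k] A :=
  RightComodule.coact

/-- Morphisms of Yetter-Drinfeld modules: the `A`-linear `A`-colinear maps. -/
@[ext]
structure Hom (V W : YDModule k A) where
  map : V.carrier →ₗ[Aᵐᵒᵖ] W.carrier
  colinear : (map.restrictScalars k).rTensor A ∘ₗ V.coact = W.coact ∘ₗ map.restrictScalars k

lemma Hom.colinear_apply {V W : YDModule k A} (f : Hom V W) (v : V.carrier) :
    W.coact (f.map v) = (f.map.restrictScalars k).rTensor A (V.coact v) :=
  (LinearMap.congr_fun f.colinear v).symm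

instance : Category (YDModule k A) where
  Hom V W := Hom V W
  id V := ⟨LinearMap.id, by
    have : (LinearMap.id (R := Aᵐᵒᵖ) (M := V.carrier)).restrictScalars k = LinearMap.id := rfl
    rw [this, LinearMap.rTensor_id]; rfl⟩
  comp f g := ⟨g.map ∘ₗ f.map, by
    have : (g.map ∘ₗ f.map).restrictScalars k =
      g.map.restrictScalars k ∘ₗ f.map.restrictScalars k := rfl
    rw [this, LinearMap.rTensor_comp, LinearMap.comp_assoc, f.colinear, ← LinearMap.comp_assoc,
      g.colinear, LinearMap.comp_assoc]⟩

/-- The underlying `A`-linear map of a morphism. -/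
abbrev mapOf {V W : YDModule k A} (f : V ⟶ W) : V.carrier →ₗ[Aᵐᵒᵖ] W.carrier := Hom.map f

@[ext] lemma hom_ext {V W : YDModule k A} {f g : V ⟶ W} (h : ∀ x, mapOf f x = mapOf g x) :
    f = g := Hom.ext (LinearMap.ext h)

@[simp] lemma mapOf_id (V : YDModule k A) : mapOf (𝟙 V) = LinearMap.id := rfl

@[simp] lemma mapOf_comp {U V W : YDModule k A} (f : U ⟶ V) (g : V ⟶ W) :
    mapOf (f ≫ g) = mapOf g ∘ₗ mapOf f := rfl

lemma coact_mapOf {V W : YDModule k A} (f : V ⟶ W) (v : V.carrier) :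
    W.coact (mapOf f v) = ((mapOf f).restrictScalars k).rTensor A (V.coact v) :=
  Hom.colinear_apply f v

section Preadditive

variable {V W : YDModule k A}

instance : Zero (V ⟶ W) := ⟨(⟨0, by
  have : (0 : V.carrier →ₗ[Aᵐᵒᵖ] W.carrier).restrictScalars k = 0 := rfl
  simp [this]⟩ : Hom V W)⟩

instance : Add (V ⟶ W) := ⟨fun f g => (⟨mapOf f + mapOf g, by
  have : (mapOf f + mapOf g).restrictScalars k =
    (mapOf f).restrictScalars k + (mapOf g).restrictScalars k := rfl
  rw [this, LinearMap.rTensor_add, LinearMap.add_comp, LinearMap.comp_add, Hom.colinear f,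
    Hom.colinear g]⟩ : Hom V W)⟩

instance : Neg (V ⟶ W) := ⟨fun f => (⟨-mapOf f, by
  have : (-mapOf f).restrictScalars k = -(mapOf f).restrictScalars k := rfl
  rw [this, LinearMap.rTensor_neg, LinearMap.neg_comp, LinearMap.comp_neg, Hom.colinear f]⟩ :
    Hom V W)⟩

@[simp] lemma mapOf_zero : mapOf (0 : V ⟶ W) = 0 := rfl

@[simp] lemma mapOf_add (f g : V ⟶ W) : mapOf (f + g) = mapOf f + mapOf g := rfl

@[simp] lemma mapOf_neg (f : V ⟶ W) : mapOf (-f) = -mapOf f := rfl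

instance : AddCommGroup (V ⟶ W) where
  add_assoc f g h := by ext; simp [add_assoc]
  zero_add f := by ext; simp
  add_zero f := by ext; simp
  add_comm f g := by ext; simp [add_comm]
  neg_add_cancel f := by ext; simp
  nsmul := nsmulRec
  zsmul := zsmulRec

end Preadditive

instance : Preadditive (YDModule k A) where
  add_comp := by intros; ext; simp
  comp_add := by intros; ext; simp

/-! ### Sub-objects, quotients and sums -/

section Transport

variable {V : Type u} [AddCommGroup V] [Module k V] [Module Aᵐᵒᵖ V] [IsScalarTower k Aᵐᵒᵖ V]

/-- Naturality of `ydTwist` in `A`-linear maps. -/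
lemma rTensor_ydTwist {W : Type u} [AddCommGroup W] [Module k W] [Module Aᵐᵒᵖ W]
    [IsScalarTower k Aᵐᵒᵖ W] (f : V →ₗ[Aᵐᵒᵖ] W) (t : A ⊗[k] (A ⊗[k] A)) (s : V ⊗[k] A) :
    (f.restrictScalars k).rTensor A (ydTwist k A V t s) =
      ydTwist k A W t ((f.restrictScalars k).rTensor A s) := by
  induction t with
  | zero => simp
  | add t₁ t₂ h₁ h₂ => simp [h₁, h₂]
  | tmul a t =>
    induction t with
    | zero => simp
    | add t₁ t₂ h₁ h₂ => simp [TensorProduct.tmul_add, h₁, h₂]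
    | tmul b c =>
      induction s with
      | zero => simp
      | add s₁ s₂ h₁ h₂ => simp [h₁, h₂]
      | tmul v x => simp

end Transport

section Linear

variable {V W : Type u} [AddCommGroup V] [Module k V] [AddCommGroup W] [Module k W]
  {c : V →ₗ[k] V ⊗[k] A} {d : W →ₗ[k] W ⊗[k] A} {f : V →ₗ[k] W}

lemma coassoc_left_nat (h : d ∘ₗ f = f.rTensor A ∘ₗ c) :
    ((TensorProduct.assoc k W A A).toLinearMap ∘ₗ d.rTensor A ∘ₗ d) ∘ₗ f =
      f.rTensor (A ⊗[k] A) ∘ₗ (TensorProduct.assoc k V A A).toLinearMap ∘ₗ c.rTensor A ∘ₗ c := by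
  have e : f.rTensor (A ⊗[k] A) ∘ₗ (TensorProduct.assoc k V A A).toLinearMap =
      (TensorProduct.assoc k W A A).toLinearMap ∘ₗ (f.rTensor A).rTensor A := by
    ext; simp
  rw [← LinearMap.comp_assoc _ _ (f.rTensor (A ⊗[k] A)), e, LinearMap.comp_assoc,
    LinearMap.comp_assoc, LinearMap.comp_assoc, h, ← LinearMap.comp_assoc c,
    ← LinearMap.rTensor_comp, h, LinearMap.rTensor_comp, LinearMap.comp_assoc]

lemma coassoc_right_nat (h : d ∘ₗ f = f.rTensor A ∘ₗ c) :
    ((Coalgebra.comul (R := k) (A := A)).lTensor W ∘ₗ d) ∘ₗ f =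
      f.rTensor (A ⊗[k] A) ∘ₗ (Coalgebra.comul (R := k) (A := A)).lTensor V ∘ₗ c := by
  have e : f.rTensor (A ⊗[k] A) ∘ₗ (Coalgebra.comul (R := k) (A := A)).lTensor V =
      (Coalgebra.comul (R := k) (A := A)).lTensor W ∘ₗ f.rTensor A := by
    ext; simp
  rw [← LinearMap.comp_assoc, e, LinearMap.comp_assoc, LinearMap.comp_assoc, h]

lemma counit_nat (h : d ∘ₗ f = f.rTensor A ∘ₗ c) :
    ((TensorProduct.rid k W).toLinearMap ∘ₗ
      (Coalgebra.counit (R := k) (A := A)).lTensor W ∘ₗ d) ∘ₗ f =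
    f ∘ₗ (TensorProduct.rid k V).toLinearMap ∘ₗ
      (Coalgebra.counit (R := k) (A := A)).lTensor V ∘ₗ c := by
  have e : f ∘ₗ (TensorProduct.rid k V).toLinearMap ∘ₗ
      (Coalgebra.counit (R := k) (A := A)).lTensor V =
      (TensorProduct.rid k W).toLinearMap ∘ₗ
        (Coalgebra.counit (R := k) (A := A)).lTensor W ∘ₗ f.rTensor A := by
    ext; simp
  rw [LinearMap.comp_assoc, LinearMap.comp_assoc, h, ← LinearMap.comp_assoc c,
    ← LinearMap.comp_assoc c, ← e]
  rfl

lemma exists_lift {R M N P : Type*} [Ring R] [AddCommGroup M] [AddCommGroup N] [AddCommGroup P]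
    [Module R M] [Module R N] [Module R P] (i : N →ₗ[R] M) (hi : Function.Injective i)
    (g : P →ₗ[R] M) (h : ∀ x, g x ∈ LinearMap.range i) : ∃ l : P →ₗ[R] N, ∀ x, i (l x) = g x :=
  ⟨(LinearEquiv.ofInjective i hi).symm.toLinearMap ∘ₗ g.codRestrict _ h, fun x => by
    have := congrArg Subtype.val
      ((LinearEquiv.ofInjective i hi).apply_symm_apply (g.codRestrict _ h x))
    exact this⟩

lemma exists_desc {R M N P : Type*} [Ring R] [AddCommGroup M] [AddCommGroup N] [AddCommGroup P]
    [Module R M] [Module R N] [Module R P] (q : M →ₗ[R] N) (hq : Function.Surjective q)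
    (g : M →ₗ[R] P) (h : ∀ x, q x = 0 → g x = 0) : ∃ l : N →ₗ[R] P, ∀ x, l (q x) = g x :=
  ⟨(LinearMap.ker q).liftQ g (fun x hx => h x hx) ∘ₗ
    (q.quotKerEquivOfSurjective hq).symm.toLinearMap, fun x => by
    have : (q.quotKerEquivOfSurjective hq).symm (q x) = Submodule.Quotient.mk x := by
      rw [LinearEquiv.symm_apply_eq]; rfl
    simp only [LinearMap.comp_apply, LinearEquiv.coe_coe, this]
    exact Submodule.liftQ_apply _ _ _⟩

end Linear

section Transport

variable {V : Type u} [AddCommGroup V] [Module k V] [Module Aᵐᵒᵖ V] [IsScalarTower k Aᵐᵒᵖ V]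

/-- The Yetter-Drinfeld structure on `V` for which an injective `A`-linear map from `V` to a
Yetter-Drinfeld module is a morphism. -/
abbrev ofInjective (W : YDModule k A) (f : V →ₗ[Aᵐᵒᵖ] W.carrier) (hf : Function.Injective f)
    (c : V →ₗ[k] V ⊗[k] A)
    (hc : ∀ v, (f.restrictScalars k).rTensor A (c v) = W.coact (f v)) : YDModule k A :=
  have hf' : Function.Injective (f.restrictScalars k) := hf
  have h : W.coact ∘ₗ f.restrictScalars k = (f.restrictScalars k).rTensor A ∘ₗ c :=
    LinearMap.ext fun v => (hc v).symm
  letI : RightComodule k A V :=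
    { coact := c
      coassoc := by
        have hinj : Function.Injective ((f.restrictScalars k).rTensor (A ⊗[k] A)) :=
          Module.Flat.rTensor_preserves_injective_linearMap _ hf'
        rw [← LinearMap.cancel_left hinj, ← coassoc_left_nat h, ← coassoc_right_nat h]
        exact congrArg (· ∘ₗ f.restrictScalars k) W.comodule.coassoc
      counit_coact := by
        rw [← LinearMap.cancel_left hf', ← counit_nat h, W.comodule.counit_coact]
        rfl }
  { carrier := V
    yd := fun v a => by
      apply Module.Flat.rTensor_preserves_injective_linearMap (M := A) _ hf'
      rw [rTensor_ydTwist]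
      exact (hc _).trans ((congrArg W.coact (f.map_smul _ v)).trans ((W.yd _ a).trans
        (congrArg _ (hc v).symm))) }

/-- The Yetter-Drinfeld structure on `V` for which a surjective `A`-linear map from a
Yetter-Drinfeld module to `V` is a morphism. -/
abbrev ofSurjective (W : YDModule k A) (f : W.carrier →ₗ[Aᵐᵒᵖ] V) (hf : Function.Surjective f)
    (c : V →ₗ[k] V ⊗[k] A)
    (hc : ∀ w, c (f w) = (f.restrictScalars k).rTensor A (W.coact w)) : YDModule k A :=
  have hf' : Function.Surjective (f.restrictScalars k) := hf
  have h : c ∘ₗ f.restrictScalars k = (f.restrictScalars k).rTensor A ∘ₗ W.coact :=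
    LinearMap.ext hc
  letI : RightComodule k A V :=
    { coact := c
      coassoc := by
        rw [← LinearMap.cancel_right hf', coassoc_left_nat h, coassoc_right_nat h]
        exact congrArg _ W.comodule.coassoc
      counit_coact := by
        rw [← LinearMap.cancel_right hf', counit_nat h, W.comodule.counit_coact]
        rfl }
  { carrier := V
    yd := fun v a => by
      obtain ⟨w, rfl⟩ := hf v
      have := hc (MulOpposite.op a • w)
      rw [f.map_smul, W.yd, rTensor_ydTwist] at this
      exact this.trans (congrArg _ (hc w).symm) }

/-- The inclusion of `ofInjective`. -/
def ofInjectiveHom (W : YDModule k A) (f : V →ₗ[Aᵐᵒᵖ] W.carrier) (hf : Function.Injective f)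
    (c : V →ₗ[k] V ⊗[k] A)
    (hc : ∀ v, (f.restrictScalars k).rTensor A (c v) = W.coact (f v)) :
    ofInjective W f hf c hc ⟶ W :=
  (⟨f, LinearMap.ext hc⟩ : Hom (ofInjective W f hf c hc) W)

/-- The projection onto `ofSurjective`. -/
def ofSurjectiveHom (W : YDModule k A) (f : W.carrier →ₗ[Aᵐᵒᵖ] V) (hf : Function.Surjective f)
    (c : V →ₗ[k] V ⊗[k] A)
    (hc : ∀ w, c (f w) = (f.restrictScalars k).rTensor A (W.coact w)) :
    W ⟶ ofSurjective W f hf c hc :=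
  (⟨f, LinearMap.ext fun w => (hc w).symm⟩ : Hom W (ofSurjective W f hf c hc))

end Transport

/-- The coaction on the direct sum of two Yetter-Drinfeld modules. -/
abbrev prodCoact (V W : YDModule k A) :
    V.carrier × W.carrier →ₗ[k] (V.carrier × W.carrier) ⊗[k] A :=
  LinearMap.coprod ((LinearMap.inl k V.carrier W.carrier).rTensor A ∘ₗ V.coact)
    ((LinearMap.inr k V.carrier W.carrier).rTensor A ∘ₗ W.coact)

lemma prodCoact_inl (V W : YDModule k A) : prodCoact V W ∘ₗ LinearMap.inl k _ _ =
    (LinearMap.inl k V.carrier W.carrier).rTensor A ∘ₗ V.coact := LinearMap.coprod_inl _ _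

lemma prodCoact_inr (V W : YDModule k A) : prodCoact V W ∘ₗ LinearMap.inr k _ _ =
    (LinearMap.inr k V.carrier W.carrier).rTensor A ∘ₗ W.coact := LinearMap.coprod_inr _ _

/-- The direct sum of two Yetter-Drinfeld modules. -/
abbrev prod (V W : YDModule k A) : YDModule k A :=
  letI : RightComodule k A (V.carrier × W.carrier) :=
    { coact := prodCoact V W
      coassoc := by
        apply LinearMap.prod_ext
        · rw [coassoc_left_nat (prodCoact_inl V W), coassoc_right_nat (prodCoact_inl V W)]
          exact congrArg _ V.comodule.coassoc
        · rw [coassoc_left_nat (prodCoact_inr V W), coassoc_right_nat (prodCoact_inr V W)]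
          exact congrArg _ W.comodule.coassoc
      counit_coact := by
        apply LinearMap.prod_ext
        · rw [counit_nat (prodCoact_inl V W), V.comodule.counit_coact]; rfl
        · rw [counit_nat (prodCoact_inr V W), W.comodule.counit_coact]; rfl }
  { carrier := V.carrier × W.carrier
    yd := fun v a => by
      obtain ⟨v, w⟩ := v
      change prodCoact V W _ = ydTwist k A _ _ (prodCoact V W _)
      have h1 := rTensor_ydTwist (LinearMap.inl Aᵐᵒᵖ V.carrier W.carrier) (comul₂ k A a)
        (V.coact v)
      have h2 := rTensor_ydTwist (LinearMap.inr Aᵐᵒᵖ V.carrier W.carrier) (comul₂ k A a)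
        (W.coact w)
      rw [← V.yd] at h1
      rw [← W.yd] at h2
      rw [LinearMap.coprod_apply, LinearMap.coprod_apply, map_add]
      exact congrArg₂ (· + ·) h1 h2 }

/-- The zero Yetter-Drinfeld module. -/
abbrev zeroObj : YDModule k A :=
  letI : RightComodule k A PUnit.{u + 1} :=
    { coact := 0
      coassoc := by simp
      counit_coact := Subsingleton.elim _ _ }
  { carrier := PUnit.{u + 1}
    yd := fun v a => by
      change (0 : PUnit.{u + 1} ⊗[k] A) = ydTwist k A _ _ 0
      simp }

/-- The trivial Yetter-Drinfeld module `k`: `x · a = ε(a) x` and `x ↦ x ⊗ 1`. -/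
def trivial (k A : Type u) [Field k] [Ring A] [HopfAlgebra k A] : YDModule k A :=
  letI : Module Aᵐᵒᵖ k := Module.compHom k
    ((Bialgebra.counitAlgHom k A).fromOpposite (fun _ _ => Commute.all _ _)).toRingHom
  have hs : ∀ (a : Aᵐᵒᵖ) (x : k), a • x = Coalgebra.counit (R := k) a.unop * x :=
    fun _ _ => rfl
  haveI : IsScalarTower k Aᵐᵒᵖ k := ⟨fun r a x => by simp [hs, mul_assoc]⟩
  letI : RightComodule k A k :=
    { coact := (TensorProduct.mk k k A).flip 1
      coassoc := by ext; simp [Algebra.TensorProduct.one_def]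
      counit_coact := by ext; simp }
  { carrier := k
    yd := fun x a => by
      change (TensorProduct.mk k k A).flip 1 _ =
        ydTwist k A k (comul₂ k A a) ((TensorProduct.mk k k A).flip 1 x)
      have key : ∀ t : A ⊗[k] (A ⊗[k] A), ydTwist k A k t (x ⊗ₜ 1) =
          x ⊗ₜ LinearMap.mul' k A ((HopfAlgebra.antipode k).rTensor A
            ((TensorProduct.lid k A).toLinearMap.lTensor A
              (((Coalgebra.counit (R := k) (A := A)).rTensor A).lTensor A t))) := by
        intro t
        induction t with
        | zero => simp
        | add t₁ t₂ h₁ h₂ => simp [h₁, h₂, TensorProduct.tmul_add]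
        | tmul a t =>
          induction t with
          | zero => simp
          | add t₁ t₂ h₁ h₂ => simp [TensorProduct.tmul_add, h₁, h₂]
          | tmul b c => simp [hs, TensorProduct.smul_tmul']
      have h2 : (TensorProduct.lid k A).toLinearMap.lTensor A
          (((Coalgebra.counit (R := k) (A := A)).rTensor A).lTensor A (comul₂ k A a)) =
          Coalgebra.comul (R := k) a := by
        have e : (TensorProduct.lid k A).toLinearMap ∘ₗ
            (Coalgebra.counit (R := k) (A := A)).rTensor A ∘ₗ
              Coalgebra.comul (R := k) (A := A) = LinearMap.id := by
          ext; simp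
        rw [comul₂, LinearMap.comp_apply, ← LinearMap.comp_apply, ← LinearMap.comp_apply,
          ← LinearMap.lTensor_comp, ← LinearMap.lTensor_comp, LinearMap.comp_assoc, e,
          LinearMap.lTensor_id]
        rfl
      rw [LinearMap.flip_apply, LinearMap.flip_apply, TensorProduct.mk_apply,
        TensorProduct.mk_apply, key, h2, HopfAlgebra.mul_antipode_rTensor_comul_apply, hs,
        Algebra.algebraMap_eq_smul_one, TensorProduct.tmul_smul, TensorProduct.smul_tmul']
      rfl }

/-! ### The category of Yetter-Drinfeld modules is abelian -/

section Abelian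

variable {V W X : YDModule k A}

lemma restrictScalars_rTensor_injective {f : V ⟶ W} (hf : Function.Injective (mapOf f)) :
    Function.Injective (((mapOf f).restrictScalars k).rTensor A) :=
  Module.Flat.rTensor_preserves_injective_linearMap _ hf

lemma hom_lift (f : V ⟶ W) (hf : Function.Injective (mapOf f)) (g : X ⟶ W)
    (h : ∀ x, mapOf g x ∈ LinearMap.range (mapOf f)) : ∃ l : X ⟶ V, l ≫ f = g := by
  obtain ⟨l, hl⟩ := exists_lift (mapOf f) hf (mapOf g) h
  have hl' : (mapOf f).restrictScalars k ∘ₗ l.restrictScalars k =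
    (mapOf g).restrictScalars k := LinearMap.ext hl
  refine ⟨(⟨l, LinearMap.ext fun x => ?_⟩ : Hom X V), hom_ext hl⟩
  apply restrictScalars_rTensor_injective hf
  rw [LinearMap.comp_apply, ← LinearMap.comp_apply, ← LinearMap.rTensor_comp, hl',
    LinearMap.comp_apply, ← coact_mapOf f, ← coact_mapOf g]
  exact congrArg _ (hl x).symm

lemma hom_desc (f : V ⟶ W) (hf : Function.Surjective (mapOf f)) (g : V ⟶ X)
    (h : ∀ x, mapOf f x = 0 → mapOf g x = 0) : ∃ l : W ⟶ X, f ≫ l = g := by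
  obtain ⟨l, hl⟩ := exists_desc (mapOf f) hf (mapOf g) h
  have hl' : l.restrictScalars k ∘ₗ (mapOf f).restrictScalars k =
    (mapOf g).restrictScalars k := LinearMap.ext hl
  refine ⟨(⟨l, LinearMap.ext fun y => ?_⟩ : Hom W X), hom_ext hl⟩
  obtain ⟨x, rfl⟩ := hf y
  rw [LinearMap.comp_apply, coact_mapOf f, ← LinearMap.comp_apply, ← LinearMap.rTensor_comp, hl',
    ← coact_mapOf g]
  exact congrArg X.coact (hl x).symm

lemma exists_kernel_aux (f : V ⟶ W) (U : Type u) [AddCommGroup U] [Module k U] [Module Aᵐᵒᵖ U]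
    [IsScalarTower k Aᵐᵒᵖ U] (ι : U →ₗ[Aᵐᵒᵖ] V.carrier) (hinj : Function.Injective ι)
    (hex : ∀ v, mapOf f v = 0 ↔ v ∈ LinearMap.range ι) :
    ∃ (K : YDModule k A) (i : K ⟶ V),
      Function.Injective (mapOf i) ∧ ∀ v, mapOf f v = 0 ↔ v ∈ LinearMap.range (mapOf i) := by
  have hex' : Function.Exact (ι.restrictScalars k) ((mapOf f).restrictScalars k) := fun v => hex v
  have hinj' : Function.Injective ((ι.restrictScalars k).rTensor A) :=
    Module.Flat.rTensor_preserves_injective_linearMap _ hinj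
  have hr : ∀ x, (V.coact ∘ₗ ι.restrictScalars k) x ∈
      LinearMap.range ((ι.restrictScalars k).rTensor A) := fun x => by
    refine (Module.Flat.rTensor_exact A hex' _).1 ?_
    have h0 : mapOf f (ι x) = 0 := (hex _).2 ⟨x, rfl⟩
    have := coact_mapOf f (ι x)
    rw [h0, map_zero] at this
    exact this.symm
  obtain ⟨c, hc⟩ := exists_lift _ hinj' (V.coact ∘ₗ ι.restrictScalars k) hr
  exact ⟨ofInjective V ι hinj c hc, ofInjectiveHom V ι hinj c hc, hinj, hex⟩

lemma exists_kernel (f : V ⟶ W) : ∃ (K : YDModule k A) (i : K ⟶ V),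
    Function.Injective (mapOf i) ∧ ∀ v, mapOf f v = 0 ↔ v ∈ LinearMap.range (mapOf i) :=
  exists_kernel_aux f (LinearMap.ker (mapOf f)) (Submodule.subtype _) Subtype.val_injective
    (fun v => by rw [Submodule.range_subtype, LinearMap.mem_ker])

lemma exists_cokernel_aux (f : V ⟶ W) (U : Type u) [AddCommGroup U] [Module k U] [Module Aᵐᵒᵖ U]
    [IsScalarTower k Aᵐᵒᵖ U] (π : W.carrier →ₗ[Aᵐᵒᵖ] U) (hs : Function.Surjective π)
    (hw : ∀ w, π w = 0 ↔ w ∈ LinearMap.range (mapOf f)) :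
    ∃ (Q : YDModule k A) (q : W ⟶ Q),
      Function.Surjective (mapOf q) ∧ ∀ w, mapOf q w = 0 ↔ w ∈ LinearMap.range (mapOf f) := by
  have hs' : Function.Surjective (π.restrictScalars k) := hs
  have h0 : π.restrictScalars k ∘ₗ (mapOf f).restrictScalars k = 0 :=
    LinearMap.ext fun v => (hw _).2 ⟨v, rfl⟩
  have hr : ∀ w, π.restrictScalars k w = 0 →
      ((π.restrictScalars k).rTensor A ∘ₗ W.coact) w = 0 := fun w h => by
    obtain ⟨v, rfl⟩ := (hw w).1 h
    rw [LinearMap.comp_apply, coact_mapOf f, ← LinearMap.comp_apply, ← LinearMap.rTensor_comp,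
      h0, LinearMap.rTensor_zero, LinearMap.zero_apply]
  obtain ⟨c, hc⟩ := exists_desc _ hs' ((π.restrictScalars k).rTensor A ∘ₗ W.coact) hr
  exact ⟨ofSurjective W π hs c hc, ofSurjectiveHom W π hs c hc, hs, hw⟩

lemma exists_cokernel (f : V ⟶ W) : ∃ (Q : YDModule k A) (q : W ⟶ Q),
    Function.Surjective (mapOf q) ∧ ∀ w, mapOf q w = 0 ↔ w ∈ LinearMap.range (mapOf f) :=
  exists_cokernel_aux f (W.carrier ⧸ LinearMap.range (mapOf f)) (Submodule.mkQ _)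
    (Submodule.mkQ_surjective _) (fun _ => Submodule.Quotient.mk_eq_zero _)

/-- An injective morphism whose range is the zero set of `g` is a kernel of `g`. -/
lemma isKernel_of {f : V ⟶ W} (hf : Function.Injective (mapOf f)) {g : W ⟶ X}
    (h : ∀ w, mapOf g w = 0 ↔ w ∈ LinearMap.range (mapOf f)) :
    ∃ w : f ≫ g = 0, Nonempty (IsLimit (KernelFork.ofι f w)) := by
  have w : f ≫ g = 0 := hom_ext fun v => (h _).2 ⟨v, rfl⟩
  have hl : ∀ {U : YDModule k A} (e : U ⟶ W), e ≫ g = 0 → ∃ l : U ⟶ V, l ≫ f = e :=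
    fun e he => hom_lift f hf e fun x => (h _).1 (LinearMap.congr_fun (congrArg mapOf he) x)
  refine ⟨w, ⟨KernelFork.IsLimit.ofι f w (fun e he => (hl e he).choose)
    (fun e he => (hl e he).choose_spec) fun e he m hm => ?_⟩⟩
  refine hom_ext fun x => hf ?_
  have := hm.trans (hl e he).choose_spec.symm
  exact LinearMap.congr_fun (congrArg mapOf this) x

/-- A surjective morphism whose zero set is the range of `g` is a cokernel of `g`. -/
lemma isCokernel_of {f : V ⟶ W} (hf : Function.Surjective (mapOf f)) {g : X ⟶ V}
    (h : ∀ v, mapOf f v = 0 ↔ v ∈ LinearMap.range (mapOf g)) :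
    ∃ w : g ≫ f = 0, Nonempty (IsColimit (CokernelCofork.ofπ f w)) := by
  have w : g ≫ f = 0 := hom_ext fun v => (h _).2 ⟨v, rfl⟩
  have hl : ∀ {U : YDModule k A} (e : V ⟶ U), g ≫ e = 0 → ∃ l : W ⟶ U, f ≫ l = e :=
    fun e he => hom_desc f hf e fun x hx => by
      obtain ⟨y, rfl⟩ := (h _).1 hx
      exact LinearMap.congr_fun (congrArg mapOf he) y
  refine ⟨w, ⟨CokernelCofork.IsColimit.ofπ f w (fun e he => (hl e he).choose)
    (fun e he => (hl e he).choose_spec) fun e he m hm => ?_⟩⟩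
  refine hom_ext fun y => ?_
  obtain ⟨x, rfl⟩ := hf y
  have := hm.trans (hl e he).choose_spec.symm
  exact LinearMap.congr_fun (congrArg mapOf this) x

lemma injective_of_mono (f : V ⟶ W) [Mono f] : Function.Injective (mapOf f) := by
  obtain ⟨K, i, -, h⟩ := exists_kernel f
  have h0 : i ≫ f = 0 ≫ f := by
    rw [zero_comp]
    exact hom_ext fun x => (h _).2 ⟨x, rfl⟩
  have hi : i = 0 := (cancel_mono f).1 h0
  refine (injective_iff_map_eq_zero _).2 fun v hv => ?_
  obtain ⟨x, rfl⟩ := (h v).1 hv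
  rw [hi]
  rfl

lemma surjective_of_epi (f : V ⟶ W) [Epi f] : Function.Surjective (mapOf f) := by
  obtain ⟨Q, q, -, h⟩ := exists_cokernel f
  have h0 : f ≫ q = f ≫ 0 := by
    rw [comp_zero]
    exact hom_ext fun x => (h _).2 ⟨x, rfl⟩
  have hq : q = 0 := (cancel_epi f).1 h0
  intro w
  exact (h w).1 (by rw [hq]; rfl)

instance : HasKernels (YDModule k A) where
  has_limit f := by
    obtain ⟨K, i, hi, h⟩ := exists_kernel f
    obtain ⟨w, ⟨l⟩⟩ := isKernel_of hi h
    exact ⟨⟨⟨_, l⟩⟩⟩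

instance : HasCokernels (YDModule k A) where
  has_colimit f := by
    obtain ⟨Q, q, hq, h⟩ := exists_cokernel f
    obtain ⟨w, ⟨l⟩⟩ := isCokernel_of hq h
    exact ⟨⟨⟨_, l⟩⟩⟩

instance : IsNormalMonoCategory (YDModule k A) where
  normalMonoOfMono f _ := by
    obtain ⟨Q, q, -, h⟩ := exists_cokernel f
    obtain ⟨w, ⟨l⟩⟩ := isKernel_of (injective_of_mono f) h
    exact ⟨⟨Q, q, w, l⟩⟩

instance : IsNormalEpiCategory (YDModule k A) where
  normalEpiOfEpi f _ := by
    obtain ⟨K, i, -, h⟩ := exists_kernel f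
    obtain ⟨w, ⟨l⟩⟩ := isCokernel_of (surjective_of_epi f) h
    exact ⟨⟨K, i, w, l⟩⟩

instance : HasTerminal (YDModule k A) :=
  IsTerminal.hasTerminal (X := (zeroObj : YDModule k A))
    (IsTerminal.ofUniqueHom (fun _ => 0) fun _ _ => hom_ext fun _ => Subsingleton.elim _ _)

lemma fst_colinear (V W : YDModule k A) :
    (LinearMap.fst k V.carrier W.carrier).rTensor A ∘ₗ prodCoact V W =
      V.coact ∘ₗ LinearMap.fst k V.carrier W.carrier := by
  apply LinearMap.prod_ext
  · rw [LinearMap.comp_assoc, prodCoact_inl, ← LinearMap.comp_assoc, ← LinearMap.rTensor_comp,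
      LinearMap.comp_assoc, LinearMap.fst_comp_inl, LinearMap.rTensor_id]
    rfl
  · rw [LinearMap.comp_assoc, prodCoact_inr, ← LinearMap.comp_assoc, ← LinearMap.rTensor_comp,
      LinearMap.comp_assoc, LinearMap.fst_comp_inr, LinearMap.rTensor_zero]
    simp

lemma snd_colinear (V W : YDModule k A) :
    (LinearMap.snd k V.carrier W.carrier).rTensor A ∘ₗ prodCoact V W =
      W.coact ∘ₗ LinearMap.snd k V.carrier W.carrier := by
  apply LinearMap.prod_ext
  · rw [LinearMap.comp_assoc, prodCoact_inl, ← LinearMap.comp_assoc, ← LinearMap.rTensor_comp,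
      LinearMap.comp_assoc, LinearMap.snd_comp_inl, LinearMap.rTensor_zero]
    simp
  · rw [LinearMap.comp_assoc, prodCoact_inr, ← LinearMap.comp_assoc, ← LinearMap.rTensor_comp,
      LinearMap.comp_assoc, LinearMap.snd_comp_inr, LinearMap.rTensor_id]
    rfl

/-- The direct sum with its inclusions and projections. -/
def prodBicone (V W : YDModule k A) : BinaryBicone V W where
  pt := prod V W
  fst := (⟨LinearMap.fst _ _ _, fst_colinear V W⟩ : Hom (prod V W) V)
  snd := (⟨LinearMap.snd _ _ _, snd_colinear V W⟩ : Hom (prod V W) W)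
  inl := (⟨LinearMap.inl _ _ _, (prodCoact_inl V W).symm⟩ : Hom V (prod V W))
  inr := (⟨LinearMap.inr _ _ _, (prodCoact_inr V W).symm⟩ : Hom W (prod V W))
  inl_fst := rfl
  inl_snd := rfl
  inr_fst := rfl
  inr_snd := rfl

instance : HasBinaryBiproducts (YDModule k A) where
  has_binary_biproduct V W := hasBinaryBiproduct_of_total (prodBicone V W)
    (hom_ext fun x => Prod.ext (add_zero x.1) (zero_add x.2))

instance : HasFiniteProducts (YDModule k A) := hasFiniteProducts_of_has_binary_and_terminal

instance : CategoryTheory.Abelian (YDModule k A) where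

end Abelian

end YDModule

end YD

/-! ### Cohomological dimensions -/

/-- `sup {n : Extⁿ(X, Y) ≠ 0 for some Y} ∈ ℕ ∪ {∞}`. -/
def extDim {C : Type v} [Category.{w} C] [Abelian C] (X : C) : ℕ∞ :=
  letI := HasExt.standard C
  ⨆ (n : ℕ) (_ : ∃ Y : C, Nontrivial (Abelian.Ext.{max v w} X Y n)), (n : ℕ∞)

/-- The Hochschild cohomological dimension `cd(A) = sup {n : Hⁿ(A, M) ≠ 0 for some bimodule M}`,
where `A`-bimodules are modules over `A ⊗ Aᵐᵒᵖ` and `Hⁿ(A, M) = Extⁿ(A, M)` is the Hochschild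
cohomology of the `k`-algebra `A` over the field `k`. -/
def cd (k A : Type u) [Field k] [Ring A] [Algebra k A] : ℕ∞ :=
  letI : Module (A ⊗[k] Aᵐᵒᵖ) A := instModuleTensorProductMop k A
  extDim (ModuleCat.of.{u} (A ⊗[k] Aᵐᵒᵖ) A)

/-- The Gerstenhaber-Schack cohomological dimension
`cd_GS(A) = sup {n : H_GSⁿ(A, V) ≠ 0 for some Yetter-Drinfeld module V}`, where
`H_GSⁿ(A, V) = Extⁿ(k, V)` in the category of Yetter-Drinfeld modules. -/
def cdGS (k A : Type u) [Field k] [Ring A] [HopfAlgebra k A] : ℕ∞ :=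
  extDim (YDModule.trivial k A)

end HopfDim

end

/-!
The cocentral surjection `p : A → kΓ` gives a `Γ`-grading of `A`: the component `A_g` consists of
the `a` with `a₍₁₎ ⊗ p(a₍₂₎) = a ⊗ g`. It is compatible with the product and the antipode, and by
cocentrality each `A_g` is a subcoalgebra (`CocentralGrading`, `gradingOfCocentral`). By
exactness, `i` identifies `B` with `A_1` (`IsDegreeOne`), and no component vanishes because `p` is
surjective.

*The two adjunctions.* Induction `W ↦ W ⊗_B A` is left adjoint to restriction from `A` to `B`. It
is also right adjoint to it: the counit is the projection `A → A_1 = B`, and the unit is obtained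
by averaging. Since each `A_g` contains an element `c` with `ε(c) = 1`, a `B`-linear map `f` between
`A`-modules has an average `x ↦ ∑_g f(x · S(c₍₁₎)) · c₍₂₎`, which is `A`-linear; the summand of index
`g` is characterized by the rule `y · t ↦ f(y) · t` for `t` of degree `g` (`avgPart_smul`), hence it
does not depend on `c`. The composite of the unit of one adjunction with the counit of the other is
multiplication by `|Γ|` (`map_coind`), which is invertible in characteristic zero. So every
`A`-module is a retract of a module induced from `B`, as in Maschke's theorem.

*Consequence for `Ext`.* If `F ⊣ G ⊣ F` are additive functors of abelian categories, both are exact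
and `Extⁿ(F X, Y) ≃ Extⁿ(X, G Y)`, `Extⁿ(G Z, X) ≃ Extⁿ(Z, F X)` (`extEquivOfAdjunction`). If
moreover `X` is a retract of `G (F X)`, then `X` and `F X` have the same cohomological dimension
(`extDim_obj_eq_of_adjunctions`).

*Hochschild dimension.* For a Hopf algebra `H`, the functor `N ↦ H ⊗ N` from right modules to
bimodules is exact, sends the trivial module to `H`, and has an exact right adjoint that is
essentially surjective. Hence `cd(H)` is the dimension of the trivial right module
(`cd_eq_extDim_trivial`), and the statement above applies to the trivial module, which restricts
to the trivial module.

*Gerstenhaber-Schack dimension.* The restriction of a Yetter-Drinfeld module `X` over `A` is its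
part of degree `1`, `{x | x₍₀₎ ⊗ p(x₍₁₎) = x ⊗ 1}`, which is an `A`-submodule since the grading is
stable under `x ↦ S(a₍₁₎) x a₍₃₎`. The induced module `W ⊗_B A` has the coaction
`w ⊗ a ↦ (w₍₀₎ ⊗ a₍₂₎) ⊗ S(a₍₁₎) w₍₁₎ a₍₃₎`. The units and counits above are compatible with the
coactions. A Yetter-Drinfeld module of degree `1`, such as the trivial one, is again a retract of an
induced one, so the same argument applies (`IsDegreeOne.cdGS_eq`).
-/

noncomputable section

namespace HopfDim

/-! ### Effaceability and naturality of `Ext` -/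

section Efface

open DerivedCategory HomologicalComplex Category

universe w' v' u'

variable {C : Type u} [Category.{v} C] [Abelian C]

/-- A quasi-isomorphism from a complex `K` concentrated in degrees `≤ 0` onto an object `X` in
degree `0` becomes an epimorphism `K⁰ → X` after restriction to the degree zero part. -/
lemma exists_epi_of_quasiIso {X : C} {K : CochainComplex C ℤ}
    (π : K ⟶ (single C (ComplexShape.up ℤ) 0).obj X) [K.IsStrictlyLE 0] [QuasiIsoAt π 0] :
    ∃ (P : C) (p : P ⟶ X) (_ : Epi p) (σ : (single C (ComplexShape.up ℤ) 0).obj P ⟶ K),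
      σ ≫ π = (single C (ComplexShape.up ℤ) 0).map p := by
  let e := K.iCyclesIso 0 (0 + 1) (by simp)
    ((K.isZero_of_isStrictlyLE 0 (0 + 1) (by simp)).eq_of_tgt _ _)
  let α : K.X 0 ⟶ X :=
    e.inv ≫ K.homologyπ 0 ≫ homologyMap π 0 ≫ (singleObjHomologySelfIso _ _ _).hom
  have hα : π.f 0 = α ≫ (singleObjXSelf (ComplexShape.up ℤ) 0 X).inv := by
    rw [← cancel_epi e.hom]
    dsimp only [α, e]
    rw [assoc, assoc, assoc, Iso.hom_inv_id_assoc, homologyπ_naturality_assoc,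
      homologyπ_singleObjHomologySelfIso_hom_assoc, ← singleObjCyclesSelfIso_inv_iCycles,
      Iso.hom_inv_id_assoc, iCyclesIso_hom, ← cyclesMap_i]
  have hepi : Epi α := by
    dsimp only [α]
    infer_instance
  refine ⟨K.X 0, α, hepi, mkHomFromSingle (𝟙 _) (fun j hj => by
    obtain rfl : 0 + 1 = j := hj
    apply (K.isZero_of_isStrictlyLE 0 (0 + 1) (by simp)).eq_of_tgt), ?_⟩
  apply from_single_hom_ext
  rw [comp_f, mkHomFromSingle_f, assoc, hα, single_map_f_self]
  simp

/-- Every class of positive degree in `Ext(X, Y)` is killed by pulling back along a suitable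
epimorphism onto `X`. -/
lemma exists_epi_comp_eq_zero [HasExt.{w} C] {X Y : C} {n : ℕ} (e : Abelian.Ext X Y (n + 1)) :
    ∃ (P : C) (p : P ⟶ X) (_ : Epi p), (Abelian.Ext.mk₀ p).comp e (zero_add _) = 0 := by
  let := HasDerivedCategory.standard C
  let ψ := ((singleFunctors C).shiftIso ((n : ℤ) + 1) (-((n : ℤ) + 1)) 0 (by lia)).app Y
  let φ : Q.obj ((CochainComplex.singleFunctor C 0).obj X) ⟶
    Q.obj ((CochainComplex.singleFunctor C (-((n : ℤ) + 1))).obj Y) := e.hom ≫ ψ.hom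
  obtain ⟨K, _, π, h, g, hg⟩ := right_fac_of_isStrictlyLE φ 0
  have hq : QuasiIsoAt π 0 := by
    rw [isIso_Q_map_iff_quasiIso] at h
    infer_instance
  have hq' : QuasiIsoAt (L := (single C (ComplexShape.up ℤ) 0).obj X) π 0 := hq
  obtain ⟨P, p, hp, σ', hσ'⟩ := exists_epi_of_quasiIso (X := X) (K := K) π
  obtain ⟨σ, hσ⟩ : ∃ σ : (CochainComplex.singleFunctor C 0).obj P ⟶ K,
    σ ≫ π = (CochainComplex.singleFunctor C 0).map p := ⟨σ', hσ'⟩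
  refine ⟨P, p, hp, ?_⟩
  apply Abelian.Ext.homEquiv.injective
  have h0 : σ ≫ g = 0 := by
    apply HomologicalComplex.from_single_hom_ext
    apply (((CochainComplex.singleFunctor C (-((n : ℤ) + 1))).obj Y).isZero_of_isStrictlyLE
      (-((n : ℤ) + 1)) 0 (by lia)).eq_of_tgt
  have h1 : Q.map ((CochainComplex.singleFunctor C 0).map p) ≫ φ = 0 := by
    rw [hg, ← hσ, Q.map_comp, assoc, IsIso.hom_inv_id_assoc, ← Q.map_comp, h0, Q.map_zero]
  have h2 : (singleFunctor C 0).map p ≫ e.hom = 0 := by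
    rw [← cancel_mono ψ.hom, assoc, Limits.zero_comp]
    exact h1
  have h3 := Abelian.Ext.comp_hom (Abelian.Ext.mk₀ p) e (zero_add _)
  rw [Abelian.Ext.mk₀_hom, ShiftedHom.mk₀_comp] at h3
  exact h3.trans (h2.trans (Abelian.Ext.zero_hom _ _ _).symm)

open Abelian

/-- A class of degree `n + 1` is the Yoneda product of the class of a short exact sequence with
a class of degree `n`. -/
lemma exists_eq_extClass_comp [HasExt.{w} C] {X Y : C} {n : ℕ} (e : Ext X Y (n + 1)) :
    ∃ (K P : C) (j : K ⟶ P) (p : P ⟶ X) (z : j ≫ p = 0)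
      (hS : (ShortComplex.mk j p z).ShortExact) (e' : Ext K Y n),
        hS.extClass.comp e' (add_comm 1 n) = e := by
  obtain ⟨P, p, hp, h⟩ := exists_epi_comp_eq_zero e
  have hS : (ShortComplex.mk _ _ (kernel.condition p)).ShortExact :=
    { exact := ShortComplex.exact_kernel p }
  exact ⟨_, P, _, p, _, hS, Ext.contravariant_sequence_exact₃ hS Y e h (add_comm 1 n)⟩

variable {D : Type u'} [Category.{v'} D] [Abelian D] [HasExt.{w} C] [HasExt.{w'} D]
  {F : C ⥤ D} {G : D ⥤ C} [F.Additive] [G.Additive] [PreservesFiniteLimits F]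
  [PreservesFiniteColimits F] [PreservesFiniteLimits G] [PreservesFiniteColimits G]

/-- Naturality on `Ext` of a transformation `𝟭 ⟶ F ⋙ G`. -/
lemma Ext.mk₀_unit_comp (τ : 𝟭 C ⟶ F ⋙ G) {X Y : C} {n : ℕ} (e : Ext X Y n) :
    (Ext.mk₀ (τ.app X)).comp ((e.mapExactFunctor F).mapExactFunctor G) (zero_add n) =
      e.comp (Ext.mk₀ (τ.app Y)) (add_zero n) := by
  induction n generalizing X with
  | zero =>
    obtain ⟨f, rfl⟩ := (Ext.mk₀_bijective X Y).2 e
    rw [Ext.mapExactFunctor_mk₀, Ext.mapExactFunctor_mk₀, Ext.mk₀_comp_mk₀, Ext.mk₀_comp_mk₀]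
    exact congrArg Ext.mk₀ (τ.naturality f).symm
  | succ n ih =>
    obtain ⟨K, P, j, p, z, hS, e', rfl⟩ := exists_eq_extClass_comp e
    have nat := ShortComplex.ShortExact.extClass_naturality hS
      ((hS.map_of_exact F).map_of_exact G) (ShortComplex.homMk (τ.app K) (τ.app P) (τ.app X)
        (τ.naturality j).symm (τ.naturality p).symm)
    have hm := (congrArg (Ext.mapExactFunctor G) (Ext.mapExactFunctor_extClass F hS)).trans
      (Ext.mapExactFunctor_extClass G (hS.map_of_exact F))
    rw [Ext.mapExactFunctor_comp, Ext.mapExactFunctor_comp, Ext.comp_assoc_of_third_deg_zero,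
      ← ih e', ← Ext.comp_assoc _ _ _ (zero_add 1) (add_comm 1 n) (by lia),
      ← Ext.comp_assoc_of_second_deg_zero]
    exact congrArg (fun t => Ext.comp t _ _)
      ((congrArg (fun t => Ext.comp _ t (zero_add 1)) hm).trans nat.symm)

/-- Naturality on `Ext` of a transformation `G ⋙ F ⟶ 𝟭`. -/
lemma Ext.comp_mk₀_counit (τ : G ⋙ F ⟶ 𝟭 D) {X Y : D} {n : ℕ} (e : Ext X Y n) :
    ((e.mapExactFunctor G).mapExactFunctor F).comp (Ext.mk₀ (τ.app Y)) (add_zero n) =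
      (Ext.mk₀ (τ.app X)).comp e (zero_add n) := by
  induction n generalizing X with
  | zero =>
    obtain ⟨f, rfl⟩ := (Ext.mk₀_bijective X Y).2 e
    rw [Ext.mapExactFunctor_mk₀, Ext.mapExactFunctor_mk₀, Ext.mk₀_comp_mk₀, Ext.mk₀_comp_mk₀]
    exact congrArg Ext.mk₀ (τ.naturality f)
  | succ n ih =>
    obtain ⟨K, P, j, p, z, hS, e', rfl⟩ := exists_eq_extClass_comp e
    have nat := ShortComplex.ShortExact.extClass_naturality
      ((hS.map_of_exact G).map_of_exact F) hS (ShortComplex.homMk (τ.app K) (τ.app P) (τ.app X)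
        (τ.naturality j).symm (τ.naturality p).symm)
    have hm := (congrArg (Ext.mapExactFunctor F) (Ext.mapExactFunctor_extClass G hS)).trans
      (Ext.mapExactFunctor_extClass F (hS.map_of_exact G))
    rw [Ext.mapExactFunctor_comp, Ext.mapExactFunctor_comp, Ext.comp_assoc_of_third_deg_zero,
      ih e', ← Ext.comp_assoc _ _ _ (zero_add 1) (add_comm 1 n) (by lia),
      ← Ext.comp_assoc_of_second_deg_zero]
    exact congrArg (fun t => Ext.comp t _ _)
      ((congrArg (fun t => Ext.comp t _ (add_zero 1)) hm).trans nat)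

/-- The adjunction isomorphism `Extⁿ(F X, Y) ≃ Extⁿ(X, G Y)` for exact adjoint functors. -/
def extEquivOfAdjunction (adj : F ⊣ G) (X : C) (Y : D) (n : ℕ) :
    Ext (F.obj X) Y n ≃ Ext X (G.obj Y) n where
  toFun e := (Ext.mk₀ (adj.unit.app X)).comp (e.mapExactFunctor G) (zero_add n)
  invFun e := (e.mapExactFunctor F).comp (Ext.mk₀ (adj.counit.app Y)) (add_zero n)
  left_inv e := by
    dsimp only
    rw [Ext.mapExactFunctor_comp, Ext.mapExactFunctor_mk₀, Ext.comp_assoc_of_third_deg_zero,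
      Ext.comp_mk₀_counit]
    erw [Ext.mk₀_comp_mk₀_assoc]
    rw [adj.left_triangle_components, Ext.mk₀_id_comp]
  right_inv e := by
    dsimp only
    rw [Ext.mapExactFunctor_comp, Ext.mapExactFunctor_mk₀, ← Ext.comp_assoc_of_third_deg_zero,
      Ext.mk₀_unit_comp, Ext.comp_assoc_of_third_deg_zero, Ext.mk₀_comp_mk₀]
    erw [adj.right_triangle_components]
    rw [Ext.comp_mk₀_id]

end Efface

/-! ### Comparison of cohomological dimensions -/

section ExtDim

open Abelian

universe v' u'

variable {C : Type u} [Category.{v} C] [Abelian C] {D : Type u'} [Category.{v'} D] [Abelian D]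

lemma extDim_le_extDim (X : C) (Y : D)
    (h : letI := HasExt.standard C; letI := HasExt.standard D
      ∀ (n : ℕ) (Z : C), Nontrivial (Ext.{max u v} X Z n) →
        ∃ W : D, Nontrivial (Ext.{max u' v'} Y W n)) :
    extDim X ≤ extDim Y :=
  iSup₂_le fun n hn => le_iSup₂_of_le n (h n _ hn.choose_spec) le_rfl

lemma extDim_le_of_retract {X Y : C} (r : Retract X Y) : extDim X ≤ extDim Y := by
  let := HasExt.standard C
  refine extDim_le_extDim X Y fun n Z _ => ⟨Z, ?_⟩
  have hinj : Function.Injective fun e : Ext.{max u v} X Z n =>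
      (Ext.mk₀ r.r).comp e (zero_add n) := by
    refine Function.LeftInverse.injective
      (g := fun e => (Ext.mk₀ r.i).comp e (zero_add n)) fun e => ?_
    change (Ext.mk₀ r.i).comp ((Ext.mk₀ r.r).comp e (zero_add n)) (zero_add n) = e
    rw [Ext.mk₀_comp_mk₀_assoc, r.retract, Ext.mk₀_id_comp]
  exact hinj.nontrivial

lemma extDim_eq_of_iso {X Y : C} (e : X ≅ Y) : extDim X = extDim Y :=
  le_antisymm (extDim_le_of_retract (.ofIso e)) (extDim_le_of_retract (.ofIso e.symm))

variable {F : C ⥤ D} {G : D ⥤ C} [F.Additive] [G.Additive] [PreservesFiniteLimits F]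
  [PreservesFiniteColimits F] [PreservesFiniteLimits G] [PreservesFiniteColimits G]

/-- An exact functor with an exact right adjoint does not increase the cohomological
dimension. -/
lemma extDim_obj_le (adj : F ⊣ G) (X : C) : extDim (F.obj X) ≤ extDim X := by
  let := HasExt.standard C
  let := HasExt.standard D
  exact extDim_le_extDim _ _ fun n Z _ =>
    ⟨G.obj Z, (extEquivOfAdjunction adj X Z n).symm.nontrivial⟩

/-- If the right adjoint is moreover essentially surjective, the cohomological dimension is
preserved. -/
lemma extDim_obj_eq (adj : F ⊣ G) [G.EssSurj] (X : C) : extDim (F.obj X) = extDim X := by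
  let := HasExt.standard C
  let := HasExt.standard D
  refine (extDim_obj_le adj X).antisymm (extDim_le_extDim _ _ fun n Z _ => ⟨G.objPreimage Z, ?_⟩)
  have hinj : Function.Injective fun e : Ext.{max u v} X Z n =>
      e.comp (Ext.mk₀ (G.objObjPreimageIso Z).inv) (add_zero n) := by
    refine Function.LeftInverse.injective
      (g := fun e => e.comp (Ext.mk₀ (G.objObjPreimageIso Z).hom) (add_zero n)) fun e => ?_
    change (e.comp _ _).comp (Ext.mk₀ _) (add_zero n) = e
    rw [Ext.comp_assoc_of_third_deg_zero, Ext.mk₀_comp_mk₀, Iso.inv_hom_id, Ext.comp_mk₀_id]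
  have := hinj.nontrivial
  exact (extEquivOfAdjunction adj X (G.objPreimage Z) n).nontrivial

/-- For functors that are adjoint to each other on both sides, the two exactness hypotheses are
automatic. -/
lemma extDim_obj_eq_of_adjunctions {F : C ⥤ D} {G : D ⥤ C} [F.Additive] [G.Additive]
    (adj₁ : F ⊣ G) (adj₂ : G ⊣ F) {X : C} (r : Retract X (G.obj (F.obj X))) :
    extDim (F.obj X) = extDim X := by
  have := adj₁.leftAdjoint_preservesColimits
  have := adj₂.leftAdjoint_preservesColimits
  have := adj₁.rightAdjoint_preservesLimits
  have := adj₂.rightAdjoint_preservesLimits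
  have h₁ : PreservesFiniteLimits F := PreservesLimits.preservesFiniteLimits F
  have h₂ : PreservesFiniteLimits G := PreservesLimits.preservesFiniteLimits G
  have h₃ : PreservesFiniteColimits F := PreservesColimits.preservesFiniteColimits F
  have h₄ : PreservesFiniteColimits G := PreservesColimits.preservesFiniteColimits G
  exact (extDim_obj_le adj₁ X).antisymm ((extDim_le_of_retract r).trans (extDim_obj_le adj₂ _))

end ExtDim

/-! ### The antipode of a Hopf algebra -/

section Antipode

open TensorProduct

variable {k : Type u} [Field k] {A : Type u} [Ring A] [HopfAlgebra k A]

local notation "Δ" => Coalgebra.comul (R := k) (A := A)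
local notation "S" => HopfAlgebra.antipode k (A := A)

lemma map_comul_comul_comp_comul : map Δ Δ ∘ₗ Δ =
    (TensorProduct.assoc k A A (A ⊗[k] A)).symm.toLinearMap ∘ₗ
      (TensorProduct.assoc k A A A).toLinearMap.lTensor A ∘ₗ
        (LinearMap.rTensor A Δ).lTensor A ∘ₗ comul₂ k A := by
  simp only [HopfDim.comul₂, coassoc_simps]

lemma comul₂_apply (a : A) : comul₂ k A a = (Δ).lTensor A (Δ a) := rfl

lemma lTensor_counit_rTensor_comul₂ (a : A) :
    ((TensorProduct.lid k A).toLinearMap ∘ₗ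
      (Coalgebra.counit (R := k) (A := A)).rTensor A).lTensor A (comul₂ k A a) = Δ a := by
  have e : (TensorProduct.lid k A).toLinearMap ∘ₗ
      (Coalgebra.counit (R := k) (A := A)).rTensor A ∘ₗ Δ = LinearMap.id := by
    ext; simp
  rw [comul₂_apply, ← LinearMap.comp_apply, ← LinearMap.lTensor_comp, LinearMap.comp_assoc, e,
    LinearMap.lTensor_id, LinearMap.id_apply]

/-- The antipode is an anti-homomorphism of coalgebras. -/
lemma comul_antipode (a : A) :
    Δ (S a) = map S S (TensorProduct.comm k A A (Δ a)) := by
  have key : WithConv.toConv (map S S ∘ₗ (TensorProduct.comm k A A).toLinearMap ∘ₗ Δ) *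
      WithConv.toConv Δ = 1 := by
    apply WithConv.ext
    have h1 : LinearMap.mul' k (A ⊗[k] A) ∘ₗ
        map (map S S ∘ₗ (TensorProduct.comm k A A).toLinearMap) LinearMap.id ∘ₗ
        (TensorProduct.assoc k A A (A ⊗[k] A)).symm.toLinearMap ∘ₗ
        (TensorProduct.assoc k A A A).toLinearMap.lTensor A ∘ₗ
        (LinearMap.rTensor A Δ).lTensor A =
      (TensorProduct.mk k A A 1 ∘ₗ LinearMap.mul' k A ∘ₗ LinearMap.rTensor A S) ∘ₗ
        ((TensorProduct.lid k A).toLinearMap ∘ₗ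
          (Coalgebra.counit (R := k) (A := A)).rTensor A).lTensor A := by
      refine TensorProduct.ext_threefold' fun x y z => ?_
      have h2 : ∀ s : A ⊗[k] A, LinearMap.mul' k (A ⊗[k] A)
          (map (map S S ∘ₗ (TensorProduct.comm k A A).toLinearMap) LinearMap.id
            ((TensorProduct.assoc k A A (A ⊗[k] A)).symm
              (x ⊗ₜ (TensorProduct.assoc k A A A (s ⊗ₜ z))))) =
          LinearMap.mul' k A (LinearMap.rTensor A S s) ⊗ₜ (S x * z) := by
        intro s
        induction s with
        | zero => simp
        | add s t hs ht => simp only [add_tmul, tmul_add, map_add, hs, ht]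
        | tmul y y' => simp
      simp only [LinearMap.comp_apply, LinearMap.lTensor_tmul, LinearMap.rTensor_tmul,
        LinearEquiv.coe_coe, h2, HopfAlgebra.mul_antipode_rTensor_comul_apply]
      simp [Algebra.algebraMap_eq_smul_one, TensorProduct.smul_tmul]
    refine LinearMap.ext fun b => ?_
    have e1 : map (map S S ∘ₗ (TensorProduct.comm k A A).toLinearMap ∘ₗ Δ) Δ (Δ b) =
        map (map S S ∘ₗ (TensorProduct.comm k A A).toLinearMap) LinearMap.id
          ((map Δ Δ ∘ₗ Δ) b) := by
      rw [LinearMap.comp_apply, ← LinearMap.comp_apply (map _ _) (map _ _),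
        ← TensorProduct.map_comp]
      rfl
    have e2 := LinearMap.congr_fun h1 (comul₂ k A b)
    simp only [LinearMap.comp_apply] at e2
    change LinearMap.mul' k (A ⊗[k] A)
      (map (map S S ∘ₗ (TensorProduct.comm k A A).toLinearMap ∘ₗ Δ) Δ (Δ b)) = _
    rw [e1, map_comul_comul_comp_comul]
    refine e2.trans ?_
    rw [lTensor_counit_rTensor_comul₂, HopfAlgebra.mul_antipode_rTensor_comul_apply]
    simp [Algebra.algebraMap_eq_smul_one, Algebra.TensorProduct.one_def]
  have := left_inv_eq_right_inv key LinearMap.comul_right_inv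
  exact (LinearMap.congr_fun (congrArg WithConv.ofConv this) a).symm

variable {B : Type*} [Ring B] [HopfAlgebra k B]

/-- A homomorphism of bialgebras between Hopf algebras commutes with the antipodes. -/
lemma map_antipode (f : A →ₐc[k] B) (a : A) :
    f (S a) = HopfAlgebra.antipode k (f a) := by
  have h1 : WithConv.toConv ((f : A →ₗ[k] B) ∘ₗ S) * WithConv.toConv (f : A →ₗ[k] B) = 1 := by
    apply WithConv.ext
    have := LinearMap.algHom_comp_convMul_distrib (R := k) (f : A →ₐ[k] B)
      (WithConv.toConv S) (WithConv.toConv LinearMap.id)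
    rw [LinearMap.antipode_mul_id] at this
    refine this.symm.trans ?_
    ext; simpa using AlgHomClass.commutes f _
  have h2 : WithConv.toConv (f : A →ₗ[k] B) *
      WithConv.toConv (HopfAlgebra.antipode k (A := B) ∘ₗ (f : A →ₗ[k] B)) = 1 := by
    apply WithConv.ext
    have := LinearMap.convMul_comp_coalgHom_distrib (R := k) (WithConv.toConv LinearMap.id)
      (WithConv.toConv (HopfAlgebra.antipode k (A := B))) (f : A →ₗc[k] B)
    rw [LinearMap.id_mul_antipode] at this
    refine this.symm.trans ?_
    ext; simp
  exact LinearMap.congr_fun (congrArg WithConv.ofConv (left_inv_eq_right_inv h1 h2)) a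

end Antipode

/-! ### Gradings by central idempotents of the dual algebra -/

section Grading

open TensorProduct

section Structure

variable (k : Type u) [Field k] (A : Type u) [Ring A] [HopfAlgebra k A]
  (Γ : Type v) [Group Γ] [Fintype Γ] [DecidableEq Γ]

/-- A cocentral Hopf algebra map `p : A → kΓ` onto a finite group algebra, recorded by its
coefficient functionals `φ g = (g-th coefficient) ∘ p`. They form a complete system of orthogonal
idempotents that are central in the convolution algebra `A*`, and make `A` a `Γ`-graded algebra
whose homogeneous components are subcoalgebras. -/
structure CocentralGrading where
  /-- The functional `a ↦ (g-th coefficient of p a)`. -/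
  φ : Γ → A →ₗ[k] k
  sum_φ : ∑ g, φ g = Coalgebra.counit
  φ_convMul (g h : Γ) (a : A) : TensorProduct.lid k k (map (φ g) (φ h) (Coalgebra.comul a)) =
    if g = h then φ g a else 0
  central (g : Γ) (a : A) : TensorProduct.lid k A ((φ g).rTensor A (Coalgebra.comul a)) =
    TensorProduct.rid k A ((φ g).lTensor A (Coalgebra.comul a))
  φ_mul (g : Γ) (a b : A) : φ g (a * b) = ∑ h, φ h a * φ (h⁻¹ * g) b
  φ_antipode (g : Γ) (a : A) : φ g (HopfAlgebra.antipode k a) = φ g⁻¹ a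
  exists_φ_eq_one (g : Γ) : ∃ a, φ g a = 1

namespace CocentralGrading

variable {k A Γ} (G : CocentralGrading k A Γ)

local notation "Δ" => Coalgebra.comul (R := k) (A := A)
local notation "S" => HopfAlgebra.antipode k (A := A)

/-- The projection `a ↦ a₍₁₎ φ_g(a₍₂₎)` of `A` onto its component of degree `g`. -/
def prj (g : Γ) : A →ₗ[k] A :=
  (TensorProduct.rid k A).toLinearMap ∘ₗ (G.φ g).lTensor A ∘ₗ Δ

lemma sum_prj (a : A) : ∑ g, G.prj g a = a := by
  have h : (∑ g, (G.φ g).lTensor A (Δ a)) = (∑ g, G.φ g).lTensor A (Δ a) := by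
    rw [← LinearMap.coe_lTensorHom, map_sum, LinearMap.sum_apply]
  change ∑ g, TensorProduct.rid k A ((G.φ g).lTensor A (Δ a)) = a
  rw [← map_sum, h, G.sum_φ]
  simp

lemma lTensor_prj_comul (g : Γ) (a : A) : (G.prj g).lTensor A (Δ a) = Δ (G.prj g a) := by
  have h : (TensorProduct.rid k A).toLinearMap.lTensor A ∘ₗ ((G.φ g).lTensor A).lTensor A ∘ₗ
      (TensorProduct.assoc k A A A).toLinearMap ∘ₗ (Δ).rTensor A =
      Δ ∘ₗ (TensorProduct.rid k A).toLinearMap ∘ₗ (G.φ g).lTensor A := by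
    refine TensorProduct.ext' fun x y => ?_
    have : ∀ s : A ⊗[k] A, (TensorProduct.rid k A).toLinearMap.lTensor A
        (((G.φ g).lTensor A).lTensor A (TensorProduct.assoc k A A A (s ⊗ₜ y))) = G.φ g y • s := by
      intro s
      induction s with
      | zero => simp
      | add s t hs ht => simp only [TensorProduct.add_tmul, map_add, hs, ht, smul_add]
      | tmul x x' => simp
    simpa using this (Δ x)
  have := LinearMap.congr_fun h (Δ a)
  simp only [LinearMap.comp_apply, LinearEquiv.coe_coe, Coalgebra.coassoc_apply] at this
  simp only [prj, LinearMap.lTensor_comp, LinearMap.comp_apply]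
  exact this

lemma prj_eq (g : Γ) : G.prj g =
    (TensorProduct.lid k A).toLinearMap ∘ₗ (G.φ g).rTensor A ∘ₗ Δ :=
  LinearMap.ext fun a => (G.central g a).symm

lemma rTensor_prj_comul (g : Γ) (a : A) : (G.prj g).rTensor A (Δ a) = Δ (G.prj g a) := by
  rw [← lTensor_prj_comul]
  have h : (TensorProduct.lid k A ∘ₗ (G.φ g).rTensor A).lTensor A ∘ₗ
      (TensorProduct.assoc k A A A).toLinearMap =
      ((TensorProduct.rid k A).toLinearMap ∘ₗ (G.φ g).lTensor A).rTensor A := by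
    refine TensorProduct.ext_threefold fun x y z => ?_
    simp [TensorProduct.smul_tmul]
  have h' : (TensorProduct.lid k A ∘ₗ (G.φ g).rTensor A ∘ₗ Δ).lTensor A (Δ a) =
      ((TensorProduct.rid k A).toLinearMap ∘ₗ (G.φ g).lTensor A ∘ₗ Δ).rTensor A (Δ a) := by
    rw [← LinearMap.comp_assoc, ← LinearMap.comp_assoc, LinearMap.lTensor_comp_apply,
      LinearMap.rTensor_comp_apply, ← h, LinearMap.comp_apply, LinearEquiv.coe_coe,
      Coalgebra.coassoc_apply]
  rw [← prj_eq] at h'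
  exact h'.symm

lemma φ_prj (g h : Γ) (a : A) : G.φ g (G.prj h a) = if g = h then G.φ g a else 0 := by
  rw [← G.φ_convMul]
  have : G.φ g ∘ₗ (TensorProduct.rid k A).toLinearMap ∘ₗ (G.φ h).lTensor A =
      (TensorProduct.lid k k).toLinearMap ∘ₗ map (G.φ g) (G.φ h) := by
    ext; simp [mul_comm]
  exact LinearMap.congr_fun this (Δ a)

lemma prj_prj (g h : Γ) (a : A) : G.prj g (G.prj h a) = if g = h then G.prj g a else 0 := by
  have h1 : G.prj g (G.prj h a) =
      TensorProduct.rid k A ((G.φ g).lTensor A (Δ (G.prj h a))) := rfl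
  have h2 : G.φ g ∘ₗ G.prj h = if g = h then G.φ g else 0 := by
    ext a
    rw [LinearMap.comp_apply, φ_prj]
    split_ifs <;> rfl
  rw [h1, ← lTensor_prj_comul, ← LinearMap.lTensor_comp_apply, h2]
  split_ifs
  · rfl
  · simp

/-- The homogeneous component of degree `g`. -/
def comp (g : Γ) : Submodule k A := LinearMap.eqLocus (G.prj g) LinearMap.id

variable {G}

lemma mem_comp {g : Γ} {a : A} : a ∈ G.comp g ↔ G.prj g a = a := Iff.rfl

lemma prj_mem_comp (g : Γ) (a : A) : G.prj g a ∈ G.comp g := by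
  rw [mem_comp, prj_prj, if_pos rfl]

lemma prj_of_mem {g h : Γ} {a : A} (ha : a ∈ G.comp g) : G.prj h a = if h = g then a else 0 := by
  nth_rw 1 [← mem_comp.1 ha]
  rw [prj_prj]
  split_ifs with hg
  · rw [hg, mem_comp.1 ha]
  · rfl

lemma φ_of_mem {g h : Γ} {a : A} (ha : a ∈ G.comp g) :
    G.φ h a = if h = g then Coalgebra.counit a else 0 := by
  have h1 : ∀ x : A, G.φ g (G.prj g x) = Coalgebra.counit (R := k) (G.prj g x) := by
    intro x
    rw [← G.sum_φ, LinearMap.sum_apply, Finset.sum_eq_single g]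
    · intro b _ hb
      rw [φ_prj, if_neg hb]
    · simp
  rw [← mem_comp.1 ha, φ_prj]
  split_ifs with hg
  · subst hg
    rw [← h1, φ_prj, if_pos rfl]
  · rfl

/-- Comultiplying an element of degree `g` produces tensors of degree `(g, g)`. -/
lemma map_prj_comul {g : Γ} {a : A} (ha : a ∈ G.comp g) :
    map (G.prj g) (G.prj g) (Δ a) = Δ a := by
  have : map (G.prj g) (G.prj g) = (G.prj g).rTensor A ∘ₗ (G.prj g).lTensor A := by
    ext; simp
  rw [this, LinearMap.comp_apply, lTensor_prj_comul, rTensor_prj_comul, mem_comp.1 ha,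
    mem_comp.1 ha]

lemma map_prj_comul₂ {g : Γ} {a : A} (ha : a ∈ G.comp g) :
    map (G.prj g) (map (G.prj g) (G.prj g)) (comul₂ k A a) = comul₂ k A a := by
  have h : map (G.prj g) (G.prj g) ∘ₗ Δ ∘ₗ G.prj g = Δ ∘ₗ G.prj g :=
    LinearMap.ext fun x => map_prj_comul (prj_mem_comp g x)
  have h' : map (G.prj g) (map (G.prj g) (G.prj g)) ∘ₗ (Δ).lTensor A ∘ₗ map (G.prj g) (G.prj g) =
      (Δ).lTensor A ∘ₗ map (G.prj g) (G.prj g) := by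
    refine TensorProduct.ext' fun x y => ?_
    have := LinearMap.congr_fun h y
    simp only [LinearMap.comp_apply] at this
    simp [this, prj_prj]
  have := LinearMap.congr_fun h' (Δ a)
  simp only [LinearMap.comp_apply, map_prj_comul ha] at this
  exact this

lemma mul_mem_comp {g h : Γ} {a b : A} (ha : a ∈ G.comp g) (hb : b ∈ G.comp h) :
    a * b ∈ G.comp (g * h) := by
  have key : ∀ s t : A ⊗[k] A, TensorProduct.rid k A ((G.φ (g * h)).lTensor A (s * t)) =
      ∑ l, TensorProduct.rid k A ((G.φ l).lTensor A s) *
        TensorProduct.rid k A ((G.φ (l⁻¹ * (g * h))).lTensor A t) := by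
    intro s t
    induction s with
    | zero => simp
    | add s s' hs hs' => simp only [add_mul, map_add, hs, hs', Finset.sum_add_distrib]
    | tmul x y =>
      induction t with
      | zero => simp
      | add s s' hs hs' => simp only [mul_add, map_add, hs, hs', Finset.sum_add_distrib]
      | tmul z w => simp [G.φ_mul, Finset.sum_smul, smul_smul, mul_comm]
  rw [mem_comp]
  have h1 := key (Δ a) (Δ b)
  rw [← Bialgebra.comul_mul] at h1
  change G.prj (g * h) (a * b) = ∑ l, G.prj l a * G.prj (l⁻¹ * (g * h)) b at h1
  rw [h1, Finset.sum_eq_single g]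
  · rw [prj_of_mem ha, if_pos rfl, prj_of_mem hb, if_pos (by group)]
  · intro l _ hl
    rw [prj_of_mem ha, if_neg hl, zero_mul]
  · simp

lemma antipode_mem_comp {g : Γ} {a : A} (ha : a ∈ G.comp g) : S a ∈ G.comp g⁻¹ := by
  have key : ∀ s : A ⊗[k] A, TensorProduct.rid k A ((G.φ g⁻¹).lTensor A
      (map S S (TensorProduct.comm k A A s))) =
      S (TensorProduct.lid k A ((G.φ g).rTensor A s)) := by
    intro s
    induction s with
    | zero => simp
    | add s s' hs hs' => simp only [map_add, hs, hs']
    | tmul x y => simp [G.φ_antipode]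
  have h1 := key (Δ a)
  rw [← comul_antipode, G.central] at h1
  exact h1.trans (congrArg _ (mem_comp.1 ha))

lemma one_mem_comp : (1 : A) ∈ G.comp 1 := by
  obtain ⟨a, ha⟩ := G.exists_φ_eq_one (1 : Γ)
  have h1 : Coalgebra.counit (R := k) (G.prj 1 a) = 1 := by
    have := φ_of_mem (h := (1 : Γ)) (prj_mem_comp (G := G) 1 a)
    rw [if_pos rfl, φ_prj, if_pos rfl, ha] at this
    exact this.symm
  have h2 : ∀ s : A ⊗[k] A, LinearMap.mul' k A ((S).rTensor A (map (G.prj 1) (G.prj 1) s)) ∈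
      G.comp (1 : Γ) := by
    intro s
    induction s with
    | zero => simp
    | add s s' hs hs' => simpa only [map_add] using add_mem hs hs'
    | tmul x y =>
      have := mul_mem_comp (antipode_mem_comp (prj_mem_comp (G := G) 1 x))
        (prj_mem_comp (G := G) 1 y)
      simpa using this
  have h3 := h2 (Δ (G.prj 1 a))
  rw [map_prj_comul (prj_mem_comp _ _), HopfAlgebra.mul_antipode_rTensor_comul_apply, h1,
    map_one] at h3
  exact h3

variable (G) in
/-- Every homogeneous component contains an element of counit `1`. -/
lemma exists_mem_comp_counit_eq_one (g : Γ) :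
    ∃ c ∈ G.comp g, Coalgebra.counit (R := k) c = 1 := by
  obtain ⟨a, ha⟩ := G.exists_φ_eq_one g
  refine ⟨G.prj g a, prj_mem_comp g a, ?_⟩
  have := φ_of_mem (h := g) (prj_mem_comp (G := G) g a)
  rw [if_pos rfl, φ_prj, if_pos rfl, ha] at this
  exact this.symm

/-- Induction on the homogeneous components. -/
lemma induction_on {motive : A → Prop} (a : A)
    (add : ∀ x y, motive x → motive y → motive (x + y))
    (hom : ∀ g, ∀ x ∈ G.comp g, motive x) : motive a := by
  rw [← G.sum_prj a]
  have : ∀ s : Finset Γ, motive (∑ g ∈ s, G.prj g a) := by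
    intro s
    induction s using Finset.induction_on with
    | empty => simpa using hom 1 0 (zero_mem _)
    | insert g s hg ih =>
      rw [Finset.sum_insert hg]
      exact add _ _ (hom g _ (prj_mem_comp g a)) ih
  exact this _

end CocentralGrading

end Structure

section OfCocentral

variable {k : Type u} [Field k] {A : Type u} [Ring A] [HopfAlgebra k A]
  {Γ : Type v} [CommGroup Γ]

/-- The `g`-th coefficient of an element of the group algebra. -/
def groupCoeff (g : Γ) : MonoidAlgebra k Γ →ₗ[k] k :=
  Finsupp.lapply g ∘ₗ (MonoidAlgebra.coeffLinearEquiv k).toLinearMap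

lemma groupCoeff_of [DecidableEq Γ] (g h : Γ) :
    groupCoeff g (MonoidAlgebra.of k Γ h) = if h = g then 1 else 0 := by
  simp [groupCoeff, MonoidAlgebra.of, Finsupp.single_apply]

lemma groupCoeff_single [DecidableEq Γ] (g h : Γ) :
    groupCoeff g (MonoidAlgebra.single h (1 : k)) = if h = g then 1 else 0 :=
  groupCoeff_of g h

lemma lid_rTensor_comm (f : A →ₗ[k] k) (s : A ⊗[k] A) :
    TensorProduct.lid k A (f.rTensor A (TensorProduct.comm k A A s)) =
      TensorProduct.rid k A (f.lTensor A s) := by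
  induction s with
  | zero => simp
  | add s t hs ht => simp only [map_add, hs, ht]
  | tmul x y => simp

/-- The grading attached to a cocentral surjection onto a group algebra. -/
def gradingOfCocentral [Fintype Γ] [DecidableEq Γ]
    (p : A →ₐc[k] MonoidAlgebra k Γ) (hs : Function.Surjective p) (hp : IsCocentral p) :
    CocentralGrading k A Γ where
  φ g := groupCoeff g ∘ₗ (p : A →ₗ[k] MonoidAlgebra k Γ)
  sum_φ := by
    have h : ∀ x : MonoidAlgebra k Γ, ∑ g, groupCoeff g x = Coalgebra.counit (R := k) x := by
      intro x
      induction x using MonoidAlgebra.induction_on with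
      | of m => simp [groupCoeff_single]
      | add x y hx hy => simp only [map_add, Finset.sum_add_distrib, hx, hy]
      | smul r x hx => simp only [map_smul, ← Finset.smul_sum, hx]
    ext a
    rw [LinearMap.sum_apply]
    exact (h (p a)).trans (CoalgHomClass.counit_comp_apply p a)
  φ_convMul g h a := by
    have key : ∀ x : MonoidAlgebra k Γ, TensorProduct.lid k k
        (map (groupCoeff g) (groupCoeff h) (Coalgebra.comul x)) =
          if g = h then groupCoeff g x else 0 := by
      intro x
      induction x using MonoidAlgebra.induction_on with
      | of m =>
        rw [MonoidAlgebra.of_apply, MonoidAlgebra.comul_single]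
        simp only [CommSemiring.comul_apply, map_tmul, MonoidAlgebra.lsingle_apply]
        rw [← MonoidAlgebra.of_apply, groupCoeff_of, groupCoeff_of]
        by_cases hgh : g = h
        · subst hgh; by_cases hm : m = g <;> simp [hm]
        · by_cases hm : m = g
          · subst hm; simp [hgh]
          · simp [hm, hgh]
      | add x y hx hy =>
        simp only [map_add, hx, hy]; split_ifs <;> simp
      | smul r x hx => simp only [map_smul, hx]; split_ifs <;> simp
    rw [TensorProduct.map_comp, LinearMap.comp_apply]
    have := CoalgHomClass.map_comp_comul_apply p a
    exact (congrArg (fun t => TensorProduct.lid k k (map (groupCoeff g) (groupCoeff h) t))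
      this).trans (key (p a))
  central g a := by
    rw [LinearMap.rTensor_comp_apply, hp a, ← LinearMap.rTensor_comp_apply, lid_rTensor_comm]
  φ_mul g a b := by
    have key : ∀ x y : MonoidAlgebra k Γ,
        groupCoeff g (x * y) = ∑ h, groupCoeff h x * groupCoeff (h⁻¹ * g) y := by
      intro x y
      induction x using MonoidAlgebra.induction_on with
      | of m =>
        induction y using MonoidAlgebra.induction_on with
        | of n =>
          rw [← map_mul]
          rw [Finset.sum_eq_single m]
          · simp [groupCoeff_single, eq_inv_mul_iff_mul_eq]
          · intro x _ hx
            simp [groupCoeff_single, Ne.symm hx]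
          · simp
        | add x y hx hy => simp only [map_add, mul_add, Finset.sum_add_distrib, hx, hy]
        | smul r x hx =>
          simp only [map_smul, mul_smul_comm, ← Finset.smul_sum, hx]
      | add x y hx hy => simp only [map_add, add_mul, Finset.sum_add_distrib, hx, hy]
      | smul r x hx => simp only [map_smul, smul_mul_assoc, ← Finset.smul_sum, hx]
    exact (congrArg (groupCoeff g) (map_mul p a b)).trans (key (p a) (p b))
  φ_antipode g a := by
    have key : ∀ x : MonoidAlgebra k Γ,
        groupCoeff g (HopfAlgebra.antipode k x) = groupCoeff g⁻¹ x := by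
      intro x
      induction x using MonoidAlgebra.induction_on with
      | of m =>
        rw [MonoidAlgebra.of_apply, MonoidAlgebra.antipode_single]
        simp only [CommSemiring.antipode_eq_id, LinearMap.id_apply]
        rw [← MonoidAlgebra.of_apply, ← MonoidAlgebra.of_apply, groupCoeff_of, groupCoeff_of]
        simp [inv_eq_iff_eq_inv]
      | add x y hx hy => simp only [map_add, hx, hy]
      | smul r x hx => simp only [map_smul, hx]
    exact (congrArg (groupCoeff g) (map_antipode p a)).trans (key (p a))
  exists_φ_eq_one g := by
    obtain ⟨a, ha⟩ := hs (MonoidAlgebra.of k Γ g)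
    refine ⟨a, (congrArg (groupCoeff g) ha).trans ?_⟩
    rw [groupCoeff_of, if_pos rfl]

/-- The component of degree `1` is the algebra of coinvariants. -/
lemma mem_comp_one_iff [Fintype Γ] [DecidableEq Γ]
    (p : A →ₐc[k] MonoidAlgebra k Γ) (hs : Function.Surjective p) (hp : IsCocentral p) (a : A) :
    a ∈ (gradingOfCocentral p hs hp).comp 1 ↔
      (p : A →ₗ[k] MonoidAlgebra k Γ).lTensor A (Coalgebra.comul (R := k) a) =
        a ⊗ₜ[k] (1 : MonoidAlgebra k Γ) := by
  constructor
  · intro ha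
    have key : ∀ x : MonoidAlgebra k Γ, TensorProduct.rid k _
        ((groupCoeff (1 : Γ)).lTensor _ (Coalgebra.comul (R := k) x)) =
          groupCoeff (1 : Γ) x • 1 := by
      intro x
      induction x using MonoidAlgebra.induction_on with
      | of m =>
        rw [MonoidAlgebra.of_apply, MonoidAlgebra.comul_single]
        simp only [CommSemiring.comul_apply, map_tmul, MonoidAlgebra.lsingle_apply,
          LinearMap.lTensor_tmul, TensorProduct.rid_tmul]
        rw [← MonoidAlgebra.of_apply, groupCoeff_of]
        split_ifs with hm
        · rw [hm, map_one]
        · rw [zero_smul, zero_smul]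
      | add x y hx hy => simp only [map_add, add_smul, hx, hy]
      | smul r x hx => simp only [map_smul, hx, smul_assoc]
    have h1 : (p : A →ₗ[k] MonoidAlgebra k Γ) ∘ₗ (gradingOfCocentral p hs hp).prj 1 =
        (groupCoeff (1 : Γ) ∘ₗ (p : A →ₗ[k] MonoidAlgebra k Γ)).smulRight
          (1 : MonoidAlgebra k Γ) := by
      ext1 x
      have h2 : (p : A →ₗ[k] MonoidAlgebra k Γ) ∘ₗ (TensorProduct.rid k A).toLinearMap ∘ₗ
          (groupCoeff (1 : Γ) ∘ₗ (p : A →ₗ[k] MonoidAlgebra k Γ)).lTensor A =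
          (TensorProduct.rid k _).toLinearMap ∘ₗ (groupCoeff (1 : Γ)).lTensor _ ∘ₗ
            map (p : A →ₗ[k] MonoidAlgebra k Γ) (p : A →ₗ[k] MonoidAlgebra k Γ) := by
        ext; simp
      refine (LinearMap.congr_fun h2 (Coalgebra.comul x)).trans ?_
      have := CoalgHomClass.map_comp_comul_apply p x
      exact (congrArg (fun t => TensorProduct.rid k _ ((groupCoeff (1 : Γ)).lTensor _ t))
        this).trans (key (p x))
    have h3 : (p : A →ₗ[k] MonoidAlgebra k Γ).lTensor A
        (Coalgebra.comul (R := k) ((gradingOfCocentral p hs hp).prj 1 a)) =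
        ((gradingOfCocentral p hs hp).prj 1 a) ⊗ₜ[k] (1 : MonoidAlgebra k Γ) := by
      rw [← CocentralGrading.lTensor_prj_comul, ← LinearMap.lTensor_comp_apply, h1]
      have h4 : ∀ (f : A →ₗ[k] k) (s : A ⊗[k] A),
          (f.smulRight (1 : MonoidAlgebra k Γ)).lTensor A s =
            TensorProduct.rid k A (f.lTensor A s) ⊗ₜ[k] (1 : MonoidAlgebra k Γ) := by
        intro f s
        induction s with
        | zero => simp
        | add s t hs ht => simp only [map_add, TensorProduct.add_tmul, hs, ht]
        | tmul x y => simp [TensorProduct.smul_tmul]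
      exact h4 _ _
    rwa [CocentralGrading.mem_comp.1 ha] at h3
  · intro ha
    have h : TensorProduct.rid k A ((groupCoeff (1 : Γ)).lTensor A
        ((p : A →ₗ[k] MonoidAlgebra k Γ).lTensor A (Coalgebra.comul (R := k) a))) = a := by
      have := groupCoeff_of (k := k) (1 : Γ) 1
      rw [map_one, if_pos rfl] at this
      rw [ha, LinearMap.lTensor_tmul, this, TensorProduct.rid_tmul, one_smul]
    rw [← LinearMap.lTensor_comp_apply] at h
    exact h

end OfCocentral

end Grading

/-! ### Induced modules and averaging over the grading -/

section Induced

open TensorProduct MulOpposite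

variable {k : Type u} [Field k] {A B : Type u} [Ring A] [HopfAlgebra k A] [Ring B]
  [HopfAlgebra k B] (i : B →ₐc[k] A)
  (W : Type u) [AddCommGroup W] [Module k W] [Module Bᵐᵒᵖ W]

/-- The relations `i(b) ⊗ w = 1 ⊗ w · b` defining the induced module. -/
def indRel : Submodule Aᵐᵒᵖ (A ⊗[k] W) :=
  Submodule.span Aᵐᵒᵖ (Set.range fun t : B × W => i t.1 ⊗ₜ t.2 - 1 ⊗ₜ (op t.1 • t.2))

/-- The right `A`-module `W ⊗_B A` induced from a right `B`-module `W` along `i : B → A`. It is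
presented as a quotient of `A ⊗ W`, with the factors exchanged because `A ⊗ W` already carries
the action of `Aᵐᵒᵖ` on the left tensor factor. -/
def Ind : Type u := (A ⊗[k] W) ⧸ indRel i W

instance : AddCommGroup (Ind i W) := inferInstanceAs (AddCommGroup ((A ⊗[k] W) ⧸ indRel i W))
instance : Module Aᵐᵒᵖ (Ind i W) := inferInstanceAs (Module Aᵐᵒᵖ ((A ⊗[k] W) ⧸ indRel i W))
instance : Module k (Ind i W) := inferInstanceAs (Module k ((A ⊗[k] W) ⧸ indRel i W))
instance : IsScalarTower k Aᵐᵒᵖ (Ind i W) :=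
  inferInstanceAs (IsScalarTower k Aᵐᵒᵖ ((A ⊗[k] W) ⧸ indRel i W))

namespace Ind

variable {W}

/-- The quotient map `A ⊗ W → W ⊗_B A`. -/
def mk : A ⊗[k] W →ₗ[Aᵐᵒᵖ] Ind i W := (indRel i W).mkQ

/-- The map `w ↦ w ⊗ 1`. -/
def of : W →ₗ[k] Ind i W := (mk i).restrictScalars k ∘ₗ TensorProduct.mk k A W 1

variable {i}

lemma mk_tmul (a : A) (w : W) : mk i (a ⊗ₜ w) = op a • of i w := by
  change _ = op a • mk i (1 ⊗ₜ w)
  rw [← map_smul, TensorProduct.smul_tmul', op_smul_eq_mul, one_mul]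

lemma of_smul (b : B) (w : W) : of i (op b • w) = op (i b) • of i w := by
  rw [← mk_tmul, ← sub_eq_zero]
  change mk i (1 ⊗ₜ _) - _ = 0
  rw [← map_sub, ← neg_sub, map_neg, neg_eq_zero]
  exact (Submodule.Quotient.mk_eq_zero _).2 (Submodule.subset_span ⟨(b, w), rfl⟩)

lemma induction_on {motive : Ind i W → Prop} (v : Ind i W)
    (add : ∀ x y, motive x → motive y → motive (x + y))
    (smul_of : ∀ (a : A) (w : W), motive (op a • of i w)) : motive v := by
  obtain ⟨t, rfl⟩ := Submodule.mkQ_surjective (indRel i W) v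
  induction t with
  | zero =>
    have := smul_of 0 0
    rwa [MulOpposite.op_zero, zero_smul] at this
  | add s t hs ht => rw [map_add]; exact add _ _ hs ht
  | tmul a w =>
    have := smul_of a w
    rwa [← mk_tmul] at this

lemma exists_desc {Z : Type*} [AddCommGroup Z] [Module k Z] (h : A →ₗ[k] W →ₗ[k] Z)
    (hh : ∀ a b w, h (i b * a) w = h a (op b • w)) :
    ∃ F : Ind i W →ₗ[k] Z, ∀ a w, F (op a • of i w) = h a w := by
  have h0 : ∀ x ∈ indRel i W, ∀ a : A, TensorProduct.lift h (op a • x) = 0 := by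
    intro x hx
    induction hx using Submodule.span_induction with
    | mem x hx =>
      obtain ⟨⟨b, w⟩, rfl⟩ := hx
      intro a
      simp [smul_sub, TensorProduct.smul_tmul', hh]
    | zero => simp
    | add x y _ _ hx hy => intro a; rw [smul_add, map_add, hx, hy, add_zero]
    | smul c x _ hx =>
      intro a
      rw [← mul_smul, ← op_unop c, ← op_mul]
      exact hx _
  obtain ⟨F, hF⟩ := YDModule.exists_desc ((mk i).restrictScalars k)
    (Submodule.mkQ_surjective (indRel i W)) (TensorProduct.lift h) fun x hx => by
      have := h0 x ((Submodule.Quotient.mk_eq_zero _).1 hx) 1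
      rwa [op_one, one_smul] at this
  refine ⟨F, fun a w => ?_⟩
  rw [← mk_tmul]
  exact (hF (a ⊗ₜ w)).trans (TensorProduct.lift.tmul _ _)

/-- The `k`-linear map out of the induced module defined by a `B`-balanced map. -/
def desc {Z : Type*} [AddCommGroup Z] [Module k Z] (h : A →ₗ[k] W →ₗ[k] Z)
    (hh : ∀ a b w, h (i b * a) w = h a (op b • w)) : Ind i W →ₗ[k] Z :=
  (exists_desc h hh).choose

@[simp] lemma desc_smul_of {Z : Type*} [AddCommGroup Z] [Module k Z] (h : A →ₗ[k] W →ₗ[k] Z)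
    (hh : ∀ a b w, h (i b * a) w = h a (op b • w)) (a : A) (w : W) :
    desc h hh (op a • of i w) = h a w :=
  (exists_desc h hh).choose_spec a w

section Lift

variable {X : Type u} [AddCommGroup X] [Module k X] [Module Aᵐᵒᵖ X] [IsScalarTower k Aᵐᵒᵖ X]

/-- The universal property of the induced module. -/
def lift (f : W →ₗ[k] X) (hf : ∀ b w, f (op b • w) = op (i b) • f w) : Ind i W →ₗ[Aᵐᵒᵖ] X where
  toFun := desc ((LinearMap.lcomp k X f) ∘ₗ rightAct k A X) (fun a b w => by
    simp [rightAct, hf])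
  map_add' := map_add _
  map_smul' c v := by
    induction v using induction_on with
    | add x y hx hy => rw [smul_add, map_add, map_add, hx, hy, smul_add]
    | smul_of a w =>
      rw [← op_unop c, RingHom.id_apply, desc_smul_of, ← mul_smul, ← op_mul, desc_smul_of]
      simp [rightAct]

@[simp] lemma lift_of (f : W →ₗ[k] X) (hf : ∀ b w, f (op b • w) = op (i b) • f w) (w : W) :
    lift f hf (of i w) = f w := by
  have : lift f hf (op (1 : A) • of i w) = _ := desc_smul_of _ _ 1 w
  rw [op_one, one_smul] at this
  simpa [rightAct] using this

omit [Module k X] [IsScalarTower k Aᵐᵒᵖ X] in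
lemma hom_ext {f g : Ind i W →ₗ[Aᵐᵒᵖ] X} (h : ∀ w, f (of i w) = g (of i w)) : f = g := by
  ext v
  induction v using induction_on with
  | add x y hx hy => rw [map_add, map_add, hx, hy]
  | smul_of a w => rw [map_smul, map_smul, h]

end Lift

end Ind

end Induced

section Average

open TensorProduct MulOpposite

variable {k : Type u} [Field k] {A B : Type u} [Ring A] [HopfAlgebra k A] [Ring B]
  [HopfAlgebra k B] {i : B →ₐc[k] A} {Γ : Type v} [Group Γ] [Fintype Γ] [DecidableEq Γ]
  (G : CocentralGrading k A Γ)
  {X V : Type u} [AddCommGroup X] [Module k X] [Module Aᵐᵒᵖ X] [IsScalarTower k Aᵐᵒᵖ X]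
  [AddCommGroup V] [Module k V] [Module Aᵐᵒᵖ V] [IsScalarTower k Aᵐᵒᵖ V]

/-- The map `y ⊗ z ↦ (x ↦ f(x · S(y)) · z)`. -/
def sandwich (f : X →ₗ[k] V) : A ⊗[k] A →ₗ[k] X →ₗ[k] V :=
  TensorProduct.lift (LinearMap.mk₂ k
    (fun y z => rightAct k A V z ∘ₗ f ∘ₗ rightAct k A X (HopfAlgebra.antipode k y))
    (by intros; ext; simp) (by intros; ext; simp) (by intros; ext; simp) (by intros; ext; simp))

@[simp] lemma sandwich_tmul (f : X →ₗ[k] V) (y z : A) (x : X) :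
    sandwich f (y ⊗ₜ z) x = op z • f (op (HopfAlgebra.antipode k y) • x) := by
  simp [sandwich, rightAct]

namespace CocentralGrading

/-- A chosen homogeneous element of degree `g` and counit `1`. -/
def unitOf (g : Γ) : A := (G.exists_mem_comp_counit_eq_one g).choose

lemma unitOf_mem (g : Γ) : G.unitOf g ∈ G.comp g :=
  (G.exists_mem_comp_counit_eq_one g).choose_spec.1

lemma counit_unitOf (g : Γ) : Coalgebra.counit (R := k) (G.unitOf g) = 1 :=
  (G.exists_mem_comp_counit_eq_one g).choose_spec.2

/-- The degree `g` part `x ↦ f(x · S(c₍₁₎)) · c₍₂₎` of the average of `f`, where `c` has degree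
`g` and counit `1`. -/
def avgPart (f : X →ₗ[k] V) (g : Γ) : X →ₗ[k] V :=
  sandwich f (Coalgebra.comul (R := k) (G.unitOf g))

/-- The average of a `B`-linear map `f` over the grading. -/
def avg (f : X →ₗ[k] V) : X →ₗ[k] V := ∑ g, G.avgPart f g

lemma avg_apply (f : X →ₗ[k] V) (x : X) : G.avg f x = ∑ g, G.avgPart f g x :=
  LinearMap.sum_apply _ _ _

variable {G}

/-- Linear maps that agree on the tensors `y ⊗ z` with `y` and `z` of degree `g` agree on the
comultiplication of the chosen element of degree `g`. -/
lemma comul_unitOf_induction {Z : Type*} [AddCommGroup Z] [Module k Z] {g : Γ}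
    {α β : A ⊗[k] A →ₗ[k] Z}
    (h : ∀ y ∈ G.comp g, ∀ z ∈ G.comp g, α (y ⊗ₜ z) = β (y ⊗ₜ z)) :
    α (Coalgebra.comul (R := k) (G.unitOf g)) = β (Coalgebra.comul (R := k) (G.unitOf g)) := by
  have h' : α ∘ₗ map (G.prj g) (G.prj g) = β ∘ₗ map (G.prj g) (G.prj g) :=
    TensorProduct.ext' fun y z => h _ (prj_mem_comp g y) _ (prj_mem_comp g z)
  rw [← map_prj_comul (G.unitOf_mem g)]
  exact LinearMap.congr_fun h' _

/-- `S(c₍₁₎) c₍₂₎ = 1`, applied under an arbitrary linear map. -/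
lemma apply_antipode_mul_comul_unitOf {Z : Type*} [AddCommGroup Z] [Module k Z] (g : Γ)
    (γ : A →ₗ[k] Z) :
    (γ ∘ₗ LinearMap.mul' k A ∘ₗ (HopfAlgebra.antipode k).rTensor A)
      (Coalgebra.comul (R := k) (G.unitOf g)) = γ 1 := by
  rw [LinearMap.comp_apply, LinearMap.comp_apply,
    HopfAlgebra.mul_antipode_rTensor_comul_apply, counit_unitOf, map_one]

variable (hi : ∀ a ∈ G.comp 1, ∃ b, i b = a) {f : X →ₗ[k] V}
  (hf : ∀ b x, f (op (i b) • x) = op (i b) • f x)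

include hi hf in
lemma avgPart_smul {g : Γ} {t : A} (ht : t ∈ G.comp g) (x : X) :
    G.avgPart f g (op t • x) = op t • f x := by
  have h := comul_unitOf_induction (G := G) (g := g)
    (α := (LinearMap.applyₗ (op t • x) : (X →ₗ[k] V) →ₗ[k] V) ∘ₗ sandwich f)
    (β := ((LinearMap.applyₗ (f x) : (V →ₗ[k] V) →ₗ[k] V) ∘ₗ rightAct k A V ∘ₗ
      LinearMap.mulLeft k t) ∘ₗ LinearMap.mul' k A ∘ₗ (HopfAlgebra.antipode k).rTensor A)
    (fun y hy z _ => by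
      have hm := mul_mem_comp ht (antipode_mem_comp hy)
      rw [mul_inv_cancel] at hm
      obtain ⟨b, hb⟩ := hi _ hm
      have h1 : f (op (HopfAlgebra.antipode k y) • op t • x) =
          op (HopfAlgebra.antipode k y) • op t • f x := by
        rw [← mul_smul, ← mul_smul, ← op_mul, ← hb, hf]
      simp [rightAct, h1])
  rw [apply_antipode_mul_comul_unitOf] at h
  simpa [rightAct, avgPart] using h

include hi hf in
lemma smul_avgPart {g h : Γ} {a : A} (ha : a ∈ G.comp h) (x : X) :
    op a • G.avgPart f g x = G.avgPart f (g * h) (op a • x) := by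
  have key := comul_unitOf_induction (G := G) (g := g)
    (α := rightAct k A V a ∘ₗ (LinearMap.applyₗ x : (X →ₗ[k] V) →ₗ[k] V) ∘ₗ sandwich f)
    (β := (G.avgPart f (g * h) ∘ₗ (LinearMap.applyₗ x : (X →ₗ[k] X) →ₗ[k] X) ∘ₗ
      rightAct k A X ∘ₗ LinearMap.mulRight k a) ∘ₗ LinearMap.mul' k A ∘ₗ
        (HopfAlgebra.antipode k).rTensor A)
    (fun y _ z hz => by
      have := avgPart_smul hi hf (mul_mem_comp hz ha) (op (HopfAlgebra.antipode k y) • x)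
      rw [op_mul, mul_smul, mul_smul] at this
      simp [rightAct, this])
  rw [apply_antipode_mul_comul_unitOf] at key
  simpa [rightAct, avgPart] using key

include hi hf in
/-- The average of a `B`-linear map is `A`-linear. -/
lemma avg_smul (a : A) (x : X) : G.avg f (op a • x) = op a • G.avg f x := by
  induction a using induction_on (G := G) with
  | add a b ha hb => rw [MulOpposite.op_add, add_smul, add_smul, map_add, ha, hb]
  | hom h a ha =>
    rw [avg_apply, avg_apply, Finset.smul_sum]
    simp_rw [smul_avgPart hi hf ha]
    exact (Equiv.sum_comp (Equiv.mulRight h) fun g => G.avgPart f g (op a • x)).symm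

include hi hf in
lemma avgPart_one (x : X) : G.avgPart f 1 x = f x := by
  have := avgPart_smul hi hf one_mem_comp x
  rwa [op_one, one_smul, one_smul] at this

include hi hf in
lemma apply_avg {Z : Type*} [AddCommGroup Z] [Module k Z] (ρ : V →ₗ[k] Z)
    (hρ : ∀ g ≠ 1, ∀ z ∈ G.comp g, ∀ x, ρ (op z • f x) = 0) (x : X) :
    ρ (G.avg f x) = ρ (f x) := by
  rw [avg_apply, map_sum, Finset.sum_eq_single 1, avgPart_one hi hf]
  · intro g _ hg
    have := comul_unitOf_induction (G := G) (g := g)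
      (α := ρ ∘ₗ (LinearMap.applyₗ x : (X →ₗ[k] V) →ₗ[k] V) ∘ₗ sandwich f) (β := 0)
      (fun y _ z hz => by simp [hρ g hg z hz])
    simpa [avgPart] using this
  · simp

include hi hf in
lemma avg_eq_of_forall {x : X} (hx : ∀ g ≠ 1, ∀ y ∈ G.comp g, f (op y • x) = 0) :
    G.avg f x = f x := by
  rw [avg_apply, Finset.sum_eq_single 1, avgPart_one hi hf]
  · intro g _ hg
    have := comul_unitOf_induction (G := G) (g := g)
      (α := (LinearMap.applyₗ x : (X →ₗ[k] V) →ₗ[k] V) ∘ₗ sandwich f) (β := 0)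
      (fun y hy z _ => by
        simp [hx g⁻¹ (by simpa using hg) _ (antipode_mem_comp hy)])
    simpa [avgPart] using this
  · simp

/-- Averaging the restriction of an `A`-linear map multiplies it by the order of the group. -/
lemma avg_restrictScalars (F : X →ₗ[Aᵐᵒᵖ] V) (x : X) :
    G.avg (F.restrictScalars k) x = Fintype.card Γ • F x := by
  rw [avg_apply, ← Finset.card_univ, ← Finset.sum_const]
  refine Finset.sum_congr rfl fun g _ => ?_
  have := comul_unitOf_induction (G := G) (g := g)
    (α := (LinearMap.applyₗ x : (X →ₗ[k] V) →ₗ[k] V) ∘ₗ sandwich (F.restrictScalars k))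
    (β := ((LinearMap.applyₗ (F x) : (V →ₗ[k] V) →ₗ[k] V) ∘ₗ rightAct k A V) ∘ₗ
      LinearMap.mul' k A ∘ₗ (HopfAlgebra.antipode k).rTensor A)
    (fun y _ z _ => by simp [rightAct])
  rw [apply_antipode_mul_comul_unitOf] at this
  simpa [rightAct, avgPart] using this

lemma map_avg {V' : Type u} [AddCommGroup V'] [Module k V'] [Module Aᵐᵒᵖ V']
    [IsScalarTower k Aᵐᵒᵖ V'] (F : V →ₗ[Aᵐᵒᵖ] V') (f : X →ₗ[k] V) (x : X) :
    F (G.avg f x) = G.avg (F.restrictScalars k ∘ₗ f) x := by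
  rw [avg_apply, avg_apply, map_sum]
  refine Finset.sum_congr rfl fun g _ => ?_
  have := comul_unitOf_induction (G := G) (g := g)
    (α := F.restrictScalars k ∘ₗ (LinearMap.applyₗ x : (X →ₗ[k] V) →ₗ[k] V) ∘ₗ sandwich f)
    (β := (LinearMap.applyₗ x : (X →ₗ[k] V') →ₗ[k] V') ∘ₗ sandwich (F.restrictScalars k ∘ₗ f))
    (fun y _ z _ => by simp)
  simpa [avgPart] using this

lemma avg_comp {X' : Type u} [AddCommGroup X'] [Module k X'] [Module Aᵐᵒᵖ X']
    [IsScalarTower k Aᵐᵒᵖ X'] (f : X →ₗ[k] V) (F : X' →ₗ[Aᵐᵒᵖ] X) (x : X') :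
    G.avg f (F x) = G.avg (f ∘ₗ F.restrictScalars k) x := by
  rw [avg_apply, avg_apply]
  refine Finset.sum_congr rfl fun g _ => ?_
  have := comul_unitOf_induction (G := G) (g := g)
    (α := (LinearMap.applyₗ (F x) : (X →ₗ[k] V) →ₗ[k] V) ∘ₗ sandwich f)
    (β := (LinearMap.applyₗ x : (X' →ₗ[k] V) →ₗ[k] V) ∘ₗ sandwich (f ∘ₗ F.restrictScalars k))
    (fun y _ z _ => by simp)
  simpa [avgPart] using this

end CocentralGrading

end Average

/-! ### Induction is adjoint to restriction on both sides -/

section Frobenius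

open TensorProduct MulOpposite

variable {k : Type u} [Field k] {A B : Type u} [Ring A] [HopfAlgebra k A] [Ring B]
  [HopfAlgebra k B] {i : B →ₐc[k] A} {Γ : Type v} [Group Γ] [Fintype Γ] [DecidableEq Γ]
  {G : CocentralGrading k A Γ}

/-- `i` identifies `B` with the component of degree `1` of the grading `G`. -/
structure IsDegreeOne (i : B →ₐc[k] A) (G : CocentralGrading k A Γ) : Prop where
  injective : Function.Injective i
  mem_comp_one_iff (a : A) : a ∈ G.comp 1 ↔ ∃ b, i b = a

namespace IsDegreeOne

open CocentralGrading

variable (hi : IsDegreeOne i G)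

include hi in
lemma exists_of_mem : ∀ a ∈ G.comp 1, ∃ b, i b = a := fun a => (hi.mem_comp_one_iff a).1

include hi in
lemma map_mem (b : B) : i b ∈ G.comp 1 := (hi.mem_comp_one_iff _).2 ⟨b, rfl⟩

include hi in
lemma exists_proj : ∃ q : A →ₗ[k] B, ∀ a, i (q a) = G.prj 1 a :=
  YDModule.exists_lift (i : B →ₗ[k] A) hi.injective (G.prj 1)
    fun a => hi.exists_of_mem _ (prj_mem_comp 1 a)

/-- The projection of `A` onto its degree one component, viewed as a map to `B`. -/
def proj : A →ₗ[k] B := hi.exists_proj.choose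

lemma map_proj (a : A) : i (hi.proj a) = G.prj 1 a := hi.exists_proj.choose_spec a

@[simp] lemma proj_map (b : B) : hi.proj (i b) = b :=
  hi.injective ((hi.map_proj _).trans (mem_comp.1 (hi.map_mem b)))

lemma proj_of_mem {g : Γ} (hg : g ≠ 1) {a : A} (ha : a ∈ G.comp g) : hi.proj a = 0 :=
  hi.injective (by rw [hi.map_proj, prj_of_mem ha, if_neg hg.symm, map_zero])

lemma proj_map_mul (b : B) (a : A) : hi.proj (i b * a) = b * hi.proj a := by
  induction a using induction_on (G := G) with
  | add x y hx hy => rw [mul_add, map_add, hx, hy, map_add, mul_add]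
  | hom g x hx =>
    by_cases hg : g = 1
    · subst hg
      obtain ⟨c, rfl⟩ := hi.exists_of_mem x hx
      rw [← map_mul, proj_map, proj_map]
    · have := mul_mem_comp (hi.map_mem b) hx
      rw [one_mul] at this
      rw [hi.proj_of_mem hg hx, hi.proj_of_mem hg this, mul_zero]

lemma proj_mul_map (b : B) (a : A) : hi.proj (a * i b) = hi.proj a * b := by
  induction a using induction_on (G := G) with
  | add x y hx hy => rw [add_mul, map_add, hx, hy, map_add, add_mul]
  | hom g x hx =>
    by_cases hg : g = 1
    · subst hg
      obtain ⟨c, rfl⟩ := hi.exists_of_mem x hx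
      rw [← map_mul, proj_map, proj_map]
    · have := mul_mem_comp hx (hi.map_mem b)
      rw [mul_one] at this
      rw [hi.proj_of_mem hg hx, hi.proj_of_mem hg this, zero_mul]

section Modules

variable {W : Type u} [AddCommGroup W] [Module k W] [Module Bᵐᵒᵖ W] [IsScalarTower k Bᵐᵒᵖ W]

/-- The `B`-linear projection `w ⊗ a ↦ w · a₁` of the induced module, where `a₁ ∈ B` is the
component of `a` of degree `1`. -/
def indProj (W : Type u) [AddCommGroup W] [Module k W] [Module Bᵐᵒᵖ W] [IsScalarTower k Bᵐᵒᵖ W] :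
    Ind i W →ₗ[k] W :=
  Ind.desc (rightAct k B W ∘ₗ hi.proj) (fun a b w => by
    simp [rightAct, hi.proj_map_mul])

@[simp] lemma indProj_smul_of (a : A) (w : W) :
    hi.indProj W (op a • Ind.of i w) = op (hi.proj a) • w := by
  simp [indProj, rightAct]

@[simp] lemma indProj_of (w : W) : hi.indProj W (Ind.of i w) = w := by
  have h := hi.indProj_smul_of 1 w
  rwa [← map_one i, proj_map, map_one, op_one, op_one, one_smul, one_smul] at h

lemma indProj_smul (b : B) (v : Ind i W) :
    hi.indProj W (op (i b) • v) = op b • hi.indProj W v := by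
  induction v using Ind.induction_on with
  | add x y hx hy => rw [smul_add, map_add, hx, hy, map_add, smul_add]
  | smul_of a w =>
    rw [← mul_smul, ← op_mul, indProj_smul_of, indProj_smul_of, proj_mul_map, op_mul, mul_smul]

variable {W' : Type u} [AddCommGroup W'] [Module k W'] [Module Bᵐᵒᵖ W'] [IsScalarTower k Bᵐᵒᵖ W']

lemma indProj_natural (F : Ind i W →ₗ[Aᵐᵒᵖ] Ind i W') (e : W →ₗ[Bᵐᵒᵖ] W')
    (h : ∀ w, F (Ind.of i w) = Ind.of i (e w)) (v : Ind i W) :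
    hi.indProj W' (F v) = e (hi.indProj W v) := by
  induction v using Ind.induction_on with
  | add x y hx hy => rw [map_add, map_add, hx, hy, map_add, map_add]
  | smul_of a w => rw [map_smul, h, indProj_smul_of, indProj_smul_of, map_smul]

variable {X : Type u} [AddCommGroup X] [Module k X] [Module Aᵐᵒᵖ X] [IsScalarTower k Aᵐᵒᵖ X]
  (p : X →ₗ[k] W) (hp : ∀ b x, p (op (i b) • x) = op b • p x)

omit [IsScalarTower k Bᵐᵒᵖ W] [IsScalarTower k Aᵐᵒᵖ X] in
include hp in
lemma of_comp_smul (b : B) (x : X) :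
    (Ind.of i ∘ₗ p) (op (i b) • x) = op (i b) • (Ind.of i ∘ₗ p) x := by
  rw [LinearMap.comp_apply, hp, Ind.of_smul, LinearMap.comp_apply]

/-- The `A`-linear map to the induced module that corresponds to a `B`-linear map `p` from an
`A`-module to `W`: the average of `x ↦ p(x) ⊗ 1`. -/
def coind : X →ₗ[Aᵐᵒᵖ] Ind i W where
  toFun := G.avg (Ind.of i ∘ₗ p)
  map_add' := map_add _
  map_smul' a x := avg_smul hi.exists_of_mem (of_comp_smul p hp) a.unop x

omit [IsScalarTower k Bᵐᵒᵖ W] in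
lemma coind_apply (x : X) : hi.coind p hp x = G.avg (Ind.of i ∘ₗ p) x := rfl

@[simp] lemma indProj_coind (x : X) : hi.indProj W (hi.coind p hp x) = p x := by
  rw [coind_apply, apply_avg hi.exists_of_mem (of_comp_smul p hp)]
  · simp
  · intro g hg z hz x
    rw [LinearMap.comp_apply, indProj_smul_of, hi.proj_of_mem hg hz, MulOpposite.op_zero, zero_smul]

lemma coind_indProj (v : Ind i W) : hi.coind (hi.indProj W) hi.indProj_smul v = v := by
  have : hi.coind (hi.indProj W) hi.indProj_smul = LinearMap.id := by
    refine Ind.hom_ext fun w => ?_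
    rw [coind_apply, avg_eq_of_forall hi.exists_of_mem (of_comp_smul _ hi.indProj_smul)]
    · simp
    · intro g hg y hy
      rw [LinearMap.comp_apply, indProj_smul_of, hi.proj_of_mem hg hy, MulOpposite.op_zero,
        zero_smul, map_zero]
  exact LinearMap.congr_fun this v

omit [IsScalarTower k Bᵐᵒᵖ W] [IsScalarTower k Bᵐᵒᵖ W'] in
lemma coind_natural {X' : Type u} [AddCommGroup X'] [Module k X'] [Module Aᵐᵒᵖ X']
    [IsScalarTower k Aᵐᵒᵖ X'] (p' : X' →ₗ[k] W') (hp' : ∀ b x, p' (op (i b) • x) = op b • p' x)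
    (f : X →ₗ[Aᵐᵒᵖ] X') (F : Ind i W →ₗ[Aᵐᵒᵖ] Ind i W')
    (h : ∀ x, F (Ind.of i (p x)) = Ind.of i (p' (f x))) (x : X) :
    F (hi.coind p hp x) = hi.coind p' hp' (f x) := by
  rw [coind_apply, coind_apply, map_avg, avg_comp]
  congr 2
  ext x
  exact h x

omit [IsScalarTower k Bᵐᵒᵖ W] in
/-- If `p` has an inverse, the composite `X → W ⊗_B A → X` of `coind p` with the `A`-linear
extension of that inverse is multiplication by the order of the group. -/
lemma map_coind (F : Ind i W →ₗ[Aᵐᵒᵖ] X) (h : ∀ x, F (Ind.of i (p x)) = x) (x : X) :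
    F (hi.coind p hp x) = Fintype.card Γ • x := by
  rw [coind_apply, map_avg]
  have : F.restrictScalars k ∘ₗ Ind.of i ∘ₗ p =
      (LinearMap.id (R := Aᵐᵒᵖ) (M := X)).restrictScalars k :=
    LinearMap.ext h
  rw [this, avg_restrictScalars]
  rfl

end Modules

end IsDegreeOne

end Frobenius

/-! ### Modules over `A` and over `B` -/

section ModuleCategories

open MulOpposite
open scoped ModuleCat.Algebra

variable {k : Type u} [Field k] {A B : Type u} [Ring A] [HopfAlgebra k A] [Ring B]
  [HopfAlgebra k B] (i : B →ₐc[k] A)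

/-- The map of induced modules defined by a `B`-linear map. -/
def Ind.map {W W' : Type u} [AddCommGroup W] [Module k W] [Module Bᵐᵒᵖ W] [AddCommGroup W']
    [Module k W'] [Module Bᵐᵒᵖ W'] (e : W →ₗ[k] W') (he : ∀ (b : B) w, e (op b • w) = op b • e w) :
    Ind i W →ₗ[Aᵐᵒᵖ] Ind i W' :=
  Ind.lift (Ind.of i ∘ₗ e) fun b w => by
    rw [LinearMap.comp_apply, he, Ind.of_smul, LinearMap.comp_apply]

@[simp] lemma Ind.map_of {W W' : Type u} [AddCommGroup W] [Module k W] [Module Bᵐᵒᵖ W]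
    [AddCommGroup W'] [Module k W'] [Module Bᵐᵒᵖ W'] (e : W →ₗ[k] W')
    (he : ∀ (b : B) w, e (op b • w) = op b • e w) (w : W) :
    Ind.map i e he (Ind.of i w) = Ind.of i (e w) := Ind.lift_of _ _ _

/-- Restriction of right modules along `i : B → A`. -/
abbrev resFunctor : ModuleCat.{u} Aᵐᵒᵖ ⥤ ModuleCat.{u} Bᵐᵒᵖ :=
  ModuleCat.restrictScalars (RingHom.op (i : B →+* A))

/-- The map of induced modules defined by a morphism of right `B`-modules. -/
def indMap {W W' : ModuleCat.{u} Bᵐᵒᵖ} (f : W ⟶ W') : Ind i W →ₗ[Aᵐᵒᵖ] Ind i W' :=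
  Ind.map i (f.hom.restrictScalars k) fun _ _ => map_smul f.hom _ _

@[simp] lemma indMap_of {W W' : ModuleCat.{u} Bᵐᵒᵖ} (f : W ⟶ W') (w : W) :
    indMap i f (Ind.of i w) = Ind.of i (f.hom w) := Ind.map_of _ _ _ _

/-- Induction of right modules along `i : B → A`. -/
def indFunctor : ModuleCat.{u} Bᵐᵒᵖ ⥤ ModuleCat.{u} Aᵐᵒᵖ where
  obj W := ModuleCat.of Aᵐᵒᵖ (Ind i W)
  map f := ModuleCat.ofHom (indMap i f)
  map_id W := ModuleCat.hom_ext (Ind.hom_ext fun w => indMap_of i _ w)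
  map_comp {U V W} f g := ModuleCat.hom_ext (Ind.hom_ext
    (f := indMap i (f ≫ g)) (g := indMap i g ∘ₗ indMap i f) fun w => by simp)

instance : (indFunctor i).Additive where
  map_add {W W' f g} := ModuleCat.hom_ext (Ind.hom_ext
    (f := indMap i (f + g)) (g := indMap i f + indMap i g) fun w => by simp)

/-- The identity of an `A`-module `X`, as a `k`-linear map to the restriction of `X` to `B`. The
`k`-module structures on both sides, through `A` and through `B`, are only propositionally
equal. -/
def toRes (X : ModuleCat.{u} Aᵐᵒᵖ) : X →ₗ[k] (resFunctor i).obj X where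
  toFun x := x
  map_add' _ _ := rfl
  map_smul' r x := by
    change (algebraMap k Aᵐᵒᵖ r) • x = (op (i (algebraMap k B r)) : Aᵐᵒᵖ) • x
    rw [AlgHomClass.commutes]
    rfl

/-- The inverse of `toRes`. -/
def ofRes (X : ModuleCat.{u} Aᵐᵒᵖ) : (resFunctor i).obj X →ₗ[k] X where
  toFun x := x
  map_add' _ _ := rfl
  map_smul' r x := ((toRes i X).map_smul r x).symm

/-- The unit `w ↦ w ⊗ 1` of induction and restriction. -/
def toResInd (W : ModuleCat.{u} Bᵐᵒᵖ) : W ⟶ (resFunctor i).obj ((indFunctor i).obj W) :=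
  ModuleCat.ofHom (Y := (resFunctor i).obj ((indFunctor i).obj W))
    { toFun w := Ind.of i w
      map_add' := (Ind.of i (W := W)).map_add
      map_smul' b w := Ind.of_smul b.unop w }

/-- The counit `x ⊗ a ↦ x · a` of induction and restriction. -/
def ofIndRes (X : ModuleCat.{u} Aᵐᵒᵖ) : (indFunctor i).obj ((resFunctor i).obj X) ⟶ X :=
  ModuleCat.ofHom (Ind.lift (ofRes i X) fun _ _ => rfl)

lemma ofIndRes_of (X : ModuleCat.{u} Aᵐᵒᵖ) (x : (resFunctor i).obj X) :
    (ofIndRes i X).hom (Ind.of i x) = ofRes i X x :=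
  Ind.lift_of (ofRes i X) (fun _ _ => rfl) x

lemma indFunctor_map_of {W W' : ModuleCat.{u} Bᵐᵒᵖ} (f : W ⟶ W') (w : W) :
    ((indFunctor i).map f).hom (Ind.of i w) = Ind.of i (f.hom w) := indMap_of _ _ _

variable {i} in
lemma indFunctor_hom_ext {W : ModuleCat.{u} Bᵐᵒᵖ} {X : ModuleCat.{u} Aᵐᵒᵖ}
    {f g : (indFunctor i).obj W ⟶ X} (h : ∀ w, f.hom (Ind.of i w) = g.hom (Ind.of i w)) : f = g :=
  ModuleCat.hom_ext (Ind.hom_ext h)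

lemma toResInd_naturality {W W' : ModuleCat.{u} Bᵐᵒᵖ} (f : W ⟶ W') :
    f ≫ toResInd i W' = toResInd i W ≫ (resFunctor i).map ((indFunctor i).map f) :=
  ModuleCat.hom_ext (LinearMap.ext fun w => (indFunctor_map_of i f w).symm)

lemma ofIndRes_naturality {X Y : ModuleCat.{u} Aᵐᵒᵖ} (f : X ⟶ Y) :
    (indFunctor i).map ((resFunctor i).map f) ≫ ofIndRes i Y = ofIndRes i X ≫ f := by
  refine indFunctor_hom_ext fun x => ?_
  have h₁ := congrArg (ofIndRes i Y).hom (indFunctor_map_of i ((resFunctor i).map f) x)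
  have h₂ := ofIndRes_of i Y (((resFunctor i).map f).hom x)
  have h₃ := congrArg f.hom (ofIndRes_of i X x)
  exact h₁.trans (h₂.trans h₃.symm)

/-- Induction is left adjoint to restriction. -/
def indResAdjunction : indFunctor i ⊣ resFunctor i :=
  Adjunction.mkOfUnitCounit
    { unit := { app := toResInd i, naturality _ _ := toResInd_naturality i }
      counit := { app := ofIndRes i, naturality _ _ := ofIndRes_naturality i }
      left_triangle := by
        ext W : 2
        exact indFunctor_hom_ext fun w =>
          (congrArg (ofIndRes i _).hom (indFunctor_map_of i (toResInd i W) w)).trans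
            (ofIndRes_of i _ _)
      right_triangle := by
        ext X : 2
        exact ModuleCat.hom_ext (LinearMap.ext fun x => ofIndRes_of i X x) }

variable {i} {Γ : Type v} [Group Γ] [Fintype Γ] [DecidableEq Γ] {G : CocentralGrading k A Γ}
  (hi : IsDegreeOne i G)

namespace IsDegreeOne

/-- The unit of restriction and induction, the average of `x ↦ x ⊗ 1`. -/
def toIndRes (X : ModuleCat.{u} Aᵐᵒᵖ) : X ⟶ (indFunctor i).obj ((resFunctor i).obj X) :=
  ModuleCat.ofHom (hi.coind (toRes i X) fun _ _ => rfl)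

/-- The counit of restriction and induction, the projection onto degree `1`. -/
def ofResInd (W : ModuleCat.{u} Bᵐᵒᵖ) : (resFunctor i).obj ((indFunctor i).obj W) ⟶ W :=
  ModuleCat.ofHom (X := (resFunctor i).obj ((indFunctor i).obj W))
    { toFun := hi.indProj W
      map_add' := (hi.indProj W).map_add
      map_smul' b v := hi.indProj_smul b.unop v }

/-- Induction is also right adjoint to restriction. -/
def resIndAdjunction : resFunctor i ⊣ indFunctor i :=
  Adjunction.mkOfUnitCounit
    { unit :=
        { app := hi.toIndRes
          naturality X Y f := ModuleCat.hom_ext (LinearMap.ext fun x =>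
            (hi.coind_natural (toRes i X) (fun _ _ => rfl) (toRes i Y) (fun _ _ => rfl) f.hom
              ((indFunctor i).map ((resFunctor i).map f)).hom
              (fun x => indFunctor_map_of i _ _) x).symm) }
      counit :=
        { app := hi.ofResInd
          naturality W W' f := ModuleCat.hom_ext (LinearMap.ext fun v =>
            hi.indProj_natural ((indFunctor i).map f).hom f.hom (indFunctor_map_of i f) v) }
      left_triangle := by
        ext X : 2
        exact ModuleCat.hom_ext (LinearMap.ext fun x =>
          hi.indProj_coind (toRes i X) (fun _ _ => rfl) x)
      right_triangle := by
        ext W : 2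
        refine ModuleCat.hom_ext (LinearMap.ext fun v => ?_)
        exact (hi.coind_natural (toRes i _) (fun _ _ => rfl) (hi.indProj W) hi.indProj_smul
          (LinearMap.id : Ind i W →ₗ[Aᵐᵒᵖ] Ind i W) ((indFunctor i).map (hi.ofResInd W)).hom
          (fun x => indFunctor_map_of i _ _) v).trans (hi.coind_indProj v) }

/-- Maschke's argument: if the order of `Γ` is invertible, every `A`-module is a retract of a
module induced from `B`. -/
def retractIndRes (hΓ : (Fintype.card Γ : k) ≠ 0) (X : ModuleCat.{u} Aᵐᵒᵖ) :
    Retract X ((indFunctor i).obj ((resFunctor i).obj X)) where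
  i := hi.toIndRes X
  r := (Fintype.card Γ : k)⁻¹ • ofIndRes i X
  retract := ModuleCat.hom_ext (LinearMap.ext fun x => by
    have h := hi.map_coind (toRes i X) (fun _ _ => rfl) (ofIndRes i X).hom
      (fun x => ofIndRes_of i X _) x
    refine (congrArg ((Fintype.card Γ : k)⁻¹ • ·) h).trans ?_
    change (Fintype.card Γ : k)⁻¹ • Fintype.card Γ • x = x
    rw [← Nat.cast_smul_eq_nsmul k, inv_smul_smul₀ hΓ])

include hi in
lemma extDim_restrict (hΓ : (Fintype.card Γ : k) ≠ 0) (X : ModuleCat.{u} Aᵐᵒᵖ) :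
    extDim ((resFunctor i).obj X) = extDim X :=
  extDim_obj_eq_of_adjunctions hi.resIndAdjunction (indResAdjunction i) (hi.retractIndRes hΓ X)

end IsDegreeOne

end ModuleCategories

/-! ### Hochschild dimension through one-sided modules -/

section Hochschild

open MulOpposite TensorProduct
open scoped ModuleCat.Algebra

variable (k : Type u) [Field k] (H : Type u) [Ring H] [HopfAlgebra k H]

local notation "Δ" => Coalgebra.comul (R := k) (A := H)
local notation "S" => HopfAlgebra.antipode k (A := H)
local notation "E" => H ⊗[k] Hᵐᵒᵖ

/-- The algebra map `c ↦ S(c₍₁₎) ⊗ c₍₂₎` from `Hᵐᵒᵖ` to the enveloping algebra of `H`. -/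
def envMap : Hᵐᵒᵖ →ₐ[k] E :=
  AlgHom.ofLinearMap
    (map (S) (opLinearEquiv k).toLinearMap ∘ₗ (Δ) ∘ₗ (opLinearEquiv k).symm.toLinearMap)
    (by
      simp [Algebra.TensorProduct.one_def])
    (fun a b => by
      have key : ∀ s t : H ⊗[k] H, map (S) (opLinearEquiv k : H ≃ₗ[k] Hᵐᵒᵖ).toLinearMap (s * t) =
          map (S) (opLinearEquiv k).toLinearMap t * map (S) (opLinearEquiv k).toLinearMap s := by
        intro s t
        induction s with
        | zero => simp
        | add s s' hs hs' => simp only [add_mul, map_add, hs, hs', mul_add]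
        | tmul x y =>
          induction t with
          | zero => simp
          | add s s' hs hs' => simp only [mul_add, map_add, hs, hs', add_mul]
          | tmul z w => simp [HopfAlgebra.antipode_mul_antidistrib]
      have := key (Δ b.unop) (Δ a.unop)
      rw [← Bialgebra.comul_mul] at this
      simpa using this)

/-- The functor sending an `H`-bimodule `M` to `M` with the right action
`m · c = S(c₍₁₎) m c₍₂₎`. -/
abbrev adFunctor : ModuleCat.{u} E ⥤ ModuleCat.{u} Hᵐᵒᵖ :=
  ModuleCat.restrictScalars (envMap k H).toRingHom

/-- The algebra map `a ⊗ c ↦ ε(a) c`, a retraction of `envMap`. -/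
def envRetract : E →ₐ[k] Hᵐᵒᵖ :=
  Algebra.TensorProduct.lift ((Algebra.ofId k Hᵐᵒᵖ).comp (Bialgebra.counitAlgHom k H))
    (AlgHom.id k Hᵐᵒᵖ) fun a _ => Algebra.commutes (Coalgebra.counit (R := k) a) _

lemma envRetract_tmul (a : H) (c : Hᵐᵒᵖ) :
    envRetract k H (a ⊗ₜ c) = Coalgebra.counit (R := k) a • c :=
  (Algebra.TensorProduct.lift_tmul ((Algebra.ofId k Hᵐᵒᵖ).comp (Bialgebra.counitAlgHom k H))
    (AlgHom.id k Hᵐᵒᵖ) (fun a _ => Algebra.commutes (Coalgebra.counit (R := k) a) _) a c).trans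
      (Algebra.smul_def (Coalgebra.counit (R := k) a) c).symm

lemma envRetract_comp_envMap :
    (envRetract k H).toRingHom.comp (envMap k H).toRingHom = RingHom.id Hᵐᵒᵖ := by
  have h : (envRetract k H).toLinearMap ∘ₗ map (S) (opLinearEquiv k).toLinearMap =
      (opLinearEquiv k).toLinearMap ∘ₗ (TensorProduct.lid k H).toLinearMap ∘ₗ
        (Coalgebra.counit (R := k) (A := H)).rTensor H := by
    refine TensorProduct.ext' fun x y => ?_
    simp [envRetract_tmul]
  ext c
  have := LinearMap.congr_fun h (Δ c.unop)
  simp only [LinearMap.comp_apply, Coalgebra.rTensor_counit_comul] at this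
  refine this.trans ?_
  simp

instance : (adFunctor k H).EssSurj where
  mem_essImage N :=
    ⟨(ModuleCat.restrictScalars (envRetract k H).toRingHom).obj N,
      ⟨((ModuleCat.restrictScalarsComp'App _ _ _ (envRetract_comp_envMap k H).symm N).symm ≪≫
        ModuleCat.restrictScalarsId'App _ rfl N)⟩⟩

section Free

variable (N : Type u) [AddCommGroup N] [Module k N] [Module Hᵐᵒᵖ N] [IsScalarTower k Hᵐᵒᵖ N]

/-- The `H`-bimodule `H ⊗ N` attached to a right `H`-module `N`, with the action
`a (x ⊗ n) c = a x c₍₁₎ ⊗ n · c₍₂₎`. -/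
def FreeBimodule : Type u := H ⊗[k] N

instance : AddCommGroup (FreeBimodule k H N) := inferInstanceAs (AddCommGroup (H ⊗[k] N))
instance : Module k (FreeBimodule k H N) := inferInstanceAs (Module k (H ⊗[k] N))

variable {H N}

/-- The pure tensor `x ⊗ n`. -/
def FreeBimodule.mk : H →ₗ[k] N →ₗ[k] FreeBimodule k H N := TensorProduct.mk k H N

/-- The linear map out of `H ⊗ N` defined by a bilinear map. -/
def FreeBimodule.lift {Z : Type*} [AddCommGroup Z] [Module k Z] (f : H →ₗ[k] N →ₗ[k] Z) :
    FreeBimodule k H N →ₗ[k] Z := TensorProduct.lift f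

omit [Module Hᵐᵒᵖ N] [IsScalarTower k Hᵐᵒᵖ N] in
@[simp] lemma FreeBimodule.lift_mk {Z : Type*} [AddCommGroup Z] [Module k Z]
    (f : H →ₗ[k] N →ₗ[k] Z) (x : H) (n : N) : lift k f (mk k x n) = f x n := rfl

variable {k} in
omit [Module Hᵐᵒᵖ N] [IsScalarTower k Hᵐᵒᵖ N] in
lemma FreeBimodule.hom_ext {Z : Type*} [AddCommGroup Z] [Module k Z]
    {f g : FreeBimodule k H N →ₗ[k] Z} (h : ∀ x n, f (mk k x n) = g (mk k x n)) : f = g :=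
  TensorProduct.ext' (M := H) (N := N) h

variable {k} in
omit [Module Hᵐᵒᵖ N] [IsScalarTower k Hᵐᵒᵖ N] in
lemma FreeBimodule.induction_on {motive : FreeBimodule k H N → Prop} (v : FreeBimodule k H N)
    (add : ∀ x y, motive x → motive y → motive (x + y))
    (mk : ∀ x n, motive (FreeBimodule.mk k x n)) : motive v := by
  induction v using TensorProduct.induction_on with
  | zero =>
    have := mk 0 0
    rw [map_zero] at this
    exact this
  | add x y hx hy => exact add _ _ hx hy
  | tmul x n => exact mk x n

variable (H N)

/-- The linear map `a ↦ (x ⊗ n ↦ a x ⊗ n)`. -/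
def leftTwist : H →ₗ[k] Module.End k (FreeBimodule k H N) :=
  (TensorProduct.mapBilinear (RingHom.id k) H N H N).flip LinearMap.id ∘ₗ LinearMap.mul k H

/-- The linear map `a ⊗ c ↦ (x ⊗ n ↦ x a ⊗ n · c)`. -/
def diagTwist : H ⊗[k] H →ₗ[k] Module.End k (FreeBimodule k H N) :=
  TensorProduct.homTensorHomMap (RingHom.id k) H N H N ∘ₗ
    TensorProduct.map (rightAct k H H) (rightAct k H N)

variable {H N}

omit [Module Hᵐᵒᵖ N] [IsScalarTower k Hᵐᵒᵖ N] in
@[simp] lemma leftTwist_mk (a x : H) (n : N) :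
    leftTwist k H N a (FreeBimodule.mk k x n) = FreeBimodule.mk k (a * x) n := rfl

@[simp] lemma diagTwist_tmul_mk (a c x : H) (n : N) :
    diagTwist k H N (a ⊗ₜ c) (FreeBimodule.mk k x n) =
      FreeBimodule.mk k (x * a) (op c • n) := rfl

variable (H N)

lemma diagTwist_mul (s t : H ⊗[k] H) :
    diagTwist k H N (s * t) = diagTwist k H N t * diagTwist k H N s := by
  induction s with
  | zero => simp
  | add s s' hs hs' => simp only [add_mul, map_add, hs, hs', mul_add]
  | tmul x y =>
    induction t with
    | zero => simp
    | add s s' hs hs' => simp only [mul_add, map_add, hs, hs', add_mul]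
    | tmul z w =>
      refine FreeBimodule.hom_ext fun a n => ?_
      simp [mul_assoc, mul_smul]

lemma leftTwist_mul_diagTwist (a : H) (t : H ⊗[k] H) :
    leftTwist k H N a * diagTwist k H N t = diagTwist k H N t * leftTwist k H N a := by
  induction t with
  | zero => simp
  | add s s' hs hs' => simp only [mul_add, map_add, hs, hs', add_mul]
  | tmul z w =>
    refine FreeBimodule.hom_ext fun x n => ?_
    simp [mul_assoc]

/-- The action of the enveloping algebra on `H ⊗ N`. -/
def freeBimoduleAction : E →ₐ[k] Module.End k (FreeBimodule k H N) :=
  Algebra.TensorProduct.lift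
    (AlgHom.ofLinearMap (leftTwist k H N)
      (FreeBimodule.hom_ext fun a n => by simp)
      (fun a b => FreeBimodule.hom_ext fun x n => by simp [mul_assoc]))
    (AlgHom.ofLinearMap (diagTwist k H N ∘ₗ (Δ) ∘ₗ (opLinearEquiv k).symm.toLinearMap)
      (FreeBimodule.hom_ext fun a n => by simp [Algebra.TensorProduct.one_def])
      (fun a b => by simp [Bialgebra.comul_mul, diagTwist_mul]))
    (fun a c => leftTwist_mul_diagTwist k H N a (Δ c.unop))

instance : Module E (FreeBimodule k H N) :=
  Module.compHom (FreeBimodule k H N) (freeBimoduleAction k H N).toRingHom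

variable {H N}

lemma FreeBimodule.smul_def (e : E) (v : FreeBimodule k H N) :
    e • v = freeBimoduleAction k H N e v := rfl

lemma FreeBimodule.tmul_smul (a c : H) (v : FreeBimodule k H N) :
    (a ⊗ₜ[k] op c) • v = leftTwist k H N a (diagTwist k H N (Δ c) v) := by
  rw [smul_def]
  exact LinearMap.congr_fun (Algebra.TensorProduct.lift_tmul (AlgHom.ofLinearMap (leftTwist k H N)
    _ _) (AlgHom.ofLinearMap _ _ _) _ a (op c)) v

/-- Linearity over the enveloping algebra can be checked on generators. -/
lemma FreeBimodule.smul_induction {M : Type*} [AddCommGroup M] [Module k M] [Module E M]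
    [IsScalarTower k E M] (F : FreeBimodule k H N →ₗ[k] M)
    (h : ∀ (a c x : H) (n : N), F (leftTwist k H N a (diagTwist k H N (Δ c) (mk k x n))) =
      (a ⊗ₜ[k] op c) • F (mk k x n))
    (e : E) (v : FreeBimodule k H N) : F (e • v) = e • F v := by
  have key : (LinearMap.applyₗ v ∘ₗ F.compRight k ∘ₗ (freeBimoduleAction k H N).toLinearMap) =
      LinearMap.applyₗ (F v) ∘ₗ (Algebra.lsmul k k M : E →ₐ[k] Module.End k M).toLinearMap := by
    refine TensorProduct.ext' fun a c => ?_
    change F ((a ⊗ₜ[k] op c.unop) • v) = (a ⊗ₜ[k] op c.unop) • F v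
    induction v using FreeBimodule.induction_on with
    | add x y hx hy => rw [smul_add, map_add, hx, hy, map_add, smul_add]
    | mk x n => rw [tmul_smul, h]
  exact LinearMap.congr_fun key e

instance : IsScalarTower k E (FreeBimodule k H N) where
  smul_assoc r e v := by rw [FreeBimodule.smul_def, FreeBimodule.smul_def, map_smul]; rfl

/-- The `k`-linear map underlying `FreeBimodule.map`. -/
def FreeBimodule.mapAux {N' : Type u} [AddCommGroup N'] [Module k N'] (f : N →ₗ[k] N') :
    FreeBimodule k H N →ₗ[k] FreeBimodule k H N' := f.lTensor H

/-- The map of bimodules induced by a map of right modules. -/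
def FreeBimodule.map {N' : Type u} [AddCommGroup N'] [Module k N'] [Module Hᵐᵒᵖ N']
    [IsScalarTower k Hᵐᵒᵖ N'] (f : N →ₗ[Hᵐᵒᵖ] N') :
    FreeBimodule k H N →ₗ[E] FreeBimodule k H N' where
  toFun := mapAux k (f.restrictScalars k)
  map_add' := map_add _
  map_smul' := FreeBimodule.smul_induction k (mapAux k (f.restrictScalars k)) (fun a c x n => by
      refine Eq.trans ?_ (FreeBimodule.tmul_smul k a c (mk k x (f n))).symm
      have key : mapAux k (f.restrictScalars k) ∘ₗ leftTwist k H N a ∘ₗ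
          LinearMap.applyₗ (mk k x n) ∘ₗ diagTwist k H N =
          leftTwist k H N' a ∘ₗ LinearMap.applyₗ (mk k x (f n)) ∘ₗ diagTwist k H N' :=
        TensorProduct.ext' fun z w => congrArg (FreeBimodule.mk k (a * (x * z))) (map_smul f _ _)
      exact LinearMap.congr_fun key (Δ c))

end Free

/-- The functor `N ↦ H ⊗ N` from right modules to bimodules. -/
def freeBimoduleFunctor : ModuleCat.{u} Hᵐᵒᵖ ⥤ ModuleCat.{u} E where
  obj N := ModuleCat.of E (FreeBimodule k H N)
  map f := ModuleCat.ofHom (FreeBimodule.map k f.hom)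
  map_id N := ModuleCat.hom_ext (LinearMap.ext fun x =>
    LinearMap.congr_fun (LinearMap.lTensor_id H N) x)
  map_comp f g := ModuleCat.hom_ext (LinearMap.ext fun x =>
    LinearMap.congr_fun (LinearMap.lTensor_comp H (g.hom.restrictScalars k)
      (f.hom.restrictScalars k)) x)

instance : (freeBimoduleFunctor k H).Additive where
  map_add {_ _ f g} := ModuleCat.hom_ext (LinearMap.ext fun x =>
    LinearMap.congr_fun (LinearMap.lTensor_add H (f.hom.restrictScalars k)
      (g.hom.restrictScalars k)) x)

lemma freeBimoduleFunctor_map_exact (T : ShortComplex (ModuleCat.{u} Hᵐᵒᵖ)) (hT : T.Exact) :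
    (T.map (freeBimoduleFunctor k H)).Exact := by
  rw [ShortComplex.ShortExact.moduleCat_exact_iff_function_exact] at hT ⊢
  have h : Function.Exact (T.f.hom.restrictScalars k) (T.g.hom.restrictScalars k) := hT
  exact Module.Flat.lTensor_exact H h

instance : PreservesFiniteLimits (freeBimoduleFunctor k H) :=
  ((freeBimoduleFunctor k H).exact_tfae.out 1 3 rfl rfl |>.1
    (freeBimoduleFunctor_map_exact k H)).1

instance : PreservesFiniteColimits (freeBimoduleFunctor k H) :=
  ((freeBimoduleFunctor k H).exact_tfae.out 1 3 rfl rfl |>.1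
    (freeBimoduleFunctor_map_exact k H)).2

variable {k H}

/-- The map `x ⊗ m ↦ x m`, as a `k`-linear map. -/
def bimoduleAct (M : ModuleCat.{u} E) : FreeBimodule k H ((adFunctor k H).obj M) →ₗ[k] M :=
  FreeBimodule.lift k (LinearMap.mk₂ k
    (fun x (m : (adFunctor k H).obj M) => (x ⊗ₜ[k] (1 : Hᵐᵒᵖ)) • (show M from m))
    (fun x y m => by rw [TensorProduct.add_tmul, add_smul])
    (fun r x m => by rw [← TensorProduct.smul_tmul', smul_assoc])
    (fun x m m' => smul_add _ _ _)
    (fun r x m => by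
      change (x ⊗ₜ[k] (1 : Hᵐᵒᵖ)) • envMap k H (algebraMap k Hᵐᵒᵖ r) • (show M from m) = _
      rw [AlgHom.commutes, algebraMap_smul, smul_comm]))

/-- The identity `x c₍₁₎ S(c₍₂₎) ⊗ c₍₃₎ = x ⊗ c` behind the linearity of `bimoduleAct`. -/
lemma bimoduleAct_twist (M : ModuleCat.{u} E) (a c x : H) (m : (adFunctor k H).obj M) :
    bimoduleAct M (leftTwist k H _ a (diagTwist k H _ (Δ c) (FreeBimodule.mk k x m))) =
      (a ⊗ₜ[k] op c) • bimoduleAct M (FreeBimodule.mk k x m) := by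
  let act : E →ₗ[k] M :=
    LinearMap.applyₗ (show M from m) ∘ₗ (Algebra.lsmul k k M : E →ₐ[k] Module.End k M).toLinearMap
  let α : (H ⊗[k] H) ⊗[k] H →ₗ[k] E :=
    map (LinearMap.mulLeft k (a * x) ∘ₗ LinearMap.mul' k H ∘ₗ (S).lTensor H)
      (opLinearEquiv k : H ≃ₗ[k] Hᵐᵒᵖ).toLinearMap
  have h1 : bimoduleAct M ∘ₗ leftTwist k H _ a ∘ₗ LinearMap.applyₗ (FreeBimodule.mk k x m) ∘ₗ
      diagTwist k H ((adFunctor k H).obj M) =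
        act ∘ₗ α ∘ₗ (TensorProduct.assoc k H H H).symm.toLinearMap ∘ₗ (Δ).lTensor H := by
    refine TensorProduct.ext' fun z w => ?_
    have h4 : LinearMap.mulLeft k ((a * (x * z)) ⊗ₜ[k] (1 : Hᵐᵒᵖ)) ∘ₗ
        map (S) (opLinearEquiv k).toLinearMap =
        α ∘ₗ (TensorProduct.assoc k H H H).symm.toLinearMap ∘ₗ
          TensorProduct.mk k H (H ⊗[k] H) z := by
      refine TensorProduct.ext' fun y y' => ?_
      simp [α, mul_assoc]
    have h5 := LinearMap.congr_fun h4 (Δ w)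
    change ((a * (x * z)) ⊗ₜ[k] (1 : Hᵐᵒᵖ)) • map (S) (opLinearEquiv k).toLinearMap (Δ w) •
        (show M from m) = _
    rw [← mul_smul]
    exact congrArg (· • (show M from m)) h5
  have h2 : α ∘ₗ (Δ).rTensor H =
      map (LinearMap.mulLeft k (a * x) ∘ₗ Algebra.linearMap k H)
        (opLinearEquiv k : H ≃ₗ[k] Hᵐᵒᵖ).toLinearMap ∘ₗ
        (Coalgebra.counit (R := k) (A := H)).rTensor H := by
    refine TensorProduct.ext' fun b c => ?_
    simp [α, HopfAlgebra.mul_antipode_lTensor_comul_apply]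
  have h3 := LinearMap.congr_fun h1 (Δ c)
  simp only [LinearMap.comp_apply, LinearEquiv.coe_coe, Coalgebra.coassoc_symm_apply] at h3
  refine h3.trans ?_
  have h4 := LinearMap.congr_fun h2 (Δ c)
  simp only [LinearMap.comp_apply, Coalgebra.rTensor_counit_comul] at h4
  rw [h4]
  change (map _ _ ((1 : k) ⊗ₜ[k] c) : E) • (show M from m) =
    (a ⊗ₜ[k] op c) • (x ⊗ₜ[k] (1 : Hᵐᵒᵖ)) • (show M from m)
  rw [← mul_smul]
  simp

/-- The identity `S(c₍₁₎) c₍₂₎ ⊗ n · c₍₃₎ = 1 ⊗ n · c`. -/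
lemma envMap_smul_mk_one {N : Type u} [AddCommGroup N] [Module k N] [Module Hᵐᵒᵖ N]
    [IsScalarTower k Hᵐᵒᵖ N] (c : H) (n : N) :
    envMap k H (op c) • FreeBimodule.mk k (1 : H) n = FreeBimodule.mk k 1 (op c • n) := by
  let α : (H ⊗[k] H) ⊗[k] H →ₗ[k] FreeBimodule k H N :=
    map (LinearMap.mul' k H ∘ₗ (S).rTensor H) ((rightAct k H N).flip n)
  have h1 : LinearMap.applyₗ (FreeBimodule.mk k (1 : H) n) ∘ₗ
      (freeBimoduleAction k H N).toLinearMap ∘ₗ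
        map (S) (opLinearEquiv k : H ≃ₗ[k] Hᵐᵒᵖ).toLinearMap =
      α ∘ₗ (TensorProduct.assoc k H H H).symm.toLinearMap ∘ₗ (Δ).lTensor H := by
    refine TensorProduct.ext' fun z w => ?_
    have h4 : leftTwist k H N (S z) ∘ₗ LinearMap.applyₗ (FreeBimodule.mk k (1 : H) n) ∘ₗ
        diagTwist k H N =
        α ∘ₗ (TensorProduct.assoc k H H H).symm.toLinearMap ∘ₗ
          TensorProduct.mk k H (H ⊗[k] H) z := by
      refine TensorProduct.ext' fun y y' => ?_
      change FreeBimodule.mk k (S z * (1 * y)) (op y' • n) =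
        FreeBimodule.mk k (S z * y) (op y' • n)
      rw [one_mul]
    exact (FreeBimodule.tmul_smul k (S z) w (FreeBimodule.mk k 1 n)).trans
      (LinearMap.congr_fun h4 (Δ w))
  have h2 : α ∘ₗ (Δ).rTensor H =
      map (Algebra.linearMap k H) ((rightAct k H N).flip n) ∘ₗ
        (Coalgebra.counit (R := k) (A := H)).rTensor H := by
    refine TensorProduct.ext' fun b c => ?_
    exact congrArg (fun t => FreeBimodule.mk k t (op c • n))
      (HopfAlgebra.mul_antipode_rTensor_comul_apply b)
  have h3 := LinearMap.congr_fun h1 (Δ c)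
  simp only [LinearMap.comp_apply, LinearEquiv.coe_coe, Coalgebra.coassoc_symm_apply] at h3
  refine h3.trans ?_
  refine (LinearMap.congr_fun h2 (Δ c)).trans ?_
  refine (congrArg (map (Algebra.linearMap k H) ((rightAct k H N).flip n))
    (Coalgebra.rTensor_counit_comul c)).trans ?_
  change FreeBimodule.mk k (algebraMap k H 1) (op c • n) = _
  rw [map_one]

/-- The counit `x ⊗ m ↦ x m`. -/
def freeBimoduleCounit (M : ModuleCat.{u} E) :
    (freeBimoduleFunctor k H).obj ((adFunctor k H).obj M) ⟶ M :=
  ModuleCat.ofHom (X := FreeBimodule k H ((adFunctor k H).obj M))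
    { toFun := bimoduleAct M
      map_add' := map_add _
      map_smul' := FreeBimodule.smul_induction k (bimoduleAct M) (bimoduleAct_twist M) }

/-- The unit `n ↦ 1 ⊗ n`. -/
def freeBimoduleUnit (N : ModuleCat.{u} Hᵐᵒᵖ) :
    N ⟶ (adFunctor k H).obj ((freeBimoduleFunctor k H).obj N) :=
  ModuleCat.ofHom (Y := (adFunctor k H).obj ((freeBimoduleFunctor k H).obj N))
    { toFun n := FreeBimodule.mk k 1 n
      map_add' := map_add _
      map_smul' c n := (envMap_smul_mk_one c.unop n).symm }

/-- The functor `N ↦ H ⊗ N` is left adjoint to `adFunctor`. -/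
def freeBimoduleAdjunction : freeBimoduleFunctor k H ⊣ adFunctor k H :=
  Adjunction.mkOfUnitCounit
    { unit := { app := freeBimoduleUnit, naturality _ _ _ := rfl }
      counit :=
        { app := freeBimoduleCounit
          naturality M M' f := ModuleCat.hom_ext (LinearMap.ext fun v => by
            induction v using FreeBimodule.induction_on with
            | add x y hx hy =>
              exact (map_add _ x y).trans ((congrArg₂ _ hx hy).trans (map_add _ x y).symm)
            | mk x n => exact (map_smul f.hom (x ⊗ₜ[k] (1 : Hᵐᵒᵖ)) _).symm) }
      left_triangle := by
        ext N : 2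
        refine ModuleCat.hom_ext (LinearMap.ext fun v => ?_)
        induction v using FreeBimodule.induction_on with
        | add x y hx hy =>
          exact (map_add _ x y).trans ((congrArg₂ _ hx hy).trans (map_add _ x y).symm)
        | mk x n =>
          refine (FreeBimodule.tmul_smul k x 1 (FreeBimodule.mk k 1 n)).trans ?_
          rw [Bialgebra.comul_one, Algebra.TensorProduct.one_def, diagTwist_tmul_mk, leftTwist_mk,
            mul_one, mul_one, op_one, one_smul]
          rfl
      right_triangle := by
        ext M : 2
        exact ModuleCat.hom_ext (LinearMap.ext fun m => one_smul E (show M from m)) }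

variable (k H)

/-- The trivial right `H`-module. -/
def trivialModule : ModuleCat.{u} Hᵐᵒᵖ := ModuleCat.of Hᵐᵒᵖ (YDModule.trivial k H).carrier

instance : PreservesFiniteColimits (adFunctor k H) := by
  have := (ModuleCat.restrictCoextendScalarsAdj.{u}
    (envMap k H).toRingHom).leftAdjoint_preservesColimits
  exact PreservesColimits.preservesFiniteColimits _

instance : PreservesFiniteLimits (adFunctor k H) := by
  have := (freeBimoduleAdjunction (k := k) (H := H)).rightAdjoint_preservesLimits
  exact PreservesLimits.preservesFiniteLimits _

/-- The trivial module is `k`, also for the `k`-module structure obtained from its structure of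
`H`-module. -/
def trivialModuleEquiv : trivialModule k H ≃ₗ[k] k where
  toFun x := x
  invFun x := x
  left_inv _ := rfl
  right_inv _ := rfl
  map_add' _ _ := rfl
  map_smul' r x := by
    change Coalgebra.counit (R := k) (algebraMap k H r) * (show k from x) = r * (show k from x)
    rw [Bialgebra.counit_algebraMap]

/-- The isomorphism of `H ⊗ k` with `H`, as a `k`-linear map. -/
def freeBimoduleTrivialEquiv : FreeBimodule k H (trivialModule k H) ≃ₗ[k] H :=
  (trivialModuleEquiv k H).lTensor H ≪≫ₗ TensorProduct.rid k H

lemma freeBimoduleTrivialEquiv_twist (a c x : H) (r : k) :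
    freeBimoduleTrivialEquiv k H (leftTwist k H _ a (diagTwist k H _ (Δ c)
      (FreeBimodule.mk k x (show trivialModule k H from r)))) =
        a * (r • x * c) := by
  have key : (freeBimoduleTrivialEquiv k H).toLinearMap ∘ₗ leftTwist k H _ a ∘ₗ
      LinearMap.applyₗ (FreeBimodule.mk k x (show trivialModule k H from r)) ∘ₗ
        diagTwist k H _ =
      LinearMap.mulLeft k (a * r • x) ∘ₗ (TensorProduct.rid k H).toLinearMap ∘ₗ
        (Coalgebra.counit (R := k) (A := H)).lTensor H := by
    refine TensorProduct.ext' fun z w => ?_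
    change (Coalgebra.counit (R := k) w * r) • (a * (x * z)) =
      a * r • x * (Coalgebra.counit (R := k) w • z)
    simp [mul_smul, mul_assoc]
  refine (LinearMap.congr_fun key (Δ c)).trans ?_
  rw [LinearMap.comp_apply, LinearMap.comp_apply, Coalgebra.lTensor_counit_comul]
  simp [mul_assoc]

/-- The isomorphism of bimodules of `H ⊗ k` with `H`. -/
def freeBimoduleTrivialIso :
    letI : Module E H := instModuleTensorProductMop k H
    (freeBimoduleFunctor k H).obj (trivialModule k H) ≅ ModuleCat.of E H :=
  letI : Module E H := instModuleTensorProductMop k H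
  haveI : IsScalarTower k E H :=
    ⟨fun r e x => LinearMap.congr_fun (map_smul TensorProduct.Algebra.moduleAux r e) x⟩
  let e : FreeBimodule k H (trivialModule k H) ≃ₗ[E] H :=
    { (freeBimoduleTrivialEquiv k H).toAddEquiv with
      map_smul' := FreeBimodule.smul_induction k (freeBimoduleTrivialEquiv k H).toLinearMap
        fun a c x r => freeBimoduleTrivialEquiv_twist k H a c x r }
  e.toModuleIso

/-- The Hochschild cohomological dimension of a Hopf algebra is the projective dimension of its
trivial module. -/
lemma cd_eq_extDim_trivial : cd k H = extDim (trivialModule k H) := by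
  rw [← extDim_obj_eq (freeBimoduleAdjunction (k := k) (H := H))]
  exact (extDim_eq_of_iso (freeBimoduleTrivialIso k H)).symm

end Hochschild

section HochschildComparison

open MulOpposite

variable {k : Type u} [Field k] {A B : Type u} [Ring A] [HopfAlgebra k A] [Ring B]
  [HopfAlgebra k B]

/-- The trivial module restricts to the trivial module. -/
def restrictTrivialIso (i : B →ₐc[k] A) :
    (resFunctor i).obj (trivialModule k A) ≅ trivialModule k B :=
  let e : (resFunctor i).obj (trivialModule k A) ≃ₗ[Bᵐᵒᵖ] trivialModule k B :=
    { toFun x := x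
      invFun x := x
      left_inv _ := rfl
      right_inv _ := rfl
      map_add' _ _ := rfl
      map_smul' b x := congrArg (· * (show k from x))
        (CoalgHomClass.counit_comp_apply i b.unop) }
  e.toModuleIso

/-- The Hochschild cohomological dimensions agree. -/
lemma IsDegreeOne.cd_eq {i : B →ₐc[k] A} {Γ : Type v} [Group Γ] [Fintype Γ] [DecidableEq Γ]
    {G : CocentralGrading k A Γ} (hi : IsDegreeOne i G) (hΓ : (Fintype.card Γ : k) ≠ 0) :
    cd k A = cd k B := by
  rw [cd_eq_extDim_trivial, cd_eq_extDim_trivial, ← hi.extDim_restrict hΓ (trivialModule k A),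
    extDim_eq_of_iso (restrictTrivialIso i)]

end HochschildComparison

/-! ### The adjoint action on tensor products -/

section Twist

open MulOpposite TensorProduct

variable {k : Type u} [Field k] {A B : Type u} [Ring A] [HopfAlgebra k A] [Ring B]
  [HopfAlgebra k B]

section Basic

variable {V : Type u} [AddCommGroup V] [Module k V] [Module Aᵐᵒᵖ V] [IsScalarTower k Aᵐᵒᵖ V]

lemma ydTwist_mul (s t : A ⊗[k] (A ⊗[k] A)) :
    ydTwist k A V (s * t) = ydTwist k A V t ∘ₗ ydTwist k A V s := by
  have key : (LinearMap.compr₂ (LinearMap.mul k (A ⊗[k] (A ⊗[k] A))) (ydTwist k A V)) =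
      ((LinearMap.mul k (Module.End k (V ⊗[k] A))).compl₁₂ (ydTwist k A V)
        (ydTwist k A V)).flip := by
    refine TensorProduct.ext_threefold' fun a b c => ?_
    refine TensorProduct.ext_threefold' fun a' b' c' => ?_
    refine TensorProduct.ext' fun v x => ?_
    simp [HopfAlgebra.antipode_mul_antidistrib, mul_smul, mul_assoc]
  exact LinearMap.congr_fun₂ key s t

lemma comul₂_mul (a b : A) : comul₂ k A (a * b) = comul₂ k A a * comul₂ k A b := by
  exact map_mul ((Algebra.TensorProduct.map (AlgHom.id k A) (Bialgebra.comulAlgHom k A)).comp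
    (Bialgebra.comulAlgHom k A)) a b

lemma ydTwist_comul₂_mul (a b : A) (s : V ⊗[k] A) :
    ydTwist k A V (comul₂ k A (a * b)) s =
      ydTwist k A V (comul₂ k A b) (ydTwist k A V (comul₂ k A a) s) := by
  rw [comul₂_mul, ydTwist_mul, LinearMap.comp_apply]

lemma ydTwist_comul₂_one (s : V ⊗[k] A) : ydTwist k A V (comul₂ k A 1) s = s := by
  induction s with
  | zero => simp
  | add s t hs ht => rw [map_add, hs, ht]
  | tmul v x => simp [comul₂_apply, Algebra.TensorProduct.one_def]

lemma counit_comul₂ (a : A) :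
    TensorProduct.lid k A (map (Coalgebra.counit (R := k) (A := A))
      ((TensorProduct.rid k A).toLinearMap ∘ₗ (Coalgebra.counit (R := k) (A := A)).lTensor A)
        (comul₂ k A a)) = a := by
  have h : (TensorProduct.rid k A).toLinearMap ∘ₗ (Coalgebra.counit (R := k) (A := A)).lTensor A ∘ₗ
      Coalgebra.comul = LinearMap.id := by
    ext; simp
  rw [comul₂_apply, ← LinearMap.comp_apply (map _ _), LinearMap.map_comp_lTensor,
    LinearMap.comp_assoc, h]
  exact (congrArg (TensorProduct.lid k A) (Coalgebra.rTensor_counit_comul a)).trans (by simp)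

/-- Coassociativity for the comultiplication with five factors. -/
lemma comul₂_comul₂ : map LinearMap.id (map (comul₂ k A) LinearMap.id) ∘ₗ comul₂ k A =
    ((TensorProduct.assoc k A (A ⊗[k] A) A).symm.toLinearMap ∘ₗ
      (TensorProduct.assoc k A A A).symm.toLinearMap.lTensor A).lTensor A ∘ₗ
        (TensorProduct.assoc k A A (A ⊗[k] (A ⊗[k] A))).toLinearMap ∘ₗ
        map Coalgebra.comul (map LinearMap.id Coalgebra.comul) ∘ₗ comul₂ k A := by
  simp only [comul₂, coassoc_simps]

end Basic

/-- `i ⊗ i ⊗ i` applied to the iterated comultiplication. -/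
lemma comul₂_map (i : B →ₐc[k] A) (b : B) :
    comul₂ k A (i b) = map (i : B →ₗ[k] A) (map (i : B →ₗ[k] A) (i : B →ₗ[k] A))
      (comul₂ k B b) := by
  have h1 : Coalgebra.comul (R := k) (i b) = map (i : B →ₗ[k] A) (i : B →ₗ[k] A)
    (Coalgebra.comul b) := (CoalgHomClass.map_comp_comul_apply i b).symm
  have h2 : Coalgebra.comul (R := k) ∘ₗ (i : B →ₗ[k] A) =
      map (i : B →ₗ[k] A) (i : B →ₗ[k] A) ∘ₗ Coalgebra.comul (R := k) (A := B) :=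
    (CoalgHomClass.map_comp_comul i).symm
  rw [comul₂_apply, comul₂_apply, h1, ← LinearMap.comp_apply, ← LinearMap.comp_apply,
    LinearMap.lTensor_comp_map, h2, ← LinearMap.map_comp_lTensor]
  rfl

lemma map_ydTwist (i : B →ₐc[k] A) {V W : Type u} [AddCommGroup V] [Module k V] [Module Bᵐᵒᵖ V]
    [IsScalarTower k Bᵐᵒᵖ V] [AddCommGroup W] [Module k W] [Module Aᵐᵒᵖ W]
    [IsScalarTower k Aᵐᵒᵖ W] (f : V →ₗ[k] W) (hf : ∀ b v, f (op b • v) = op (i b) • f v)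
    (b : B) (s : V ⊗[k] B) :
    map f (i : B →ₗ[k] A) (ydTwist k B V (comul₂ k B b) s) =
      ydTwist k A W (comul₂ k A (i b)) (map f (i : B →ₗ[k] A) s) := by
  rw [comul₂_map]
  have key : (LinearMap.llcomp k _ _ _ (map f (i : B →ₗ[k] A))) ∘ₗ ydTwist k B V =
      (LinearMap.lcomp k _ (map f (i : B →ₗ[k] A))) ∘ₗ ydTwist k A W ∘ₗ
        map (i : B →ₗ[k] A) (map (i : B →ₗ[k] A) (i : B →ₗ[k] A)) := by
    refine TensorProduct.ext_threefold' fun a b c => ?_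
    refine TensorProduct.ext' fun v x => ?_
    simp [hf, map_antipode]
  exact LinearMap.congr_fun₂ key _ s

end Twist

section CoTwist

open MulOpposite TensorProduct

variable {k : Type u} [Field k] {A : Type u} [Ring A] [HopfAlgebra k A]
  {V : Type u} [AddCommGroup V] [Module k V]

/-- The linear map `a ⊗ (r ⊗ c) ↦ (v ⊗ x ↦ ρ(r) v ⊗ S(a) x c)`. For `ρ` the action of `A` on a
right `A`-module it is `ydTwist`. -/
def coTwist {R : Type u} [AddCommGroup R] [Module k R] (ρ : R →ₗ[k] Module.End k V) :
    A ⊗[k] (R ⊗[k] A) →ₗ[k] Module.End k (V ⊗[k] A) :=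
  TensorProduct.homTensorHomMap (RingHom.id k) V A V A ∘ₗ
    TensorProduct.map ρ (antipodeMul k A) ∘ₗ (TensorProduct.leftComm k A R A).toLinearMap

lemma coTwist_tmul {R : Type u} [AddCommGroup R] [Module k R] (ρ : R →ₗ[k] Module.End k V)
    (a c x : A) (r : R) (v : V) : coTwist ρ (a ⊗ₜ (r ⊗ₜ c)) (v ⊗ₜ x) =
      ρ r v ⊗ₜ (HopfAlgebra.antipode k a * x * c) := by
  simp [coTwist, antipodeMul]

lemma coTwist_comp {R R' : Type u} [AddCommGroup R] [Module k R] [AddCommGroup R'] [Module k R']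
    (ρ : R →ₗ[k] Module.End k V) (f : R' →ₗ[k] R) (t : A ⊗[k] (R' ⊗[k] A)) :
    coTwist (ρ ∘ₗ f) t = coTwist ρ (map LinearMap.id (map f LinearMap.id) t) := by
  have : coTwist (ρ ∘ₗ f) =
      coTwist (A := A) ρ ∘ₗ map LinearMap.id (map f LinearMap.id) := by
    refine TensorProduct.ext_threefold' fun a r c => ?_
    refine TensorProduct.ext' fun v x => ?_
    simp [coTwist_tmul]
  exact LinearMap.congr_fun this t

lemma rTensor_coTwist {R : Type u} [AddCommGroup R] [Module k R] {W : Type u} [AddCommGroup W]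
    [Module k W] (ρ : R →ₗ[k] Module.End k V) (σ : R →ₗ[k] Module.End k W) (f : V →ₗ[k] W)
    (h : ∀ r v, f (ρ r v) = σ r (f v)) (t : A ⊗[k] (R ⊗[k] A)) (s : V ⊗[k] A) :
    f.rTensor A (coTwist ρ t s) = coTwist σ t (f.rTensor A s) := by
  have : (LinearMap.llcomp k _ _ _ (f.rTensor A)) ∘ₗ coTwist ρ =
      (LinearMap.lcomp k _ (f.rTensor A)) ∘ₗ coTwist (A := A) σ := by
    refine TensorProduct.ext_threefold' fun a r c => ?_
    refine TensorProduct.ext' fun v x => ?_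
    simp [coTwist_tmul, h]
  exact LinearMap.congr_fun₂ this t s

variable [Module Aᵐᵒᵖ V] [IsScalarTower k Aᵐᵒᵖ V]

lemma coTwist_rightAct : coTwist (rightAct k A V) = ydTwist k A V := rfl

variable (k A V) in
/-- The action `a ↦ (v ⊗ x ↦ v · a₍₂₎ ⊗ S(a₍₁₎) x a₍₃₎)` of `A` on `V ⊗ A`. -/
def coadAct : A →ₗ[k] Module.End k (V ⊗[k] A) := ydTwist k A V ∘ₗ comul₂ k A

/-- The map `id ⊗ Δ` is compatible with the actions of `A` on `V ⊗ A` and on `(V ⊗ A) ⊗ A`. This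
is what makes `V ⊗ A` a Yetter-Drinfeld module. -/
lemma lTensor_comul_ydTwist (a : A) (s : V ⊗[k] A) :
    (TensorProduct.assoc k V A A).symm ((Coalgebra.comul (R := k)).lTensor V
      (ydTwist k A V (comul₂ k A a) s)) =
    coTwist (coadAct k A V) (comul₂ k A a)
      ((TensorProduct.assoc k V A A).symm ((Coalgebra.comul (R := k)).lTensor V s)) := by
  induction s with
  | zero => simp
  | add s t hs ht => simp only [map_add, hs, ht]
  | tmul v x =>
    rw [coadAct, coTwist_comp]
    have e := LinearMap.congr_fun (comul₂_comul₂ (k := k) (A := A)) a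
    simp only [LinearMap.comp_apply] at e
    rw [e]
    -- Both sides are linear in `Δ x` and in the fivefold comultiplication of `a`.
    have key : ∀ w : A ⊗[k] A, ∀ p q b c d : A,
        (TensorProduct.assoc k V A A).symm ((op b • v) ⊗ₜ
          (map (HopfAlgebra.antipode k) (HopfAlgebra.antipode k)
            (TensorProduct.comm k A A (p ⊗ₜ q)) * w * (c ⊗ₜ d))) =
        coTwist (ydTwist k A V) (p ⊗ₜ ((q ⊗ₜ (b ⊗ₜ c)) ⊗ₜ d))
          ((TensorProduct.assoc k V A A).symm (v ⊗ₜ w)) := by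
      intro w p q b c d
      induction w with
      | zero => simp
      | add s t hs ht => simp only [mul_add, add_mul, TensorProduct.tmul_add, map_add, hs, ht]
      | tmul y z => simp [coTwist_tmul]
    let P : A ⊗[k] A →ₗ[k] A ⊗[k] A →ₗ[k] A ⊗[k] A :=
      (LinearMap.mul k (A ⊗[k] A)).comp (LinearMap.mulRight k (Coalgebra.comul (R := k) x) ∘ₗ
        map (HopfAlgebra.antipode k) (HopfAlgebra.antipode k) ∘ₗ
          (TensorProduct.comm k A A).toLinearMap)
    let L : (A ⊗[k] A) ⊗[k] (A ⊗[k] (A ⊗[k] A)) →ₗ[k] (V ⊗[k] A) ⊗[k] A :=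
      (TensorProduct.assoc k V A A).symm.toLinearMap ∘ₗ
        map ((rightAct k A V).flip v) (TensorProduct.lift P) ∘ₗ
          (TensorProduct.leftComm k (A ⊗[k] A) A (A ⊗[k] A)).toLinearMap
    have h1 : (TensorProduct.assoc k V A A).symm.toLinearMap ∘ₗ
        (Coalgebra.comul (R := k)).lTensor V ∘ₗ LinearMap.applyₗ (v ⊗ₜ x) ∘ₗ ydTwist k A V =
        L ∘ₗ map Coalgebra.comul (map LinearMap.id Coalgebra.comul) := by
      refine TensorProduct.ext_threefold' fun a b c => ?_
      simp [L, P, comul_antipode, rightAct]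
    have h2 : L = LinearMap.applyₗ ((TensorProduct.assoc k V A A).symm
        (v ⊗ₜ Coalgebra.comul (R := k) x)) ∘ₗ coTwist (ydTwist k A V) ∘ₗ
        ((TensorProduct.assoc k A (A ⊗[k] A) A).symm.toLinearMap ∘ₗ
          (TensorProduct.assoc k A A A).symm.toLinearMap.lTensor A).lTensor A ∘ₗ
        (TensorProduct.assoc k A A (A ⊗[k] (A ⊗[k] A))).toLinearMap := by
      refine TensorProduct.ext (TensorProduct.ext' fun p q =>
        TensorProduct.ext_threefold' fun b c d => ?_)
      simpa [L, P, rightAct] using key (Coalgebra.comul (R := k) x) p q b c d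
    have h3 := LinearMap.congr_fun h1 (comul₂ k A a)
    rw [h2] at h3
    simpa using h3

end CoTwist

/-! ### Induced Yetter-Drinfeld modules -/

section InducedYD

open MulOpposite TensorProduct

variable {k : Type u} [Field k] {A B : Type u} [Ring A] [HopfAlgebra k A] [Ring B]
  [HopfAlgebra k B]

lemma counit_ydTwist {V : Type u} [AddCommGroup V] [Module k V] [Module Aᵐᵒᵖ V]
    [IsScalarTower k Aᵐᵒᵖ V] (a : A) (s : V ⊗[k] A) :
    TensorProduct.rid k V ((Coalgebra.counit (R := k)).lTensor V
      (ydTwist k A V (comul₂ k A a) s)) =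
    op a • TensorProduct.rid k V ((Coalgebra.counit (R := k)).lTensor V s) := by
  have key : LinearMap.llcomp k _ _ _ ((TensorProduct.rid k V).toLinearMap ∘ₗ
      (Coalgebra.counit (R := k)).lTensor V) ∘ₗ ydTwist k A V =
      LinearMap.lcomp k _ ((TensorProduct.rid k V).toLinearMap ∘ₗ
        (Coalgebra.counit (R := k)).lTensor V) ∘ₗ rightAct k A V ∘ₗ
        (TensorProduct.lid k A).toLinearMap ∘ₗ map (Coalgebra.counit (R := k) (A := A))
      ((TensorProduct.rid k A).toLinearMap ∘ₗ (Coalgebra.counit (R := k) (A := A)).lTensor A) := by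
    refine TensorProduct.ext_threefold' fun a b c => ?_
    refine TensorProduct.ext' fun v x => ?_
    simp [rightAct, smul_smul, mul_comm, mul_left_comm]
  have := LinearMap.congr_fun₂ key (comul₂ k A a) s
  simp only [LinearMap.comp_apply, LinearEquiv.coe_coe, counit_comul₂] at this
  simpa [rightAct] using this

variable (i : B →ₐc[k] A) (W : YDModule k B)

/-- The `B`-balanced map defining the coaction of the induced module. -/
def indCoactAux : A →ₗ[k] W.carrier →ₗ[k] Ind i W.carrier ⊗[k] A :=
  (LinearMap.lcomp k (Ind i W.carrier ⊗[k] A) (map (Ind.of i) (i : B →ₗ[k] A) ∘ₗ W.coact)) ∘ₗ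
    coadAct k A (Ind i W.carrier)

lemma indCoactAux_apply (a : A) (w : W.carrier) : indCoactAux i W a w =
    ydTwist k A _ (comul₂ k A a) (map (Ind.of i) (i : B →ₗ[k] A) (W.coact w)) := rfl

lemma indCoactAux_balanced (a : A) (b : B) (w : W.carrier) :
    indCoactAux i W (i b * a) w = indCoactAux i W a (op b • w) := by
  rw [indCoactAux_apply, indCoactAux_apply, ydTwist_comul₂_mul, W.yd,
    map_ydTwist i _ Ind.of_smul]

/-- The coaction `w ⊗ a ↦ (w₍₀₎ ⊗ a₍₂₎) ⊗ S(a₍₁₎) w₍₁₎ a₍₃₎` of the induced module. -/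
def indCoact : Ind i W.carrier →ₗ[k] Ind i W.carrier ⊗[k] A :=
  Ind.desc (indCoactAux i W) (indCoactAux_balanced i W)

lemma indCoact_smul_of (a : A) (w : W.carrier) : indCoact i W (op a • Ind.of i w) =
    ydTwist k A _ (comul₂ k A a) (map (Ind.of i) (i : B →ₗ[k] A) (W.coact w)) :=
  Ind.desc_smul_of _ _ _ _

lemma indCoact_of (w : W.carrier) : indCoact i W (Ind.of i w) =
    map (Ind.of i) (i : B →ₗ[k] A) (W.coact w) := by
  have := indCoact_smul_of i W 1 w
  rwa [op_one, one_smul, ydTwist_comul₂_one] at this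

lemma indCoact_smul (a : A) (v : Ind i W.carrier) : indCoact i W (op a • v) =
    ydTwist k A _ (comul₂ k A a) (indCoact i W v) := by
  induction v using Ind.induction_on with
  | add x y hx hy => rw [smul_add, map_add, hx, hy, map_add, map_add]
  | smul_of a' w =>
    rw [← mul_smul, ← op_mul, indCoact_smul_of, indCoact_smul_of, ydTwist_comul₂_mul]

lemma indCoact_coassoc_of (w : W.carrier) :
    (indCoact i W).rTensor A (indCoact i W (Ind.of i w)) =
      (TensorProduct.assoc k _ A A).symm ((Coalgebra.comul (R := k)).lTensor _
        (indCoact i W (Ind.of i w))) := by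
  have h1 : (indCoact i W).rTensor A ∘ₗ map (Ind.of i) (i : B →ₗ[k] A) =
      map (map (Ind.of i) (i : B →ₗ[k] A)) (i : B →ₗ[k] A) ∘ₗ W.coact.rTensor B := by
    refine TensorProduct.ext' fun x b => ?_
    simp [indCoact_of]
  have h2 : (TensorProduct.assoc k _ A A).symm.toLinearMap ∘ₗ
      (Coalgebra.comul (R := k)).lTensor _ ∘ₗ map (Ind.of i) (i : B →ₗ[k] A) =
      map (map (Ind.of i) (i : B →ₗ[k] A)) (i : B →ₗ[k] A) ∘ₗ
        (TensorProduct.assoc k W.carrier B B).symm.toLinearMap ∘ₗ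
          (Coalgebra.comul (R := k)).lTensor _ := by
    refine TensorProduct.ext' fun x b => ?_
    have h3 : Coalgebra.comul (R := k) (i b) = map (i : B →ₗ[k] A) (i : B →ₗ[k] A)
      (Coalgebra.comul b) := (CoalgHomClass.map_comp_comul_apply i b).symm
    have h4 : ∀ t : B ⊗[k] B, (TensorProduct.assoc k _ A A).symm
        (Ind.of i x ⊗ₜ map (i : B →ₗ[k] A) (i : B →ₗ[k] A) t) =
        map (map (Ind.of i) (i : B →ₗ[k] A)) (i : B →ₗ[k] A)
          ((TensorProduct.assoc k W.carrier B B).symm (x ⊗ₜ t)) := by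
      intro t
      induction t with
      | zero => simp
      | add s t hs ht => simp only [TensorProduct.tmul_add, map_add, hs, ht]
      | tmul y z => simp
    change (TensorProduct.assoc k _ A A).symm (Ind.of i x ⊗ₜ Coalgebra.comul (R := k) (i b)) = _
    rw [h3]
    exact h4 _
  have h5 : W.coact.rTensor B (W.coact w) = (TensorProduct.assoc k W.carrier B B).symm
      ((Coalgebra.comul (R := k)).lTensor _ (W.coact w)) := by
    rw [LinearEquiv.eq_symm_apply]
    exact LinearMap.congr_fun W.comodule.coassoc w
  have h1' := LinearMap.congr_fun h1 (W.coact w)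
  have h2' := LinearMap.congr_fun h2 (W.coact w)
  simp only [LinearMap.comp_apply, LinearEquiv.coe_coe] at h1' h2'
  rw [indCoact_of, h1', h2', h5]

lemma indCoact_coassoc (v : Ind i W.carrier) :
    (indCoact i W).rTensor A (indCoact i W v) =
      (TensorProduct.assoc k _ A A).symm ((Coalgebra.comul (R := k)).lTensor _
        (indCoact i W v)) := by
  induction v using Ind.induction_on with
  | add x y hx hy => simp only [map_add, hx, hy]
  | smul_of a w =>
    rw [indCoact_smul, lTensor_comul_ydTwist, ← indCoact_coassoc_of, ← coTwist_rightAct]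
    exact rTensor_coTwist (rightAct k A _) (coadAct k A _) (indCoact i W)
      (fun a v => indCoact_smul i W a v) _ _

lemma indCoact_counit (v : Ind i W.carrier) :
    TensorProduct.rid k _ ((Coalgebra.counit (R := k)).lTensor _ (indCoact i W v)) = v := by
  induction v using Ind.induction_on with
  | add x y hx hy => simp only [map_add, hx, hy]
  | smul_of a w =>
    rw [indCoact_smul, counit_ydTwist, indCoact_of]
    have h1 : (TensorProduct.rid k _).toLinearMap ∘ₗ (Coalgebra.counit (R := k)).lTensor _ ∘ₗ
        map (Ind.of i) (i : B →ₗ[k] A) = Ind.of i ∘ₗ (TensorProduct.rid k W.carrier).toLinearMap ∘ₗ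
          (Coalgebra.counit (R := k)).lTensor _ := by
      refine TensorProduct.ext' fun x b => ?_
      simp
    have h2 := LinearMap.congr_fun h1 (W.coact w)
    have h3 := LinearMap.congr_fun W.comodule.counit_coact w
    simp only [LinearMap.comp_apply, LinearEquiv.coe_coe, LinearMap.id_apply] at h2 h3
    rw [h2, h3]

instance : RightComodule k A (Ind i W.carrier) where
  coact := indCoact i W
  coassoc := LinearMap.ext fun v => by
    have := indCoact_coassoc i W v
    rw [LinearEquiv.eq_symm_apply] at this
    exact this
  counit_coact := LinearMap.ext (indCoact_counit i W)

/-- The Yetter-Drinfeld module over `A` induced from a Yetter-Drinfeld module over `B`. -/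
def indYD : YDModule k A where
  carrier := Ind i W.carrier
  yd v a := indCoact_smul i W a v

variable {i W}

/-- Colinearity of a map out of an induced module can be checked on the generators. -/
lemma indCoact_colinear {V : YDModule k A} (f : Ind i W.carrier →ₗ[Aᵐᵒᵖ] V.carrier)
    (h : ∀ w, V.coact (f (Ind.of i w)) =
      map (f.restrictScalars k ∘ₗ Ind.of i) (i : B →ₗ[k] A) (W.coact w)) :
    (f.restrictScalars k).rTensor A ∘ₗ indCoact i W = V.coact ∘ₗ f.restrictScalars k := by
  refine LinearMap.ext fun v => ?_
  induction v using Ind.induction_on with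
  | add x y hx hy => rw [map_add, map_add, hx, hy]
  | smul_of a w =>
    rw [LinearMap.comp_apply, LinearMap.comp_apply, indCoact_smul_of,
      YDModule.rTensor_ydTwist, LinearMap.restrictScalars_apply, map_smul, V.yd, h,
      ← LinearMap.comp_apply (LinearMap.rTensor _ _), LinearMap.rTensor_comp_map]

/-- The morphism out of an induced Yetter-Drinfeld module defined by an `A`-linear map. -/
def indYDHom {V : YDModule k A} (f : Ind i W.carrier →ₗ[Aᵐᵒᵖ] V.carrier)
    (h : ∀ w, V.coact (f (Ind.of i w)) =
      map (f.restrictScalars k ∘ₗ Ind.of i) (i : B →ₗ[k] A) (W.coact w)) : indYD i W ⟶ V :=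
  (⟨f, indCoact_colinear f h⟩ : YDModule.Hom (indYD i W) V)

lemma indYD_hom_ext {V : YDModule k A} {f g : indYD i W ⟶ V}
    (h : ∀ w, YDModule.mapOf f (Ind.of i w) = YDModule.mapOf g (Ind.of i w)) : f = g :=
  YDModule.hom_ext (LinearMap.congr_fun (Ind.hom_ext h))

end InducedYD

/-! ### The degree one part of a Yetter-Drinfeld module -/

section ComoduleOfInjective

open TensorProduct

variable {k : Type u} [Field k] {A B : Type u} [Ring A] [HopfAlgebra k A] [Ring B]
  [HopfAlgebra k B] {i : B →ₐc[k] A}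

lemma map_injective (hi : Function.Injective i) {V W : Type u} [AddCommGroup V] [Module k V]
    [AddCommGroup W] [Module k W] {f : V →ₗ[k] W} (hf : Function.Injective f) :
    Function.Injective (map f (i : B →ₗ[k] A)) :=
  TensorProduct.map_injective_of_flat_flat _ _ hf hi

/-- The `B`-comodule structure on `V` for which `f ⊗ i` carries the coaction to the one of an
`A`-comodule `W`, where `i : B → A` and `f : V → W` are injective. -/
abbrev comoduleOfInjective (hi : Function.Injective i) {V W : Type u} [AddCommGroup V] [Module k V]
    [AddCommGroup W] [Module k W] [RightComodule k A W] {f : V →ₗ[k] W}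
    (hf : Function.Injective f) (c : V →ₗ[k] V ⊗[k] B)
    (hc : ∀ v, map f (i : B →ₗ[k] A) (c v) = RightComodule.coact (f v)) :
    RightComodule k B V where
  coact := c
  coassoc := by
    refine LinearMap.ext fun v => ?_
    have hinj : Function.Injective (map f (map (i : B →ₗ[k] A) (i : B →ₗ[k] A))) :=
      TensorProduct.map_injective_of_flat_flat _ _ hf (map_injective hi hi)
    apply hinj
    have h1 : map f (map (i : B →ₗ[k] A) (i : B →ₗ[k] A)) ∘ₗ
        (TensorProduct.assoc k V B B).toLinearMap ∘ₗ c.rTensor B =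
        (TensorProduct.assoc k W A A).toLinearMap ∘ₗ
          (RightComodule.coact (k := k) (A := A)).rTensor A ∘ₗ map f (i : B →ₗ[k] A) := by
      have h3 : ∀ (b : B) (t : V ⊗[k] B), map f (map (i : B →ₗ[k] A) (i : B →ₗ[k] A))
          (TensorProduct.assoc k V B B (t ⊗ₜ b)) =
          TensorProduct.assoc k W A A (map f (i : B →ₗ[k] A) t ⊗ₜ i b) := by
        intro b t
        induction t with
        | zero => simp
        | add s t hs ht => simp only [TensorProduct.add_tmul, map_add, hs, ht]
        | tmul y z => simp
      refine TensorProduct.ext' fun x b => ?_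
      change map f _ (TensorProduct.assoc k V B B (c x ⊗ₜ b)) =
        TensorProduct.assoc k W A A (RightComodule.coact (f x) ⊗ₜ i b)
      rw [h3, hc]
    have h2 : map f (map (i : B →ₗ[k] A) (i : B →ₗ[k] A)) ∘ₗ
        (Coalgebra.comul (R := k)).lTensor V =
        (Coalgebra.comul (R := k)).lTensor W ∘ₗ map f (i : B →ₗ[k] A) := by
      refine TensorProduct.ext' fun x b => ?_
      change f x ⊗ₜ map (i : B →ₗ[k] A) (i : B →ₗ[k] A) (Coalgebra.comul b) =
        f x ⊗ₜ Coalgebra.comul (i b)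
      exact congrArg _ (CoalgHomClass.map_comp_comul_apply i b)
    have h1' := LinearMap.congr_fun h1 (c v)
    have h2' := LinearMap.congr_fun h2 (c v)
    simp only [LinearMap.comp_apply] at h1' h2' ⊢
    rw [h1', h2', hc]
    exact LinearMap.congr_fun RightComodule.coassoc (f v)
  counit_coact := by
    refine LinearMap.ext fun v => hf ?_
    have h1 : f ∘ₗ (TensorProduct.rid k V).toLinearMap ∘ₗ
        (Coalgebra.counit (R := k) (A := B)).lTensor V =
        (TensorProduct.rid k W).toLinearMap ∘ₗ (Coalgebra.counit (R := k) (A := A)).lTensor W ∘ₗ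
          map f (i : B →ₗ[k] A) := by
      refine TensorProduct.ext' fun x b => ?_
      simp
    have h1' := LinearMap.congr_fun h1 (c v)
    rw [LinearMap.comp_apply, LinearMap.comp_apply, LinearMap.comp_apply, LinearMap.comp_apply,
      hc] at h1'
    exact h1'.trans (LinearMap.congr_fun RightComodule.counit_coact (f v))

end ComoduleOfInjective

section DegreeOne

open TensorProduct MulOpposite

variable {k : Type u} [Field k] {A B : Type u} [Ring A] [HopfAlgebra k A] [Ring B]
  [HopfAlgebra k B] {i : B →ₐc[k] A} {Γ : Type v} [Group Γ] [Fintype Γ] [DecidableEq Γ]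
  {G : CocentralGrading k A Γ}

namespace CocentralGrading

lemma φ_antipode_mul_mul {g : Γ} {a c : A} (ha : a ∈ G.comp g) (hc : c ∈ G.comp g) (x : A) :
    G.φ 1 (HopfAlgebra.antipode k a * x * c) =
      Coalgebra.counit a * (Coalgebra.counit c * G.φ 1 x) := by
  rw [G.φ_mul, Finset.sum_eq_single g⁻¹]
  · rw [φ_of_mem hc, if_pos (by group), G.φ_mul, Finset.sum_eq_single g⁻¹]
    · rw [φ_of_mem (antipode_mem_comp ha), if_pos rfl, inv_inv, mul_inv_cancel,
        HopfAlgebra.counit_antipode]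
      ring
    · intro h _ hh
      rw [φ_of_mem (antipode_mem_comp ha), if_neg hh, zero_mul]
    · simp
  · intro h _ hh
    rw [φ_of_mem hc, if_neg, mul_zero]
    rintro h1
    exact hh (by rw [← h1]; group)
  · simp

lemma lTensor_φ_ydTwist {V : Type u} [AddCommGroup V] [Module k V] [Module Aᵐᵒᵖ V]
    [IsScalarTower k Aᵐᵒᵖ V] (a : A) (s : V ⊗[k] A) :
    TensorProduct.rid k V ((G.φ 1).lTensor V (ydTwist k A V (comul₂ k A a) s)) =
      op a • TensorProduct.rid k V ((G.φ 1).lTensor V s) := by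
  induction a using induction_on (G := G) with
  | add a b ha hb => simp only [map_add, LinearMap.add_apply, ha, hb, MulOpposite.op_add, add_smul]
  | hom g a ha =>
    have key : LinearMap.llcomp k _ _ _ ((TensorProduct.rid k V).toLinearMap ∘ₗ
        (G.φ 1).lTensor V) ∘ₗ ydTwist k A V ∘ₗ map (G.prj g) (map (G.prj g) (G.prj g)) =
        LinearMap.lcomp k _ ((TensorProduct.rid k V).toLinearMap ∘ₗ
          (G.φ 1).lTensor V) ∘ₗ rightAct k A V ∘ₗ
          (TensorProduct.lid k A).toLinearMap ∘ₗ map (Coalgebra.counit (R := k) (A := A))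
        ((TensorProduct.rid k A).toLinearMap ∘ₗ
          (Coalgebra.counit (R := k) (A := A)).lTensor A) ∘ₗ
          map (G.prj g) (map (G.prj g) (G.prj g)) := by
      refine TensorProduct.ext_threefold' fun a b c => ?_
      refine TensorProduct.ext' fun v x => ?_
      simp [rightAct, smul_smul, φ_antipode_mul_mul (prj_mem_comp g a) (prj_mem_comp g c),
        mul_comm, mul_left_comm]
    have := LinearMap.congr_fun₂ key (comul₂ k A a) s
    simp only [LinearMap.comp_apply, LinearEquiv.coe_coe, map_prj_comul₂ ha,
      counit_comul₂] at this
    simpa [rightAct] using this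

variable (G) in
/-- The projection `x ↦ x₍₀₎ φ_1(x₍₁₎)` of a Yetter-Drinfeld module onto its part of degree `1`
for the grading induced by the coaction. -/
def degOne (X : YDModule k A) : X.carrier →ₗ[Aᵐᵒᵖ] X.carrier where
  toFun x := TensorProduct.rid k _ ((G.φ 1).lTensor _ (X.coact x))
  map_add' x y := by simp only [map_add]
  map_smul' a x := by
    rw [← op_unop a, X.yd, lTensor_φ_ydTwist]
    rfl

variable {X : YDModule k A}

lemma degOne_apply (x : X.carrier) :
    G.degOne X x = TensorProduct.rid k _ ((G.φ 1).lTensor _ (X.coact x)) := rfl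

lemma coact_rTensor_coact (x : X.carrier) : TensorProduct.assoc k _ A A
    (X.coact.rTensor A (X.coact x)) = (Coalgebra.comul (R := k)).lTensor _ (X.coact x) :=
  LinearMap.congr_fun X.comodule.coassoc x

lemma coact_degOne (x : X.carrier) :
    X.coact (G.degOne X x) = (G.prj 1).lTensor _ (X.coact x) := by
  have h : X.coact ∘ₗ (TensorProduct.rid k _).toLinearMap ∘ₗ (G.φ 1).lTensor _ =
      ((TensorProduct.rid k A).toLinearMap ∘ₗ (G.φ 1).lTensor A).lTensor _ ∘ₗ
        (TensorProduct.assoc k X.carrier A A).toLinearMap ∘ₗ X.coact.rTensor A := by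
    have h' : ∀ (a : A) (t : X.carrier ⊗[k] A), G.φ 1 a • t =
        ((TensorProduct.rid k A).toLinearMap ∘ₗ (G.φ 1).lTensor A).lTensor _
          (TensorProduct.assoc k X.carrier A A (t ⊗ₜ a)) := by
      intro a t
      induction t with
      | zero => simp
      | add s t hs ht => simp only [TensorProduct.add_tmul, smul_add, map_add, hs, ht]
      | tmul y z => simp
    refine TensorProduct.ext' fun x a => ?_
    simpa using h' a (X.coact x)
  have h' := LinearMap.congr_fun h (X.coact x)
  simp only [LinearMap.comp_apply, LinearEquiv.coe_coe, coact_rTensor_coact] at h'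
  refine h'.trans ?_
  rw [← LinearMap.lTensor_comp_apply]
  rfl

lemma rTensor_degOne_coact (x : X.carrier) :
    ((G.degOne X).restrictScalars k).rTensor A (X.coact x) = X.coact (G.degOne X x) := by
  have e : (G.degOne X).restrictScalars k =
      (TensorProduct.rid k _).toLinearMap ∘ₗ (G.φ 1).lTensor _ ∘ₗ X.coact := rfl
  have h : ((TensorProduct.rid k X.carrier).toLinearMap ∘ₗ (G.φ 1).lTensor _).rTensor A =
      ((TensorProduct.lid k A).toLinearMap ∘ₗ (G.φ 1).rTensor A).lTensor _ ∘ₗ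
        (TensorProduct.assoc k X.carrier A A).toLinearMap := by
    refine TensorProduct.ext_threefold fun x a b => ?_
    simp [TensorProduct.smul_tmul]
  rw [e, ← LinearMap.comp_assoc, LinearMap.rTensor_comp_apply, h, LinearMap.comp_apply,
    LinearEquiv.coe_coe, coact_rTensor_coact, ← LinearMap.lTensor_comp_apply, coact_degOne, prj_eq]
  rfl

@[simp] lemma degOne_degOne (x : X.carrier) : G.degOne X (G.degOne X x) = G.degOne X x := by
  have h : G.φ 1 ∘ₗ G.prj 1 = G.φ 1 := LinearMap.ext fun a => by
    rw [LinearMap.comp_apply, φ_prj, if_pos rfl]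
  rw [degOne_apply, coact_degOne, ← LinearMap.lTensor_comp_apply, h]
  rfl

/-- Morphisms of Yetter-Drinfeld modules preserve the degree. -/
lemma degOne_mapOf {Y : YDModule k A} (f : X ⟶ Y) (x : X.carrier) :
    G.degOne Y (YDModule.mapOf f x) = YDModule.mapOf f (G.degOne X x) := by
  have h : (TensorProduct.rid k Y.carrier).toLinearMap ∘ₗ (G.φ 1).lTensor _ ∘ₗ
      ((YDModule.mapOf f).restrictScalars k).rTensor A =
      (YDModule.mapOf f).restrictScalars k ∘ₗ (TensorProduct.rid k _).toLinearMap ∘ₗ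
        (G.φ 1).lTensor _ := by
    refine TensorProduct.ext' fun x a => ?_
    simp
  rw [degOne_apply, YDModule.coact_mapOf]
  exact LinearMap.congr_fun h (X.coact x)

end CocentralGrading

end DegreeOne

/-! ### Restriction and induction functors for Yetter-Drinfeld modules -/

section Functors

open TensorProduct MulOpposite CocentralGrading

variable {k : Type u} [Field k] {A B : Type u} [Ring A] [HopfAlgebra k A] [Ring B]
  [HopfAlgebra k B] {i : B →ₐc[k] A} {Γ : Type v} [Group Γ] [Fintype Γ] [DecidableEq Γ]
  {G : CocentralGrading k A Γ}

/-- The part of degree `1` of a Yetter-Drinfeld module `X` over `A`. The type depends on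
`i : B → A` because it carries the action of `B` through `i`. -/
def DegOne (_ : B →ₐc[k] A) (G : CocentralGrading k A Γ) (X : YDModule k A) : Type u :=
  LinearMap.eqLocus (G.degOne X) LinearMap.id

namespace DegOne

variable {X : YDModule k A}

instance : AddCommGroup (DegOne i G X) :=
  inferInstanceAs (AddCommGroup (LinearMap.eqLocus (G.degOne X) LinearMap.id))

instance : Module k (DegOne i G X) :=
  inferInstanceAs (Module k (LinearMap.eqLocus (G.degOne X) LinearMap.id))

instance : Module Bᵐᵒᵖ (DegOne i G X) :=
  Module.compHom (LinearMap.eqLocus (G.degOne X) LinearMap.id) (RingHom.op (i : B →+* A))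

variable (i G X) in
/-- The inclusion of the part of degree `1`. -/
def incl : DegOne i G X →ₗ[k] X.carrier :=
  (LinearMap.eqLocus (G.degOne X) LinearMap.id).subtype.restrictScalars k

variable (i G X) in
/-- The projection onto the part of degree `1`. -/
def projn : X.carrier →ₗ[k] DegOne i G X :=
  ((G.degOne X).codRestrict (LinearMap.eqLocus (G.degOne X) LinearMap.id)
    degOne_degOne).restrictScalars k

lemma incl_injective : Function.Injective (incl i G X) := Subtype.val_injective

lemma incl_smul (b : B) (x : DegOne i G X) : incl i G X (op b • x) = op (i b) • incl i G X x := rfl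

@[simp] lemma degOne_incl (x : DegOne i G X) : G.degOne X (incl i G X x) = incl i G X x := x.2

@[simp] lemma incl_projn (x : X.carrier) : incl i G X (projn i G X x) = G.degOne X x := rfl

@[simp] lemma projn_incl (x : DegOne i G X) : projn i G X (incl i G X x) = x :=
  incl_injective (by simp)

lemma projn_smul (b : B) (x : X.carrier) :
    projn i G X (op (i b) • x) = op b • projn i G X x :=
  incl_injective (by rw [incl_projn, map_smul, incl_smul, incl_projn])

instance : IsScalarTower k Bᵐᵒᵖ (DegOne i G X) where
  smul_assoc r b x := incl_injective (by
    rw [(incl i G X).map_smul]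
    change op (i (unop (r • b))) • incl i G X x = r • op (i (unop b)) • incl i G X x
    rw [unop_smul, map_smul, op_smul, smul_assoc])

end DegOne

variable (hi : IsDegreeOne i G)

namespace IsDegreeOne

open DegOne

/-- The coaction of `B` on the part of degree `1`. -/
def degOneCoact (X : YDModule k A) : DegOne i G X →ₗ[k] DegOne i G X ⊗[k] B :=
  map (projn i G X) hi.proj ∘ₗ X.coact ∘ₗ incl i G X

lemma map_incl_map_projn {X : YDModule k A} (x : X.carrier) :
    map (incl i G X) (i : B →ₗ[k] A) (map (projn i G X) hi.proj (X.coact x)) =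
      X.coact (G.degOne X x) := by
  have h : map (incl i G X) (i : B →ₗ[k] A) ∘ₗ map (projn i G X) hi.proj =
      ((G.degOne X).restrictScalars k).rTensor A ∘ₗ (G.prj 1).lTensor _ := by
    refine TensorProduct.ext' fun x a => ?_
    simp [hi.map_proj]
  rw [← LinearMap.comp_apply, h, LinearMap.comp_apply, ← coact_degOne, rTensor_degOne_coact,
    degOne_degOne]

lemma map_degOneCoact {X : YDModule k A} (x : DegOne i G X) :
    map (incl i G X) (i : B →ₗ[k] A) (hi.degOneCoact X x) = X.coact (incl i G X x) :=
  (hi.map_incl_map_projn _).trans (by rw [degOne_incl])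

/-- The restriction of a Yetter-Drinfeld module over `A` to `B`: its part of degree `1`. -/
def resYD (X : YDModule k A) : YDModule k B :=
  letI : RightComodule k B (DegOne i G X) :=
    comoduleOfInjective hi.injective incl_injective (hi.degOneCoact X) hi.map_degOneCoact
  { carrier := DegOne i G X
    yd := fun x b => by
      apply map_injective hi.injective (f := incl i G X) incl_injective
      change map _ _ (hi.degOneCoact X _) = map _ _ (ydTwist k B _ _ (hi.degOneCoact X x))
      rw [map_ydTwist i _ incl_smul, hi.map_degOneCoact, hi.map_degOneCoact, incl_smul, X.yd] }

/-- The inclusion of the restriction of a Yetter-Drinfeld module. -/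
def resIncl (X : YDModule k A) : (hi.resYD X).carrier →ₗ[k] X.carrier := incl i G X

lemma resIncl_injective {X : YDModule k A} : Function.Injective (hi.resIncl X) := incl_injective

lemma resIncl_smul {X : YDModule k A} (b : B) (x : (hi.resYD X).carrier) :
    hi.resIncl X (op b • x) = op (i b) • hi.resIncl X x := incl_smul b x

lemma degOne_resIncl {X : YDModule k A} (x : (hi.resYD X).carrier) :
    G.degOne X (hi.resIncl X x) = hi.resIncl X x := degOne_incl x

lemma map_resIncl_coact {X : YDModule k A} (x : (hi.resYD X).carrier) :
    map (hi.resIncl X) (i : B →ₗ[k] A) ((hi.resYD X).coact x) = X.coact (hi.resIncl X x) :=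
  hi.map_degOneCoact x

/-- The projection onto the restriction of a Yetter-Drinfeld module. -/
def resProj (X : YDModule k A) : X.carrier →ₗ[k] (hi.resYD X).carrier := projn i G X

lemma resProj_smul {X : YDModule k A} (b : B) (x : X.carrier) :
    hi.resProj X (op (i b) • x) = op b • hi.resProj X x := projn_smul b x

@[simp] lemma resIncl_resProj {X : YDModule k A} (x : X.carrier) :
    hi.resIncl X (hi.resProj X x) = G.degOne X x := rfl

@[simp] lemma resProj_resIncl {X : YDModule k A} (x : (hi.resYD X).carrier) :
    hi.resProj X (hi.resIncl X x) = x := projn_incl x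

/-- The morphism into a restriction defined by a map into the ambient module that is compatible
with the actions and coactions and takes values of degree `1`. -/
def toResYD {W : YDModule k B} {X : YDModule k A} (f : W.carrier →ₗ[k] X.carrier)
    (hf : ∀ b w, f (op b • w) = op (i b) • f w) (hd : ∀ w, G.degOne X (f w) = f w)
    (hc : ∀ w, X.coact (f w) = map f (i : B →ₗ[k] A) (W.coact w)) : W ⟶ hi.resYD X :=
  (⟨{ toFun := fun w => hi.resProj X (f w)
      map_add' := fun v w => by rw [map_add, map_add]
      map_smul' := fun b w => (congrArg _ (hf b.unop w)).trans (hi.resProj_smul _ _) }, by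
    refine LinearMap.ext fun w => map_injective hi.injective hi.resIncl_injective ?_
    have h (w : W.carrier) : hi.resIncl X (hi.resProj X (f w)) = f w := hd w
    refine Eq.trans ?_ (hi.map_resIncl_coact (hi.resProj X (f w))).symm
    rw [h, hc, LinearMap.comp_apply, ← LinearMap.comp_apply (map _ _), LinearMap.map_comp_rTensor]
    congr 2
    exact LinearMap.ext h⟩ : YDModule.Hom W (hi.resYD X))

lemma resIncl_toResYD {W : YDModule k B} {X : YDModule k A} (f : W.carrier →ₗ[k] X.carrier)
    (hf : ∀ b w, f (op b • w) = op (i b) • f w) (hd : ∀ w, G.degOne X (f w) = f w)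
    (hc : ∀ w, X.coact (f w) = map f (i : B →ₗ[k] A) (W.coact w)) (w : W.carrier) :
    hi.resIncl X (YDModule.mapOf (hi.toResYD f hf hd hc) w) = f w := hd w

lemma resYD_hom_ext {W : YDModule k B} {X : YDModule k A} {f g : W ⟶ hi.resYD X}
    (h : ∀ w, hi.resIncl X (YDModule.mapOf f w) = hi.resIncl X (YDModule.mapOf g w)) : f = g :=
  YDModule.hom_ext fun w => hi.resIncl_injective (h w)

/-- The restriction of a morphism of Yetter-Drinfeld modules to the parts of degree `1`. -/
def resYDMap {X Y : YDModule k A} (f : X ⟶ Y) : hi.resYD X ⟶ hi.resYD Y :=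
  hi.toResYD ((YDModule.mapOf f).restrictScalars k ∘ₗ hi.resIncl X)
    (fun b x => (congrArg (YDModule.mapOf f) (hi.resIncl_smul b x)).trans
      (map_smul (YDModule.mapOf f) _ _))
    (fun x => (degOne_mapOf f _).trans (congrArg _ (hi.degOne_resIncl x)))
    (fun x => (YDModule.coact_mapOf f _).trans (by
      rw [← hi.map_resIncl_coact, ← LinearMap.comp_apply, LinearMap.rTensor_comp_map]))

lemma resIncl_resYDMap {X Y : YDModule k A} (f : X ⟶ Y) (x : (hi.resYD X).carrier) :
    hi.resIncl Y (YDModule.mapOf (hi.resYDMap f) x) = YDModule.mapOf f (hi.resIncl X x) :=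
  hi.resIncl_toResYD _ _ _ _ x

/-- Restriction of Yetter-Drinfeld modules from `A` to `B`. -/
def resYDFunctor : YDModule k A ⥤ YDModule k B where
  obj := hi.resYD
  map := hi.resYDMap
  map_id _ := hi.resYD_hom_ext fun _ => hi.resIncl_resYDMap _ _
  map_comp f g := hi.resYD_hom_ext fun x => (hi.resIncl_resYDMap _ x).trans
    ((hi.resIncl_resYDMap g _).trans
      (congrArg (YDModule.mapOf g) (hi.resIncl_resYDMap f x))).symm

instance : hi.resYDFunctor.Additive where
  map_add {_ _ f g} := hi.resYD_hom_ext fun x => (hi.resIncl_resYDMap _ x).trans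
    ((map_add (hi.resIncl _) _ _).trans
      (congrArg₂ (· + ·) (hi.resIncl_resYDMap f x) (hi.resIncl_resYDMap g x))).symm

end IsDegreeOne

variable (i) in
/-- The map of induced modules underlying `indYDMap`. -/
def indYDLin {W W' : YDModule k B} (f : W ⟶ W') : Ind i W.carrier →ₗ[Aᵐᵒᵖ] Ind i W'.carrier :=
  Ind.map i ((YDModule.mapOf f).restrictScalars k) fun b w => map_smul (YDModule.mapOf f) (op b) w

lemma indYDLin_of {W W' : YDModule k B} (f : W ⟶ W') (w : W.carrier) :
    indYDLin i f (Ind.of i w) = Ind.of i (YDModule.mapOf f w) :=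
  Ind.map_of i _ (fun b w => map_smul (YDModule.mapOf f) (op b) w) w

variable (i) in
/-- The morphism of induced Yetter-Drinfeld modules defined by a morphism. -/
def indYDMap {W W' : YDModule k B} (f : W ⟶ W') : indYD i W ⟶ indYD i W' :=
  indYDHom (V := indYD i W') (indYDLin i f) fun w => by
    have h : (indYDLin i f).restrictScalars k ∘ₗ Ind.of i =
        Ind.of i ∘ₗ (YDModule.mapOf f).restrictScalars k := LinearMap.ext (indYDLin_of f)
    refine (congrArg (indCoact i W') (indYDLin_of f w)).trans ((indCoact_of i W' _).trans ?_)
    rw [YDModule.coact_mapOf, ← LinearMap.comp_apply, LinearMap.map_comp_rTensor, ← h]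
    rfl

lemma indYDMap_of {W W' : YDModule k B} (f : W ⟶ W') (w : W.carrier) :
    YDModule.mapOf (indYDMap i f) (Ind.of i w) = Ind.of i (YDModule.mapOf f w) :=
  indYDLin_of f w

variable (i) in
/-- Induction of Yetter-Drinfeld modules from `B` to `A`. -/
def indYDFunctor : YDModule k B ⥤ YDModule k A where
  obj := indYD i
  map := indYDMap i
  map_id _ := indYD_hom_ext fun _ => indYDMap_of _ _
  map_comp f g := indYD_hom_ext fun w => (indYDMap_of _ w).trans
    ((congrArg _ (indYDMap_of f w)).trans (indYDMap_of g _)).symm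

instance : (indYDFunctor (k := k) i).Additive where
  map_add {_ _ f g} := indYD_hom_ext fun w => (indYDMap_of _ w).trans
    ((congrArg₂ (· + ·) (indYDMap_of f w) (indYDMap_of g w)).trans
      (map_add (Ind.of i) _ _).symm).symm

end Functors

/-! ### Adjunctions between Yetter-Drinfeld modules over `A` and over `B` -/

section AdjunctionsYD

open TensorProduct MulOpposite CocentralGrading

variable {k : Type u} [Field k] {A B : Type u} [Ring A] [HopfAlgebra k A] [Ring B]
  [HopfAlgebra k B] {i : B →ₐc[k] A} {Γ : Type v} [Group Γ] [Fintype Γ] [DecidableEq Γ]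
  {G : CocentralGrading k A Γ} (hi : IsDegreeOne i G)

namespace CocentralGrading

section

variable {X V : Type u} [AddCommGroup X] [Module k X] [Module Aᵐᵒᵖ X] [IsScalarTower k Aᵐᵒᵖ X]
  [AddCommGroup V] [Module k V] [Module Aᵐᵒᵖ V] [IsScalarTower k Aᵐᵒᵖ V]

variable (G) in
/-- Every element of an `A`-module is a sum of elements `y · t` with `t` of a prescribed degree
`g`. -/
lemma hom_ext_of_smul (g : Γ) {Z : Type*} [AddCommGroup Z] [Module k Z] {γ γ' : X →ₗ[k] Z}
    (h : ∀ t ∈ G.comp g, ∀ y, γ (op t • y) = γ' (op t • y)) : γ = γ' := by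
  refine LinearMap.ext fun x => ?_
  have key := comul_unitOf_induction (G := G) (g := g)
    (α := (γ ∘ₗ LinearMap.applyₗ x ∘ₗ rightAct k A X) ∘ₗ
      LinearMap.mul' k A ∘ₗ (HopfAlgebra.antipode k).rTensor A)
    (β := (γ' ∘ₗ LinearMap.applyₗ x ∘ₗ rightAct k A X) ∘ₗ
      LinearMap.mul' k A ∘ₗ (HopfAlgebra.antipode k).rTensor A)
    (fun y _ z hz => by simp [rightAct, h z hz])
  rw [apply_antipode_mul_comul_unitOf, apply_antipode_mul_comul_unitOf] at key
  simpa [rightAct] using key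

/-- A map that is compatible with the action of the elements of degree `g` is compatible with
`ydTwist` on the iterated comultiplication of such elements. -/
lemma rTensor_ydTwist_of_mem {g : Γ} {γ f : X →ₗ[k] V}
    (h : ∀ t ∈ G.comp g, ∀ x, γ (op t • x) = op t • f x) {t : A} (ht : t ∈ G.comp g)
    (s : X ⊗[k] A) :
    γ.rTensor A (ydTwist k A X (comul₂ k A t) s) =
      ydTwist k A V (comul₂ k A t) (f.rTensor A s) := by
  have key : LinearMap.llcomp k _ _ _ (γ.rTensor A) ∘ₗ ydTwist k A X ∘ₗ
      map (G.prj g) (map (G.prj g) (G.prj g)) =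
      LinearMap.lcomp k _ (f.rTensor A) ∘ₗ ydTwist k A V ∘ₗ
        map (G.prj g) (map (G.prj g) (G.prj g)) := by
    refine TensorProduct.ext_threefold' fun a b c => ?_
    refine TensorProduct.ext' fun v x => ?_
    simp [h _ (prj_mem_comp g b)]
  have := LinearMap.congr_fun₂ key (comul₂ k A t) s
  simp only [LinearMap.comp_apply, map_prj_comul₂ ht] at this
  exact this

end

end CocentralGrading

namespace IsDegreeOne

include hi in
/-- Induced Yetter-Drinfeld modules are concentrated in degree `1`. -/
lemma degOne_indYD (W : YDModule k B) (v : (indYD i W).carrier) : G.degOne (indYD i W) v = v := by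
  have h : G.degOne (indYD i W) = LinearMap.id := by
    refine Ind.hom_ext fun w => ?_
    have h1 : (TensorProduct.rid k _).toLinearMap ∘ₗ (G.φ 1).lTensor _ ∘ₗ
        map (Ind.of i) (i : B →ₗ[k] A) = Ind.of i ∘ₗ (TensorProduct.rid k W.carrier).toLinearMap ∘ₗ
          (Coalgebra.counit (R := k)).lTensor _ := by
      refine TensorProduct.ext' fun x b => ?_
      simp [φ_of_mem (hi.map_mem b)]
    have h2 := LinearMap.congr_fun h1 (W.coact w)
    have h3 := LinearMap.congr_fun W.comodule.counit_coact w
    simp only [LinearMap.comp_apply, LinearEquiv.coe_coe, LinearMap.id_apply] at h2 h3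
    rw [h3, ← indCoact_of] at h2
    exact h2
  exact LinearMap.congr_fun h v

/-- The unit `w ↦ w ⊗ 1` of induction and restriction. -/
def toResIndYD (W : YDModule k B) : W ⟶ hi.resYD (indYD i W) :=
  hi.toResYD (X := indYD i W) (Ind.of i) Ind.of_smul (fun _ => hi.degOne_indYD W _)
    (indCoact_of i W)

lemma resIncl_toResIndYD (W : YDModule k B) (w : W.carrier) :
    hi.resIncl (indYD i W) (YDModule.mapOf (hi.toResIndYD W) w) = Ind.of i w :=
  hi.resIncl_toResYD _ _ _ _ w

lemma toResIndYD_naturality {W W' : YDModule k B} (f : W ⟶ W') :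
    f ≫ hi.toResIndYD W' = hi.toResIndYD W ≫ hi.resYDMap (indYDMap i f) :=
  hi.resYD_hom_ext fun w => by
    have h := congrArg (YDModule.mapOf (indYDMap i f)) (hi.resIncl_toResIndYD W w)
    exact (hi.resIncl_toResIndYD W' _).trans
      (((hi.resIncl_resYDMap _ _).trans (h.trans (indYDMap_of f w))).symm)

/-- The `A`-linear map underlying `ofIndResYD`. -/
def ofIndResLin (X : YDModule k A) : Ind i (hi.resYD X).carrier →ₗ[Aᵐᵒᵖ] X.carrier :=
  Ind.lift (hi.resIncl X) fun b x => hi.resIncl_smul b x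

lemma ofIndResLin_of (X : YDModule k A) (x : (hi.resYD X).carrier) :
    hi.ofIndResLin X (Ind.of i x) = hi.resIncl X x :=
  Ind.lift_of _ (fun b x => hi.resIncl_smul b x) x

/-- The counit `x ⊗ a ↦ x · a` of induction and restriction. -/
def ofIndResYD (X : YDModule k A) : indYD i (hi.resYD X) ⟶ X :=
  indYDHom (hi.ofIndResLin X) fun x => by
    have h : (hi.ofIndResLin X).restrictScalars k ∘ₗ Ind.of i = hi.resIncl X :=
      LinearMap.ext (hi.ofIndResLin_of X)
    rw [h, hi.map_resIncl_coact, ofIndResLin_of]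

lemma ofIndResYD_of (X : YDModule k A) (x : (hi.resYD X).carrier) :
    YDModule.mapOf (hi.ofIndResYD X) (Ind.of i x) = hi.resIncl X x :=
  hi.ofIndResLin_of X x

lemma ofIndResYD_naturality {X Y : YDModule k A} (f : X ⟶ Y) :
    indYDMap i (hi.resYDMap f) ≫ hi.ofIndResYD Y = hi.ofIndResYD X ≫ f :=
  indYD_hom_ext fun x => by
    have h₁ := congrArg (YDModule.mapOf (hi.ofIndResYD Y)) (indYDMap_of (hi.resYDMap f) x)
    have h₂ := congrArg (YDModule.mapOf f) (hi.ofIndResYD_of X x)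
    exact h₁.trans ((hi.ofIndResYD_of Y _).trans ((hi.resIncl_resYDMap f x).trans h₂.symm))

lemma indYDMap_toResIndYD_comp (W : YDModule k B) :
    indYDMap i (hi.toResIndYD W) ≫ hi.ofIndResYD (indYD i W) = 𝟙 (indYD i W) :=
  indYD_hom_ext fun w => by
    have h := congrArg (YDModule.mapOf (hi.ofIndResYD (indYD i W)))
      (indYDMap_of (hi.toResIndYD W) w)
    exact h.trans ((hi.ofIndResYD_of _ _).trans (hi.resIncl_toResIndYD W w))

lemma toResIndYD_comp_resYDMap (X : YDModule k A) :
    hi.toResIndYD (hi.resYD X) ≫ hi.resYDMap (hi.ofIndResYD X) = 𝟙 (hi.resYD X) :=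
  hi.resYD_hom_ext fun x => by
    have h := congrArg (YDModule.mapOf (hi.ofIndResYD X)) (hi.resIncl_toResIndYD (hi.resYD X) x)
    exact (hi.resIncl_resYDMap (hi.ofIndResYD X) _).trans (h.trans (hi.ofIndResYD_of X x))

/-- Induction of Yetter-Drinfeld modules is left adjoint to restriction. -/
def indResYDAdjunction : indYDFunctor i ⊣ hi.resYDFunctor :=
  Adjunction.mkOfUnitCounit
    { unit := { app := hi.toResIndYD, naturality _ _ := hi.toResIndYD_naturality }
      counit := { app := hi.ofIndResYD, naturality _ _ := hi.ofIndResYD_naturality }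
      left_triangle := by
        ext W : 2
        simp only [NatTrans.comp_app, Functor.whiskerRight_app, Functor.associator_hom_app,
          Functor.whiskerLeft_app]
        exact hi.indYDMap_toResIndYD_comp W
      right_triangle := by
        ext X : 2
        simp only [NatTrans.comp_app, Functor.whiskerRight_app, Functor.associator_inv_app,
          Functor.whiskerLeft_app, Category.id_comp]
        exact hi.toResIndYD_comp_resYDMap X }

lemma coact_resProj {X : YDModule k A} (x : X.carrier) :
    (hi.resYD X).coact (hi.resProj X x) = map (hi.resProj X) hi.proj (X.coact x) := by
  apply map_injective hi.injective hi.resIncl_injective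
  rw [map_resIncl_coact, resIncl_resProj]
  exact (hi.map_incl_map_projn x).symm

/-- The map `x ↦ x₁ ⊗ 1`, where `x₁` is the part of degree `1`, is colinear. -/
lemma indCoact_of_resProj {X : YDModule k A} (x : X.carrier) :
    indCoact i (hi.resYD X) (Ind.of i (hi.resProj X x)) =
      (Ind.of i ∘ₗ hi.resProj X).rTensor A (X.coact x) := by
  have h1 : map (Ind.of i) (i : B →ₗ[k] A) ∘ₗ map (hi.resProj X) hi.proj =
      (Ind.of i ∘ₗ hi.resProj X).rTensor A ∘ₗ (G.prj 1).lTensor _ := by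
    refine TensorProduct.ext' fun x a => ?_
    simp [hi.map_proj]
  have h2 : hi.resProj X ∘ₗ (G.degOne X).restrictScalars k = hi.resProj X :=
    LinearMap.ext fun x => hi.resIncl_injective (degOne_degOne x)
  rw [indCoact_of, coact_resProj, ← LinearMap.comp_apply (map _ _), h1, LinearMap.comp_apply,
    ← coact_degOne, ← rTensor_degOne_coact, ← LinearMap.rTensor_comp_apply, LinearMap.comp_assoc,
    h2]

/-- The `A`-linear map underlying `toIndResYD`. -/
def toIndResLin (X : YDModule k A) : X.carrier →ₗ[Aᵐᵒᵖ] Ind i (hi.resYD X).carrier :=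
  hi.coind (hi.resProj X) fun b x => hi.resProj_smul b x

lemma toIndResLin_colinear (X : YDModule k A) :
    ((hi.toIndResLin X).restrictScalars k).rTensor A ∘ₗ X.coact =
      indCoact i (hi.resYD X) ∘ₗ (hi.toIndResLin X).restrictScalars k := by
  have h : ∀ g, indCoact i (hi.resYD X) ∘ₗ G.avgPart (Ind.of i ∘ₗ hi.resProj X) g =
      (G.avgPart (Ind.of i ∘ₗ hi.resProj X) g).rTensor A ∘ₗ X.coact := by
    intro g
    have hs : ∀ t ∈ G.comp g, ∀ y, G.avgPart (Ind.of i ∘ₗ hi.resProj X) g (op t • y) =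
        op t • (Ind.of i ∘ₗ hi.resProj X) y := fun t ht y =>
      avgPart_smul hi.exists_of_mem (of_comp_smul _ fun b x => hi.resProj_smul b x) ht y
    refine hom_ext_of_smul G g fun t ht y => ?_
    rw [LinearMap.comp_apply, LinearMap.comp_apply, hs t ht, indCoact_smul, X.yd,
      rTensor_ydTwist_of_mem hs ht]
    exact congrArg _ (hi.indCoact_of_resProj y)
  have e : (hi.toIndResLin X).restrictScalars k =
      ∑ g, G.avgPart (Ind.of i ∘ₗ hi.resProj X) g := rfl
  refine LinearMap.ext fun x => ?_
  rw [e, ← LinearMap.coe_rTensorHom, map_sum, LinearMap.comp_apply, LinearMap.comp_apply,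
    LinearMap.sum_apply, LinearMap.sum_apply, map_sum]
  exact Finset.sum_congr rfl fun g _ => (LinearMap.congr_fun (h g) x).symm

/-- The unit of restriction and induction, the average of `x ↦ x₁ ⊗ 1`, where `x₁` is the part of
degree `1`. -/
def toIndResYD (X : YDModule k A) : X ⟶ indYD i (hi.resYD X) :=
  (⟨hi.toIndResLin X, hi.toIndResLin_colinear X⟩ : YDModule.Hom X (indYD i (hi.resYD X)))

lemma toIndResYD_naturality {X Y : YDModule k A} (f : X ⟶ Y) :
    f ≫ hi.toIndResYD Y = hi.toIndResYD X ≫ indYDMap i (hi.resYDMap f) :=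
  YDModule.hom_ext fun x => by
    have h (x : X.carrier) : indYDLin i (hi.resYDMap f) (Ind.of i (hi.resProj X x)) =
        Ind.of i (hi.resProj Y (YDModule.mapOf f x)) := by
      rw [indYDLin_of]
      congr 1
      exact hi.resIncl_injective ((hi.resIncl_resYDMap f _).trans (degOne_mapOf f x).symm)
    exact (hi.coind_natural (hi.resProj X) (fun b x => hi.resProj_smul b x) (hi.resProj Y)
      (fun b x => hi.resProj_smul b x) (YDModule.mapOf f) (indYDLin i (hi.resYDMap f)) h x).symm

/-- The morphism out of a restriction defined by a map on the ambient module. -/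
def fromResYD {W : YDModule k B} {X : YDModule k A} (q : X.carrier →ₗ[k] W.carrier)
    (hq : ∀ b x, q (op (i b) • x) = op b • q x)
    (hc : ∀ x, (i : B →ₗ[k] A).lTensor _ (W.coact (q x)) = q.rTensor A (X.coact x)) :
    hi.resYD X ⟶ W :=
  (⟨{ toFun := fun x => q (hi.resIncl X x)
      map_add' := fun x y => by rw [map_add, map_add]
      map_smul' := fun b x => (congrArg q (hi.resIncl_smul b.unop x)).trans (hq _ _) }, by
    refine LinearMap.ext fun x =>
      map_injective hi.injective (f := LinearMap.id) Function.injective_id ?_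
    refine Eq.trans ?_ (hc (hi.resIncl X x)).symm
    rw [← map_resIncl_coact, LinearMap.comp_apply, ← LinearMap.comp_apply (map _ _),
      LinearMap.map_comp_rTensor, ← LinearMap.comp_apply (LinearMap.rTensor _ _),
      LinearMap.rTensor_comp_map]
    rfl⟩ : YDModule.Hom (hi.resYD X) W)

lemma lTensor_coact_indProj (W : YDModule k B) (v : Ind i W.carrier) :
    (i : B →ₗ[k] A).lTensor _ (W.coact (hi.indProj W.carrier v)) =
      (hi.indProj W.carrier).rTensor A (indCoact i W v) := by
  have h1 : ∀ w, (i : B →ₗ[k] A).lTensor _ (W.coact (hi.indProj W.carrier (Ind.of i w))) =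
      (hi.indProj W.carrier).rTensor A (indCoact i W (Ind.of i w)) := by
    intro w
    have e : hi.indProj W.carrier ∘ₗ Ind.of i = LinearMap.id := LinearMap.ext hi.indProj_of
    rw [indCoact_of, indProj_of, ← LinearMap.comp_apply (LinearMap.rTensor _ _),
      LinearMap.rTensor_comp_map, e]
    rfl
  induction v using Ind.induction_on with
  | add x y hx hy => simp only [map_add, hx, hy]
  | smul_of a w =>
    induction a using induction_on (G := G) with
    | add a b ha hb => simp only [MulOpposite.op_add, add_smul, map_add, ha, hb]
    | hom g a ha =>
      by_cases hg : g = 1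
      · subst hg
        obtain ⟨b, rfl⟩ := hi.exists_of_mem a ha
        rw [← Ind.of_smul]
        exact h1 _
      · have key : LinearMap.llcomp k _ _ _ ((hi.indProj W.carrier).rTensor A) ∘ₗ
            LinearMap.lcomp k _ (map (Ind.of i) (i : B →ₗ[k] A)) ∘ₗ
            ydTwist k A _ ∘ₗ map (G.prj g) (map (G.prj g) (G.prj g)) = 0 := by
          refine TensorProduct.ext_threefold' fun a b c => ?_
          refine TensorProduct.ext' fun v x => ?_
          simp [hi.proj_of_mem hg (prj_mem_comp g b)]
        have key' := LinearMap.congr_fun₂ key (comul₂ k A a) (W.coact w)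
        simp only [LinearMap.comp_apply, map_prj_comul₂ ha] at key'
        rw [indProj_smul_of, hi.proj_of_mem hg ha, MulOpposite.op_zero, zero_smul, map_zero,
          map_zero, indCoact_smul_of]
        exact key'.symm

/-- The counit of restriction and induction, the projection onto degree `1`. -/
def ofResIndYD (W : YDModule k B) : hi.resYD (indYD i W) ⟶ W :=
  hi.fromResYD (X := indYD i W) (hi.indProj W.carrier) hi.indProj_smul
    (hi.lTensor_coact_indProj W)

lemma ofResIndYD_naturality {W W' : YDModule k B} (f : W ⟶ W') :
    hi.resYDMap (indYDMap i f) ≫ hi.ofResIndYD W' = hi.ofResIndYD W ≫ f :=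
  YDModule.hom_ext fun x => by
    have h := congrArg (hi.indProj W'.carrier) (hi.resIncl_resYDMap (indYDMap i f) x)
    exact h.trans (hi.indProj_natural (indYDLin i f) (YDModule.mapOf f) (indYDLin_of f) _)

lemma resYDMap_toIndResYD_comp (X : YDModule k A) :
    hi.resYDMap (hi.toIndResYD X) ≫ hi.ofResIndYD (hi.resYD X) = 𝟙 (hi.resYD X) :=
  YDModule.hom_ext fun x => by
    have h := congrArg (hi.indProj (hi.resYD X).carrier) (hi.resIncl_resYDMap (hi.toIndResYD X) x)
    exact h.trans ((hi.indProj_coind (hi.resProj X) (fun b x => hi.resProj_smul b x) _).trans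
      (hi.resProj_resIncl x))

lemma toIndResYD_comp_indYDMap (W : YDModule k B) :
    hi.toIndResYD (indYD i W) ≫ indYDMap i (hi.ofResIndYD W) = 𝟙 (indYD i W) :=
  YDModule.hom_ext fun v => by
    have h (v : Ind i W.carrier) : indYDLin i (hi.ofResIndYD W)
        (Ind.of i (hi.resProj (indYD i W) v)) = Ind.of i (hi.indProj W.carrier v) := by
      rw [indYDLin_of]
      exact congrArg (fun v => Ind.of i (hi.indProj W.carrier v)) (hi.degOne_indYD W v)
    exact (hi.coind_natural (hi.resProj (indYD i W)) (fun b x => hi.resProj_smul b x)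
      (hi.indProj W.carrier) hi.indProj_smul (LinearMap.id : Ind i W.carrier →ₗ[Aᵐᵒᵖ] _)
      (indYDLin i (hi.ofResIndYD W)) h v).trans (hi.coind_indProj v)

/-- Induction of Yetter-Drinfeld modules is also right adjoint to restriction. -/
def resIndYDAdjunction : hi.resYDFunctor ⊣ indYDFunctor i :=
  Adjunction.mkOfUnitCounit
    { unit := { app := hi.toIndResYD, naturality _ _ := hi.toIndResYD_naturality }
      counit := { app := hi.ofResIndYD, naturality _ _ := hi.ofResIndYD_naturality }
      left_triangle := by
        ext X : 2
        simp only [NatTrans.comp_app, Functor.whiskerRight_app, Functor.associator_hom_app,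
          Functor.whiskerLeft_app]
        exact hi.resYDMap_toIndResYD_comp X
      right_triangle := by
        ext W : 2
        simp only [NatTrans.comp_app, Functor.whiskerRight_app, Functor.associator_inv_app,
          Functor.whiskerLeft_app, Category.id_comp]
        exact hi.toIndResYD_comp_indYDMap W }

end IsDegreeOne

end AdjunctionsYD

/-! ### Invariance of the Gerstenhaber-Schack cohomological dimension -/

section GerstenhaberSchack

open TensorProduct MulOpposite CocentralGrading

variable {k : Type u} [Field k] {A B : Type u} [Ring A] [HopfAlgebra k A] [Ring B]
  [HopfAlgebra k B] {i : B →ₐc[k] A} {Γ : Type v} [Group Γ] [Fintype Γ] [DecidableEq Γ]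
  {G : CocentralGrading k A Γ} (hi : IsDegreeOne i G)

/-- Multiplication by a scalar, as an endomorphism of a Yetter-Drinfeld module. -/
def scalarHom (r : k) (X : YDModule k A) : X ⟶ X :=
  (⟨{ toFun := fun x => r • x
      map_add' := smul_add r
      map_smul' := fun a x => smul_comm r a x }, by
    have h : LinearMap.restrictScalars k
        ({ toFun := fun x => r • x
           map_add' := smul_add r
           map_smul' := fun a x => smul_comm r a x } : X.carrier →ₗ[Aᵐᵒᵖ] X.carrier) =
        r • LinearMap.id := rfl
    rw [h, LinearMap.rTensor_smul, LinearMap.rTensor_id, LinearMap.smul_comp, LinearMap.comp_smul]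
    rfl⟩ : YDModule.Hom X X)

namespace IsDegreeOne

/-- Maschke's argument: if the order of `Γ` is invertible, every Yetter-Drinfeld module of degree
`1` is a retract of one induced from `B`. -/
def retractIndYD (hΓ : (Fintype.card Γ : k) ≠ 0) (X : YDModule k A)
    (hX : ∀ x, G.degOne X x = x) :
    Retract X ((indYDFunctor i).obj (hi.resYDFunctor.obj X)) where
  i := hi.toIndResYD X
  r := hi.ofIndResYD X ≫ scalarHom (Fintype.card Γ : k)⁻¹ X
  retract := YDModule.hom_ext fun x => by
    have h : hi.ofIndResLin X (hi.toIndResLin X x) = Fintype.card Γ • x :=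
      hi.map_coind (hi.resProj X) (fun b x => hi.resProj_smul b x) (hi.ofIndResLin X)
        (fun x => (hi.ofIndResLin_of X _).trans (hX x)) x
    refine (congrArg ((Fintype.card Γ : k)⁻¹ • ·) h).trans ?_
    change (Fintype.card Γ : k)⁻¹ • Fintype.card Γ • x = x
    rw [← Nat.cast_smul_eq_nsmul k, inv_smul_smul₀ hΓ]

end IsDegreeOne

variable (G) in
lemma degOne_trivial (x : k) : G.degOne (YDModule.trivial k A) x = x := by
  have h : G.degOne (YDModule.trivial k A) x = G.φ 1 1 • x :=
    TensorProduct.rid_tmul x (G.φ 1 1)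
  rw [h, φ_of_mem one_mem_comp, if_pos rfl, Bialgebra.counit_one, one_smul]

namespace IsDegreeOne

/-- The trivial Yetter-Drinfeld module over `A` restricts to the one over `B`. -/
def resYDTrivialIso : hi.resYD (YDModule.trivial k A) ≅ YDModule.trivial k B where
  hom := hi.fromResYD (W := YDModule.trivial k B) (X := YDModule.trivial k A)
    (LinearMap.id : k →ₗ[k] k)
    (fun b x => congrArg (· * (show k from x)) (CoalgHomClass.counit_comp_apply i b))
    (fun x => congrArg (x ⊗ₜ[k] ·) (map_one i))
  inv := hi.toResYD (W := YDModule.trivial k B) (X := YDModule.trivial k A)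
    (LinearMap.id : k →ₗ[k] k)
    (fun b x => congrArg (· * (show k from x)) (CoalgHomClass.counit_comp_apply i b).symm)
    (degOne_trivial G)
    (fun x => congrArg (x ⊗ₜ[k] ·) (map_one i).symm)
  hom_inv_id := hi.resYD_hom_ext fun x => hi.degOne_resIncl x
  inv_hom_id := YDModule.hom_ext fun x => degOne_trivial G x

include hi in
/-- A Hopf subalgebra that is the degree one part for a cocentral grading by a finite group of
invertible order has the same Gerstenhaber-Schack cohomological dimension. -/
theorem cdGS_eq (hΓ : (Fintype.card Γ : k) ≠ 0) : cdGS k A = cdGS k B :=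
  ((extDim_eq_of_iso hi.resYDTrivialIso.symm).trans
    (extDim_obj_eq_of_adjunctions hi.resIndYDAdjunction hi.indResYDAdjunction
      (hi.retractIndYD hΓ _ (degOne_trivial G)))).symm

end IsDegreeOne

end GerstenhaberSchack

end HopfDim

end

theorem theorem4 {k : Type u} [Field k] [IsAlgClosed k] [CharZero k]
    {A B : Type u} [Ring A] [HopfAlgebra k A] [Ring B] [HopfAlgebra k B]
    {Γ : Type v} [CommGroup Γ] [Finite Γ]
    (i : B →ₐc[k] A) (p : A →ₐc[k] MonoidAlgebra k Γ)
    (hex : HopfDim.IsHopfExact i p) (hp : HopfDim.IsCocentral p) :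
    HopfDim.cd k A = HopfDim.cd k B ∧
      (HopfDim.IsCosemisimple k A → HopfDim.cdGS k A = HopfDim.cdGS k B) := by
  classical
  cases nonempty_fintype Γ
  have hi : HopfDim.IsDegreeOne i (HopfDim.gradingOfCocentral p hex.surjective hp) :=
    ⟨hex.injective, fun a => (HopfDim.mem_comp_one_iff p hex.surjective hp a).trans
      (hex.mem_range_iff_right a).symm⟩
  have hΓ : (Fintype.card Γ : k) ≠ 0 := Nat.cast_ne_zero.2 Fintype.card_ne_zero
  exact ⟨hi.cd_eq hΓ, fun _ => hi.cdGS_eq hΓ⟩
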